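/- For a directed set $\Lambda$ and a family of C$^*$-algebras $(B_\lambda)_{\lambda\in\Lambda}$ let $\prod_\lambda B_\lambda$ be the C$^*$-algebra of norm-bounded nets $(x_\lambda)$ and $\bigoplus_\lambda B_\lambda$ its closed ideal of nets with $\lim_\lambda\|x_\lambda\|=0$. A linear map between C$^*$-algebras is c.p.c. if it is completely positive and contractive, and it has order $0$ if it maps orthogonal positive elements to orthogonal elements. A C$^*$-algebra $A$ has nuclear dimension at most $\omega$ if there are a nonempty directed set $\Lambda$ and, for $i=0,1,2,\dots$ and $\lambda\in\Lambda$, finite-dimensional C$^*$-algebras $F^i_\lambda$ and c.p.c. maps $\psi^i_\lambda\colon A\to F^i_\lambda$ and $\phi^i_\lambda\colon F^i_\lambda\to A$ such that (1) for every $i$ the induced maps $\psi^i\colon A\to \prod_\lambda F^i_\lambda/\bigoplus_\lambda F^i_\lambda$, $a\mapsto[(\psi^i_\lambda(a))_\lambda]$, and $\phi^i\colon \prod_\lambda F^i_\lambda/\bigoplus_\lambda F^i_\lambda\to \prod_\lambda A/\bigoplus_\lambda A$, $[(x_\lambda)_\lambda]\mapsto[(\phi^i_\lambda(x_\lambda))_\lambda]$,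 are c.p.c. of order $0$; (2) $\iota(a)=\sum_{i=0}^\infty \phi^i\psi^i(a)$ for all $a\in A$, the series being norm convergent, where $\iota\colon A\to\prod_\lambda A/\bigoplus_\lambda A$ is the diagonal embedding. Let $Cu(A)=W(A\otimes\mathcal K)$ be the stabilized Cuntz semigroup of $A$: the set of Cuntz equivalence classes of positive elements of $\bigcup_n M_n(A\otimes\mathcal K)$, where $\mathcal K$ is the algebra of compact operators on $\ell^2(\mathbb N)$, ordered by Cuntz subequivalence and with addition $[a]+[b]=[\mathrm{diag}(a,b)]$. For $x,y\in Cu(A)$ write $x\le_s y$ if $(k+1)x\le ky$ for some $k\in\mathbb N$, and let $\sum_{i=0}^\infty y_i$ denote the supremum in $Cu(A)$ of the partial sums of $(y_i)$. **Theorem.** Let $A$ be a C$^*$-algebra of nuclear dimension at most $\omega$. Then $Cu(A)$ has the $\omega$-comparison property: if $x,y_0,y_1,\dots\in Cu(A)$ satisfy $x\le_s y_i$ for all $i\ge 0$, then $\sum_{i=0}^\infty y_i$ exists and $x\le\sum_{i=0}^\infty y_i$. -/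

import Mathlib

universe u v w

noncomputable section

namespace CuntzComparison

open Filter Topology
open scoped ENNReal CStarAlgebra


section ProdModSum

variable {L : Type v} [Preorder L] (F : L → Type w) [∀ l, NonUnitalCStarAlgebra (F l)]

/-- The closed ideal `⨁ F l` of `∏ F l` (the algebra of bounded nets), consisting of the nets whose
norms tend to zero. -/
def nullNets : Submodule ℂ (lp F ∞) where
  carrier := {x | Tendsto (fun l => ‖x l‖) atTop (𝓝 0)}
  add_mem' {x y} hx hy := by
    refine squeeze_zero (fun _ => norm_nonneg _) (fun l => ?_) (by simpa using hx.add hy)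
    simpa using norm_add_le (x l) (y l)
  zero_mem' := by simpa using tendsto_const_nhds
  smul_mem' c x hx := by
    have : Tendsto (fun l => ‖c‖ * ‖x l‖) atTop (𝓝 0) := by simpa using hx.const_mul ‖c‖
    simpa [norm_smul] using this

variable {F} in
theorem mem_nullNets {x : lp F ∞} :
    x ∈ nullNets F ↔ Tendsto (fun l => ‖x l‖) atTop (𝓝 0) := Iff.rfl

variable {F} in
theorem mul_mem_nullNets_left (x : lp F ∞) {y : lp F ∞} (hy : y ∈ nullNets F) :
    x * y ∈ nullNets F := by
  rw [mem_nullNets] at *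
  refine squeeze_zero (fun _ => norm_nonneg _) (fun l => ?_) (by simpa using hy.const_mul ‖x‖)
  rw [lp.infty_coeFn_mul]
  exact (norm_mul_le _ _).trans
    (mul_le_mul_of_nonneg_right (lp.norm_apply_le_norm ENNReal.top_ne_zero x l) (norm_nonneg _))

variable {F} in
theorem star_mem_nullNets {x : lp F ∞} (hx : x ∈ nullNets F) : star x ∈ nullNets F := by
  rw [mem_nullNets] at *
  simpa [lp.star_apply] using hx

variable {F} in
theorem mul_mem_nullNets_right {x : lp F ∞} (y : lp F ∞) (hx : x ∈ nullNets F) :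
    x * y ∈ nullNets F := by
  have := star_mem_nullNets (mul_mem_nullNets_left (star y) (star_mem_nullNets hx))
  simpa using this

instance isClosed_nullNets : IsClosed (nullNets F : Set (lp F ∞)) := by
  refine isClosed_of_closure_subset fun x hx => ?_
  rw [SetLike.mem_coe, mem_nullNets, Metric.tendsto_nhds]
  intro e he
  obtain ⟨y, hy, hxy⟩ := Metric.mem_closure_iff.1 hx (e / 2) (by positivity)
  have hy' := (Metric.tendsto_nhds.1 (mem_nullNets.1 hy)) (e / 2) (by positivity)
  filter_upwards [hy'] with l hl
  simp only [dist_zero_right, norm_norm] at hl ⊢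
  have h1 := lp.norm_apply_le_norm ENNReal.top_ne_zero (x - y) l
  rw [dist_eq_norm] at hxy
  have h2 : x l = (x - y) l + y l := by simp
  rw [h2]
  exact (norm_add_le _ _).trans_lt (by linarith)

/-- The quotient C⋆-algebra `∏ F l / ⨁ F l` of bounded nets modulo null nets. -/
def ProdModSum : Type (max v w) := lp F ∞ ⧸ nullNets F

namespace ProdModSum

instance : NormedAddCommGroup (ProdModSum F) :=
  inferInstanceAs (NormedAddCommGroup (lp F ∞ ⧸ nullNets F))

instance : NormedSpace ℂ (ProdModSum F) :=
  inferInstanceAs (NormedSpace ℂ (lp F ∞ ⧸ nullNets F))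

instance : CompleteSpace (ProdModSum F) :=
  inferInstanceAs (CompleteSpace (lp F ∞ ⧸ nullNets F))

/-- The quotient map `∏ F l → ∏ F l / ⨁ F l`. -/
def mk : lp F ∞ →ₗ[ℂ] ProdModSum F := (nullNets F).mkQ

variable {F}

theorem mk_surjective : Function.Surjective (mk F) := (nullNets F).mkQ_surjective

theorem mk_eq_mk {x y : lp F ∞} : mk F x = mk F y ↔ x - y ∈ nullNets F :=
  Submodule.Quotient.eq _

theorem norm_mk_le (x : lp F ∞) : ‖mk F x‖ ≤ ‖x‖ := Submodule.Quotient.norm_mk_le _ x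

theorem exists_norm_lt (x : ProdModSum F) {e : ℝ} (he : 0 < e) :
    ∃ y : lp F ∞, mk F y = x ∧ ‖y‖ < ‖x‖ + e := Submodule.Quotient.norm_mk_lt x he

instance : Mul (ProdModSum F) where
  mul := Quotient.map₂ (· * ·) (by
    intro a b hab c d hcd
    rw [← Quotient.eq_iff_equiv] at hab hcd ⊢
    have h1 : a - b ∈ nullNets F := (Submodule.Quotient.eq _).1 hab
    have h2 : c - d ∈ nullNets F := (Submodule.Quotient.eq _).1 hcd
    refine (Submodule.Quotient.eq (nullNets F)).2 ?_
    have : a * c - b * d = (a - b) * c + b * (c - d) := by noncomm_ring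
    rw [this]
    exact add_mem (mul_mem_nullNets_right c h1) (mul_mem_nullNets_left b h2))

instance : Star (ProdModSum F) where
  star := Quotient.map star (by
    intro a b hab
    rw [← Quotient.eq_iff_equiv] at hab ⊢
    have h1 : a - b ∈ nullNets F := (Submodule.Quotient.eq _).1 hab
    refine (Submodule.Quotient.eq (nullNets F)).2 ?_
    rw [← star_sub]
    exact star_mem_nullNets h1)

theorem mk_mul (x y : lp F ∞) : mk F (x * y) = mk F x * mk F y := rfl

theorem mk_star (x : lp F ∞) : mk F (star x) = star (mk F x) := rfl

instance : NonUnitalNormedRing (ProdModSum F) where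
  __ := (inferInstance : NormedAddCommGroup (ProdModSum F))
  __ := (inferInstance : Mul (ProdModSum F))
  left_distrib a b c := by
    obtain ⟨a, rfl⟩ := mk_surjective a
    obtain ⟨b, rfl⟩ := mk_surjective b
    obtain ⟨c, rfl⟩ := mk_surjective c
    simp only [← map_add, ← mk_mul, mul_add]
  right_distrib a b c := by
    obtain ⟨a, rfl⟩ := mk_surjective a
    obtain ⟨b, rfl⟩ := mk_surjective b
    obtain ⟨c, rfl⟩ := mk_surjective c
    simp only [← map_add, ← mk_mul, add_mul]
  zero_mul a := by
    obtain ⟨a, rfl⟩ := mk_surjective a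
    rw [← map_zero (mk F), ← mk_mul, zero_mul]
  mul_zero a := by
    obtain ⟨a, rfl⟩ := mk_surjective a
    rw [← map_zero (mk F), ← mk_mul, mul_zero]
  mul_assoc a b c := by
    obtain ⟨a, rfl⟩ := mk_surjective a
    obtain ⟨b, rfl⟩ := mk_surjective b
    obtain ⟨c, rfl⟩ := mk_surjective c
    simp only [← mk_mul, mul_assoc]
  norm_mul_le a b := by
    have key : ∀ e : ℝ, 0 < e → ‖a * b‖ ≤ (‖a‖ + e) * (‖b‖ + e) := by
      intro e he
      obtain ⟨x, hx, hx'⟩ := exists_norm_lt a he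
      obtain ⟨y, hy, hy'⟩ := exists_norm_lt b he
      rw [← hx, ← hy, ← mk_mul, hx, hy]
      exact (norm_mk_le _).trans ((norm_mul_le _ _).trans
        (mul_le_mul hx'.le hy'.le (norm_nonneg _) (by positivity)))
    have hlim : Tendsto (fun e : ℝ => (‖a‖ + e) * (‖b‖ + e)) (𝓝[>] 0) (𝓝 (‖a‖ * ‖b‖)) := by
      have : Continuous fun e : ℝ => (‖a‖ + e) * (‖b‖ + e) := by fun_prop
      simpa using (this.tendsto 0).mono_left nhdsWithin_le_nhds
    exact ge_of_tendsto hlim (by filter_upwards [self_mem_nhdsWithin] with e he using key e he)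

instance : StarRing (ProdModSum F) where
  star_involutive a := by
    obtain ⟨a, rfl⟩ := mk_surjective a
    rw [← mk_star, ← mk_star, star_star]
  star_mul a b := by
    obtain ⟨a, rfl⟩ := mk_surjective a
    obtain ⟨b, rfl⟩ := mk_surjective b
    simp only [← mk_mul, ← mk_star, star_mul]
  star_add a b := by
    obtain ⟨a, rfl⟩ := mk_surjective a
    obtain ⟨b, rfl⟩ := mk_surjective b
    simp only [← map_add, ← mk_star, star_add]

/-- The norm of a class is bounded by any eventual bound of the norms of a representing net. -/
theorem norm_mk_le_of_eventually (x : lp F ∞) {r : ℝ} (hr : 0 ≤ r)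
    (h : ∀ᶠ l in atTop, ‖x l‖ ≤ r) : ‖mk F x‖ ≤ r := by
  classical
  let y : lp F ∞ := ⟨fun l => if ‖x l‖ ≤ r then x l else 0, by
    refine memℓp_infty ⟨r, ?_⟩
    rintro _ ⟨l, rfl⟩
    dsimp only
    split_ifs with hl
    · exact hl
    · simpa using hr⟩
  have hxy : mk F x = mk F y := by
    rw [mk_eq_mk, mem_nullNets]
    refine tendsto_const_nhds.congr' ?_
    filter_upwards [h] with l hl
    have : y l = x l := if_pos hl
    simp [this]
  rw [hxy]
  refine (norm_mk_le y).trans (lp.norm_le_of_forall_le hr fun l => ?_)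
  change ‖if ‖x l‖ ≤ r then x l else 0‖ ≤ r
  split_ifs with hl
  · exact hl
  · simpa using hr

/-- Every number above the norm of a class eventually bounds the norms of a representing net. -/
theorem eventually_norm_lt (x : lp F ∞) {r : ℝ} (hr : ‖mk F x‖ < r) :
    ∀ᶠ l in atTop, ‖x l‖ < r := by
  obtain ⟨y, hy, hyr⟩ := exists_norm_lt (mk F x) (half_pos (sub_pos.2 hr))
  have hd := (Metric.tendsto_nhds.1 (mem_nullNets.1 (mk_eq_mk.1 hy.symm))) _
    (half_pos (sub_pos.2 hr))
  filter_upwards [hd] with l hl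
  have h1 := lp.norm_apply_le_norm ENNReal.top_ne_zero y l
  have h2 : x l = (x - y) l + y l := by simp
  simp only [dist_zero_right, norm_norm] at hl
  rw [h2]
  exact (norm_add_le _ _).trans_lt (by linarith)

instance : CStarRing (ProdModSum F) where
  norm_mul_self_le a := by
    obtain ⟨x, rfl⟩ := mk_surjective a
    refine le_of_forall_pos_le_add fun e he => ?_
    have h := eventually_norm_lt (star x * x) (r := ‖star (mk F x) * mk F x‖ + e)
      (by rw [mk_mul, mk_star]; linarith)
    set r := ‖star (mk F x) * mk F x‖ + e with hr
    have hr0 : 0 ≤ r := by positivity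
    have h2 : ‖mk F x‖ ≤ √r := by
      refine norm_mk_le_of_eventually x (Real.sqrt_nonneg _) ?_
      filter_upwards [h] with l hl
      rw [lp.infty_coeFn_mul, Pi.mul_apply, lp.star_apply, CStarRing.norm_star_mul_self] at hl
      exact Real.le_sqrt_of_sq_le (by rw [sq]; exact hl.le)
    calc ‖mk F x‖ * ‖mk F x‖ ≤ √r * √r := by gcongr
      _ = r := Real.mul_self_sqrt hr0

instance : NonUnitalCStarAlgebra (ProdModSum F) where
  smul_assoc c a b := by
    obtain ⟨a, rfl⟩ := mk_surjective a
    obtain ⟨b, rfl⟩ := mk_surjective b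
    simp only [smul_eq_mul, ← mk_mul, ← map_smul, smul_mul_assoc]
  smul_comm c a b := by
    obtain ⟨a, rfl⟩ := mk_surjective a
    obtain ⟨b, rfl⟩ := mk_surjective b
    simp only [smul_eq_mul, ← mk_mul, ← map_smul, mul_smul_comm]
  star_smul c a := by
    obtain ⟨a, rfl⟩ := mk_surjective a
    simp only [← mk_star, ← map_smul, star_smul]

instance : PartialOrder (ProdModSum F) := CStarAlgebra.spectralOrder _

instance : StarOrderedRing (ProdModSum F) := CStarAlgebra.spectralOrderedRing _

section maps

variable {E : L → Type*} [∀ l, NonUnitalCStarAlgebra (E l)]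

/-- A family of linear contractions, acting on bounded nets. -/
def lpMap (T : ∀ l, E l →ₗ[ℂ] F l) (hT : ∀ l x, ‖T l x‖ ≤ ‖x‖) : lp E ∞ →ₗ[ℂ] lp F ∞ where
  toFun x := ⟨fun l => T l (x l), memℓp_infty ⟨‖x‖, by
    rintro _ ⟨l, rfl⟩
    exact (hT l _).trans (lp.norm_apply_le_norm ENNReal.top_ne_zero x l)⟩⟩
  map_add' x y := by ext l; exact map_add (T l) _ _
  map_smul' c x := by ext l; exact map_smul (T l) _ _

/-- The map `∏ E l / ⨁ E l → ∏ F l / ⨁ F l` induced by a family of linear contractions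
`E l → F l`. -/
def map (T : ∀ l, E l →ₗ[ℂ] F l) (hT : ∀ l x, ‖T l x‖ ≤ ‖x‖) : ProdModSum E →ₗ[ℂ] ProdModSum F :=
  (nullNets E).mapQ (nullNets F) (lpMap T hT) fun x hx =>
    squeeze_zero (fun _ => norm_nonneg _) (fun l => hT l (x l)) hx

end maps

variable (L) in
/-- The diagonal embedding `ι` of `A` into `∏ A / ⨁ A`, sending `a` to the class of the constant
net `a`. -/
def diag (A : Type u) [NonUnitalCStarAlgebra A] : A →ₗ[ℂ] ProdModSum (fun _ : L => A) :=
  mk (fun _ : L => A) ∘ₗ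
    { toFun a := ⟨fun _ => a, memℓp_infty ⟨‖a‖, by rintro _ ⟨l, rfl⟩; exact le_rfl⟩⟩
      map_add' _ _ := rfl
      map_smul' _ _ := rfl }

end ProdModSum

end ProdModSum

section Stabilization

variable (A : Type u) [NonUnitalCStarAlgebra A] [PartialOrder A] [StarOrderedRing A]

/-- `M_m(A)`. -/
abbrev Mat (m : ℕ) : Type u := CStarMatrix (Fin m) (Fin m) A

/-- The union `M_∞(A) = ⋃ M_n(A)` along the embeddings `a ↦ diag (a, 0)`, as a subalgebra of
`∏ M_m(A) / ⨁ M_m(A)`: a finitely supported matrix `a` over `ℕ` is represented by the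
sequence whose `m`-th term, for all large `m`, is the upper left `m × m` corner of `a`. -/
def finMatrices : NonUnitalStarSubalgebra ℂ (ProdModSum (Mat A)) where
  carrier := {x | ∃ y : lp (Mat A) ∞, ProdModSum.mk _ y = x ∧ ∃ (n : ℕ) (a : ℕ → ℕ → A),
    (∀ i j, n ≤ i ∨ n ≤ j → a i j = 0) ∧ ∀ m, n ≤ m → ∀ i j : Fin m, y m i j = a i j}
  add_mem' := by
    rintro _ _ ⟨y, rfl, n, a, ha, hy⟩ ⟨z, rfl, k, b, hb, hz⟩
    refine ⟨y + z, map_add _ _ _, max n k, fun i j => a i j + b i j, fun i j h => ?_,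
      fun m hm i j => ?_⟩
    · simp only [ha i j (by omega), hb i j (by omega), add_zero]
    · exact congrArg₂ (· + ·) (hy m (by omega) i j) (hz m (by omega) i j)
  zero_mem' := ⟨0, map_zero _, 0, fun _ _ => 0, fun _ _ _ => rfl, fun _ _ _ _ => rfl⟩
  mul_mem' := by
    rintro _ _ ⟨y, rfl, n, a, ha, hy⟩ ⟨z, rfl, k, b, hb, hz⟩
    refine ⟨y * z, ProdModSum.mk_mul _ _, max n k,
      fun i j => ∑ p ∈ Finset.range (max n k), a i p * b p j, fun i j h => ?_,
      fun m hm i j => ?_⟩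
    · refine Finset.sum_eq_zero fun p _ => ?_
      rcases h with h | h
      · rw [ha i p (by omega), zero_mul]
      · rw [hb p j (by omega), mul_zero]
    · rw [lp.infty_coeFn_mul, Pi.mul_apply, CStarMatrix.mul_apply]
      simp only [hy m (by omega), hz m (by omega)]
      rw [Fin.sum_univ_eq_sum_range (fun p => a i p * b p j)]
      refine (Finset.sum_subset (Finset.range_mono hm) fun p _ hp => ?_).symm
      rw [Finset.mem_range] at hp
      rw [ha i p (by omega), zero_mul]
  smul_mem' := by
    rintro c _ ⟨y, rfl, n, a, ha, hy⟩
    refine ⟨c • y, map_smul _ _ _, n, fun i j => c • a i j, fun i j h => ?_, fun m hm i j => ?_⟩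
    · simp only [ha i j h, smul_zero]
    · exact congrArg (c • ·) (hy m hm i j)
  star_mem' := by
    rintro _ ⟨y, rfl, n, a, ha, hy⟩
    refine ⟨star y, ProdModSum.mk_star _, n, fun i j => star (a j i), fun i j h => ?_,
      fun m hm i j => ?_⟩
    · simp only [ha j i h.symm, star_zero]
    · exact congrArg star (hy m hm j i)

/-- The stabilization `A ⊗ 𝒦`: the C⋆-algebraic inductive limit of the matrix algebras `M_n(A)`
along `a ↦ diag (a, 0)`, realized as the norm closure of `⋃ M_n(A)` in
`∏ M_m(A) / ⨁ M_m(A)`. -/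
def Stab : Type u := (finMatrices A).topologicalClosure

instance : NonUnitalCStarAlgebra (Stab A) :=
  NonUnitalStarSubalgebra.nonUnitalCStarAlgebra (finMatrices A).topologicalClosure
    (h_closed := (finMatrices A).isClosed_topologicalClosure)

instance : PartialOrder (Stab A) := CStarAlgebra.spectralOrder _

instance : StarOrderedRing (Stab A) := CStarAlgebra.spectralOrderedRing _

end Stabilization

section Cuntz

variable {B : Type u} [NonUnitalCStarAlgebra B] [PartialOrder B] [StarOrderedRing B]

/-- Cuntz subequivalence of a (positive) `m × m` matrix `a` and a (positive) `n × n` matrix `b`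
over `B`: there are `n × m` matrices `d` over `B` for which `d⋆ b d` is arbitrarily close to `a`. -/
def CuntzLE {m n : Type} [Fintype m] [Fintype n] (a : CStarMatrix m m B) (b : CStarMatrix n n B) :
    Prop :=
  a ∈ closure (Set.range fun d : CStarMatrix n m B => d.conjTranspose * b * d)

theorem mulAssoc {k l m n : Type} [Fintype l] [Fintype m] (x : CStarMatrix k l B)
    (y : CStarMatrix l m B) (z : CStarMatrix m n B) : x * y * z = x * (y * z) :=
  Matrix.mul_assoc (α := B) x y z

theorem conjTransposeMul {l m n : Type} [Fintype m] (x : CStarMatrix l m B)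
    (y : CStarMatrix m n B) : (x * y).conjTranspose = y.conjTranspose * x.conjTranspose :=
  Matrix.conjTranspose_mul (α := B) x y

theorem continuousMul {l m n : Type} [Fintype l] [Fintype m] [Fintype n] :
    Continuous fun p : CStarMatrix l m B × CStarMatrix m n B => p.1 * p.2 := by
  refine continuous_pi fun i => continuous_pi fun j => ?_
  refine continuous_finsetSum _ fun k _ => ?_
  have h1 : Continuous fun p : CStarMatrix l m B × CStarMatrix m n B => p.1 i k :=
    (continuous_apply k).comp ((continuous_apply i).comp continuous_fst)
  have h2 : Continuous fun p : CStarMatrix l m B × CStarMatrix m n B => p.2 k j :=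
    (continuous_apply j).comp ((continuous_apply k).comp continuous_snd)
  exact h1.mul h2

theorem CuntzLE.trans {k m n : Type} [Fintype k] [Fintype m] [Fintype n] {a : CStarMatrix k k B}
    {b : CStarMatrix m m B} {c : CStarMatrix n n B} (hab : CuntzLE a b) (hbc : CuntzLE b c) :
    CuntzLE a c := by
  refine closure_minimal ?_ isClosed_closure hab
  rintro _ ⟨d, rfl⟩
  have hcont : Continuous fun x : CStarMatrix m m B => d.conjTranspose * x * d :=
    continuousMul.comp
      ((continuousMul.comp (continuous_const.prodMk continuous_id)).prodMk continuous_const)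
  refine map_mem_closure (f := fun x : CStarMatrix m m B => d.conjTranspose * x * d) hcont hbc ?_
  rintro _ ⟨e, rfl⟩
  refine ⟨e * d, ?_⟩
  simp only [conjTransposeMul, mulAssoc]

/-- The matrix `(b (e i) (e j))` obtained from `b` by relabelling the indices. -/
def relabel {m n : Type} (b : CStarMatrix n n B) (e : m ≃ n) : CStarMatrix m m B :=
  CStarMatrix.ofMatrix fun i j => b (e i) (e j)

theorem relabel_apply {m n : Type} (b : CStarMatrix n n B) (e : m ≃ n) (i j : m) :
    relabel b e i j = b (e i) (e j) := rfl

theorem relabel_cuntzLE {m n : Type} [Fintype m] [Fintype n] (b : CStarMatrix n n B)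
    (e : m ≃ n) : CuntzLE (relabel b e) b := by
  have hu := CStarAlgebra.increasingApproximateUnit (CStarMatrix m m B)
  set a := relabel b e with ha
  have h1 : Tendsto (fun u : CStarMatrix m m B => star u * a * u)
      (CStarAlgebra.approximateUnit (CStarMatrix m m B)) (𝓝 a) := by
    have hl : Tendsto (fun u : CStarMatrix m m B => a * u)
      (CStarAlgebra.approximateUnit (CStarMatrix m m B)) (𝓝 a) := hu.tendsto_mul_left a
    have hr : Tendsto (fun u : CStarMatrix m m B => u * a)
      (CStarAlgebra.approximateUnit (CStarMatrix m m B)) (𝓝 a) := hu.tendsto_mul_right a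
    rw [tendsto_iff_norm_sub_tendsto_zero] at *
    refine squeeze_zero' (.of_forall fun _ => norm_nonneg _) ?_ (by simpa using hl.add hr)
    filter_upwards [hu.eventually_norm, hu.eventually_star_eq] with u hu1 hu2
    have : star u * a * u - a = u * (a * u - a) + (u * a - a) := by
      rw [hu2]; noncomm_ring
    rw [this]
    refine (norm_add_le _ _).trans (add_le_add_left ?_ _)
    calc ‖u * (a * u - a)‖ ≤ ‖u‖ * ‖a * u - a‖ := norm_mul_le _ _
      _ ≤ 1 * ‖a * u - a‖ := by gcongr
      _ = _ := one_mul _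
  refine mem_closure_of_tendsto h1 (.of_forall fun u => ?_)
  refine ⟨CStarMatrix.ofMatrix fun i j => u (e.symm i) j, ?_⟩
  have hd : ∀ i j, CStarMatrix.ofMatrix (fun i j => u (e.symm i) j) (e i) j = u i j := fun i j =>
    congrArg (u · j) (e.symm_apply_apply i)
  ext i j
  simp only [CStarMatrix.mul_apply, CStarMatrix.conjTranspose_apply, CStarMatrix.star_apply, ha,
    relabel_apply, ← e.sum_comp, hd]

theorem cuntzLE_relabel {m n : Type} [Fintype m] [Fintype n] (b : CStarMatrix n n B)
    (e : m ≃ n) : CuntzLE b (relabel b e) := by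
  have := relabel_cuntzLE (relabel b e) e.symm
  have h : relabel (relabel b e) e.symm = b := by
    ext i j
    simp only [relabel_apply, Equiv.apply_symm_apply]
  rwa [h] at this

theorem CuntzLE.refl {m : Type} [Fintype m] (a : CStarMatrix m m B) : CuntzLE a a :=
  relabel_cuntzLE a (Equiv.refl m)

/-- The block diagonal matrix `diag (a, b)`. -/
def blockDiag {k l m n : Type} (a : CStarMatrix k l B) (b : CStarMatrix m n B) :
    CStarMatrix (k ⊕ m) (l ⊕ n) B :=
  CStarMatrix.ofMatrix (Matrix.fromBlocks a 0 0 b)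

theorem blockDiag_mul {i j k l m n : Type} [Fintype k] [Fintype l] (a : CStarMatrix i k B)
    (b : CStarMatrix j l B) (c : CStarMatrix k m B) (d : CStarMatrix l n B) :
    blockDiag a b * blockDiag c d = blockDiag (a * c) (b * d) := by
  ext (x | x) (y | y) <;>
    simp [blockDiag, CStarMatrix.mul_apply, Matrix.fromBlocks]

theorem blockDiag_conjTranspose {k l m n : Type} (a : CStarMatrix k l B) (b : CStarMatrix m n B) :
    (blockDiag a b).conjTranspose = blockDiag a.conjTranspose b.conjTranspose := by
  refine (Matrix.fromBlocks_conjTranspose (α := B) a 0 0 b).trans ?_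
  simp only [Matrix.conjTranspose_zero]
  rfl

theorem CuntzLE.blockDiag {k l m n : Type} [Fintype k] [Fintype l] [Fintype m] [Fintype n]
    {a : CStarMatrix k k B} {b : CStarMatrix l l B} {c : CStarMatrix m m B}
    {d : CStarMatrix n n B} (h : CuntzLE a c) (h' : CuntzLE b d) :
    CuntzLE (blockDiag a b) (blockDiag c d) := by
  have hcont : Continuous fun p : CStarMatrix k k B × CStarMatrix l l B =>
      CuntzComparison.blockDiag p.1 p.2 :=
    Continuous.matrix_fromBlocks (R := B) continuous_fst continuous_const continuous_const
      continuous_snd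
  refine map_mem_closure₂ (f := fun (x : CStarMatrix k k B) (y : CStarMatrix l l B) =>
    CuntzComparison.blockDiag x y) hcont h h' ?_
  rintro _ ⟨x, rfl⟩ _ ⟨y, rfl⟩
  refine ⟨CuntzComparison.blockDiag x y, ?_⟩
  simp only [blockDiag_conjTranspose, blockDiag_mul]

theorem exists_eq_star_mul_self {C : Type*} [NonUnitalCStarAlgebra C] [PartialOrder C]
    [StarOrderedRing C] {a : C} (ha : 0 ≤ a) : ∃ c, a = star c * c :=
  CStarAlgebra.nonneg_iff_eq_star_mul_self.1 ha

theorem blockDiag_nonneg {m n : Type} [Fintype m] [Fintype n] {a : CStarMatrix m m B}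
    {b : CStarMatrix n n B} (ha : 0 ≤ a) (hb : 0 ≤ b) : 0 ≤ blockDiag a b := by
  obtain ⟨c, rfl⟩ := exists_eq_star_mul_self ha
  obtain ⟨d, rfl⟩ := exists_eq_star_mul_self hb
  have h : blockDiag (star c * c) (star d * d) = star (blockDiag c d) * blockDiag c d := by
    rw [CStarMatrix.star_eq_conjTranspose, CStarMatrix.star_eq_conjTranspose,
      CStarMatrix.star_eq_conjTranspose, blockDiag_conjTranspose]
    exact (blockDiag_mul _ _ _ _).symm
  rw [h]
  exact star_mul_self_nonneg _

theorem relabel_nonneg {m n : Type} [Fintype m] [Fintype n] {b : CStarMatrix n n B}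
    (hb : 0 ≤ b) (e : m ≃ n) : 0 ≤ relabel b e := by
  obtain ⟨c, rfl⟩ := exists_eq_star_mul_self hb
  have h : relabel (star c * c) e = star (relabel c e) * relabel c e := by
    ext i j
    simp only [relabel_apply, CStarMatrix.mul_apply, CStarMatrix.star_apply, ← e.sum_comp]
  rw [h]
  exact star_mul_self_nonneg _

end Cuntz

section CuntzSemigroup

variable (B : Type u) [NonUnitalCStarAlgebra B] [PartialOrder B] [StarOrderedRing B]

/-- `⋃ M_n(B)₊`: the positive square matrices over `B`, of all sizes. -/
def PosMat : Type u := Σ n : ℕ, {a : Mat B n // 0 ≤ a}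

variable {B}

/-- Positive matrices preordered by Cuntz subequivalence. -/
instance : Preorder (PosMat B) where
  le a b := CuntzLE a.2.1 b.2.1
  le_refl a := CuntzLE.refl _
  le_trans _ _ _ := CuntzLE.trans

/-- `a ⊕ b = diag (a, b)`. -/
instance : Add (PosMat B) where
  add a b := ⟨a.1 + b.1, relabel (blockDiag a.2.1 b.2.1) finSumFinEquiv.symm,
    relabel_nonneg (blockDiag_nonneg a.2.2 b.2.2) _⟩

instance : Zero (PosMat B) where
  zero := ⟨0, 0, le_rfl⟩

namespace PosMat

theorem add_le_add {a b c d : PosMat B} (h : a ≤ c) (h' : b ≤ d) : a + b ≤ c + d :=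
  (relabel_cuntzLE _ _).trans ((CuntzLE.blockDiag h h').trans (cuntzLE_relabel _ _))

theorem add_comm_le (a b : PosMat B) : a + b ≤ b + a := by
  have h : blockDiag a.2.1 b.2.1 = relabel (blockDiag b.2.1 a.2.1) (Equiv.sumComm _ _) := by
    ext (i | i) (j | j) <;> rfl
  refine (relabel_cuntzLE _ _).trans (CuntzLE.trans ?_ (cuntzLE_relabel _ _))
  rw [h]
  exact relabel_cuntzLE _ _

theorem add_assoc_aux (a b c : PosMat B) : a + b + c ≤ a + (b + c) ∧ a + (b + c) ≤ a + b + c := by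
  have h : blockDiag (blockDiag a.2.1 b.2.1) c.2.1 =
      relabel (blockDiag a.2.1 (blockDiag b.2.1 c.2.1)) (Equiv.sumAssoc _ _ _) := by
    ext ((i | i) | i) ((j | j) | j) <;> rfl
  have l1 : CuntzLE (a + b + c).2.1 (blockDiag (blockDiag a.2.1 b.2.1) c.2.1) :=
    (relabel_cuntzLE _ _).trans (CuntzLE.blockDiag (relabel_cuntzLE _ _) (CuntzLE.refl _))
  have l2 : CuntzLE (blockDiag (blockDiag a.2.1 b.2.1) c.2.1) (a + b + c).2.1 :=
    (CuntzLE.blockDiag (cuntzLE_relabel _ _) (CuntzLE.refl _)).trans (cuntzLE_relabel _ _)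
  have r1 : CuntzLE (a + (b + c)).2.1 (blockDiag a.2.1 (blockDiag b.2.1 c.2.1)) :=
    (relabel_cuntzLE _ _).trans (CuntzLE.blockDiag (CuntzLE.refl _) (relabel_cuntzLE _ _))
  have r2 : CuntzLE (blockDiag a.2.1 (blockDiag b.2.1 c.2.1)) (a + (b + c)).2.1 :=
    (CuntzLE.blockDiag (CuntzLE.refl _) (cuntzLE_relabel _ _)).trans (cuntzLE_relabel _ _)
  rw [h] at l1 l2
  exact ⟨l1.trans ((relabel_cuntzLE _ _).trans r2), r1.trans ((cuntzLE_relabel _ _).trans l2)⟩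

theorem zero_add_aux (a : PosMat B) : 0 + a ≤ a ∧ a ≤ 0 + a := by
  have h : blockDiag (0 : PosMat B).2.1 a.2.1 = relabel a.2.1 (Equiv.emptySum (Fin 0) _) := by
    ext (i | i) (j | j)
    · exact i.elim0
    · exact i.elim0
    · exact j.elim0
    · rfl
  have h1 : CuntzLE (0 + a).2.1 (blockDiag (0 : PosMat B).2.1 a.2.1) := relabel_cuntzLE _ _
  have h2 : CuntzLE (blockDiag (0 : PosMat B).2.1 a.2.1) (0 + a).2.1 := cuntzLE_relabel _ _
  rw [h] at h1 h2
  exact ⟨h1.trans (relabel_cuntzLE _ _), (cuntzLE_relabel _ _).trans h2⟩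

end PosMat

variable (B) in
/-- The ordered semigroup `W(B)` of Cuntz equivalence classes of positive matrices over `B`, with
order induced by Cuntz subequivalence. -/
def CuntzW : Type u := Antisymmetrization (PosMat B) (· ≤ ·)

instance : PartialOrder (CuntzW B) :=
  inferInstanceAs (PartialOrder (Antisymmetrization (PosMat B) (· ≤ ·)))

/-- The class `[a]` of a positive matrix. -/
def CuntzW.mk (a : PosMat B) : CuntzW B := toAntisymmetrization (· ≤ ·) a

theorem CuntzW.mk_le_mk {a b : PosMat B} : CuntzW.mk a ≤ CuntzW.mk b ↔ a ≤ b := Iff.rfl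

theorem CuntzW.ind {p : CuntzW B → Prop} (h : ∀ a, p (CuntzW.mk a)) (x : CuntzW B) : p x :=
  Antisymmetrization.ind _ h x

/-- Addition on `W(B)` is `[a] + [b] = [diag (a, b)]`. -/
instance : Add (CuntzW B) where
  add := Quotient.map₂ (· + ·) fun _ _ h _ _ h' =>
    ⟨PosMat.add_le_add h.1 h'.1, PosMat.add_le_add h.2 h'.2⟩

instance : Zero (CuntzW B) where
  zero := CuntzW.mk 0

instance : AddCommMonoid (CuntzW B) where
  add_assoc x y z := by
    induction x using CuntzW.ind
    induction y using CuntzW.ind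
    induction z using CuntzW.ind
    exact Quotient.sound (PosMat.add_assoc_aux _ _ _)
  zero_add x := by
    induction x using CuntzW.ind
    exact Quotient.sound (PosMat.zero_add_aux _)
  add_zero x := by
    induction x using CuntzW.ind with
    | h a =>
      exact Quotient.sound ⟨(PosMat.add_comm_le a 0).trans (PosMat.zero_add_aux a).1,
        (PosMat.zero_add_aux a).2.trans (PosMat.add_comm_le 0 a)⟩
  add_comm x y := by
    induction x using CuntzW.ind
    induction y using CuntzW.ind
    exact Quotient.sound ⟨PosMat.add_comm_le _ _, PosMat.add_comm_le _ _⟩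
  nsmul := nsmulRec

theorem CuntzW.mk_add (a b : PosMat B) : CuntzW.mk (a + b) = CuntzW.mk a + CuntzW.mk b := rfl

instance : IsOrderedAddMonoid (CuntzW B) where
  add_le_add_left x y h z := by
    induction x using CuntzW.ind
    induction y using CuntzW.ind
    induction z using CuntzW.ind
    exact PosMat.add_le_add h le_rfl

/-- The stabilized Cuntz semigroup `Cu(A) = W(A ⊗ 𝒦)`. -/
abbrev Cu (A : Type u) [NonUnitalCStarAlgebra A] [PartialOrder A] [StarOrderedRing A] : Type u :=
  CuntzW (Stab A)

end CuntzSemigroup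

section Comparison

variable {S : Type u} [AddCommMonoid S] [PartialOrder S]

/-- The relation `x ≤ₛ y`: `(k + 1) x ≤ k y` for some natural number `k`. -/
def LEs (x y : S) : Prop := ∃ k : ℕ, (k + 1) • x ≤ k • y

variable (S) in
/-- The `ω`-comparison property: if `x ≤ₛ y i` for all `i`, then the infinite sum of the `y i`, that
is the supremum of the partial sums, exists and is above `x`. -/
def OmegaComparison : Prop :=
  ∀ (x : S) (y : ℕ → S), (∀ i, LEs x (y i)) →
    ∃ s : S, IsLUB (Set.range fun n : ℕ => ∑ i ∈ Finset.range n, y i) s ∧ x ≤ s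

end Comparison

section NuclearDimension

section maps

variable {A : Type*} {B : Type*} [NonUnitalCStarAlgebra A] [PartialOrder A] [StarOrderedRing A]
  [NonUnitalCStarAlgebra B] [PartialOrder B] [StarOrderedRing B]

/-- `f` is a completely positive contraction. -/
structure IsCPC (f : A →ₗ[ℂ] B) : Prop where
  completelyPositive : ∃ g : A →CP B, g.toLinearMap = f
  contractive : ∀ a, ‖f a‖ ≤ ‖a‖

/-- `f` has order zero: it preserves orthogonality of positive elements. -/
def IsOrderZero (f : A →ₗ[ℂ] B) : Prop :=
  ∀ a b : A, 0 ≤ a → 0 ≤ b → a * b = 0 → f a * f b = 0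

end maps

section induced

variable {L : Type v} [Preorder L] {A : Type u} [NonUnitalCStarAlgebra A] [PartialOrder A]
  [StarOrderedRing A] {F : L → Type w} [∀ l, NonUnitalCStarAlgebra (F l)]
  [∀ l, PartialOrder (F l)] [∀ l, StarOrderedRing (F l)]

/-- The map `A → ∏ F l / ⨁ F l` induced by a net of c.p.c. maps `ψ l : A → F l`, sending `a` to
the class of the net `(ψ l a)`. -/
def inducedIn {ψ : ∀ l, A →ₗ[ℂ] F l} (hψ : ∀ l, IsCPC (ψ l)) : A →ₗ[ℂ] ProdModSum F :=
  ProdModSum.map ψ (fun l => (hψ l).contractive) ∘ₗ ProdModSum.diag L A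

/-- The map `∏ F l / ⨁ F l → ∏ A / ⨁ A` induced by a net of c.p.c. maps `φ l : F l → A`, sending
the class of `(x l)` to the class of `(φ l (x l))`. -/
def inducedOut {φ : ∀ l, F l →ₗ[ℂ] A} (hφ : ∀ l, IsCPC (φ l)) :
    ProdModSum F →ₗ[ℂ] ProdModSum (fun _ : L => A) :=
  ProdModSum.map φ fun l => (hφ l).contractive

end induced

/-- `A` has nuclear dimension at most `ω`: there are nets, over a directed set `L`, of completely
positive contractions `ψ i l : A → F i l` and `φ i l : F i l → A`, for `i = 0, 1, 2, …`, through
finite-dimensional C⋆-algebras `F i l`, such that the induced maps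
`A → ∏ F i l / ⨁ F i l` and `∏ F i l / ⨁ F i l → ∏ A / ⨁ A` are completely positive contractions
of order zero, and the series of their compositions converges in norm to the diagonal embedding,
pointwise on `A`. -/
def NuclearDimLEOmega (A : Type u) [NonUnitalCStarAlgebra A] [PartialOrder A]
    [StarOrderedRing A] : Prop :=
  ∃ (L : Type v) (_ : Preorder L) (_ : IsDirectedOrder L) (_ : Nonempty L)
    (F : ℕ → L → Type w) (_ : ∀ i l, NonUnitalCStarAlgebra (F i l))
    (_ : ∀ i l, PartialOrder (F i l)) (_ : ∀ i l, StarOrderedRing (F i l))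
    (_ : ∀ i l, FiniteDimensional ℂ (F i l))
    (ψ : ∀ i l, A →ₗ[ℂ] F i l) (φ : ∀ i l, F i l →ₗ[ℂ] A)
    (hψ : ∀ i l, IsCPC (ψ i l)) (hφ : ∀ i l, IsCPC (φ i l)),
    (∀ i, IsCPC (inducedIn (hψ i)) ∧ IsOrderZero (inducedIn (hψ i))) ∧
    (∀ i, IsCPC (inducedOut (hφ i)) ∧ IsOrderZero (inducedOut (hφ i))) ∧
    ∀ a : A, Tendsto
      (fun n : ℕ => ∑ i ∈ Finset.range n, inducedOut (hφ i) (inducedIn (hψ i) a))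
      atTop (𝓝 (ProdModSum.diag L A a))

end NuclearDimension

end CuntzComparison

end

/-!
A completely positive contraction `f` of order zero satisfies `f (x y) f z = f x f (y z)`: a bounded
bilinear map vanishing on zero products is balanced, as one sees by cutting `y` into spectral
pieces. This identity is inherited by matrix amplifications, and it makes `f` respect Cuntz
subequivalence; so `x ≤_s y_i` passes through the map `ψ^i` to a relation between nets of positive
elements of finite-dimensional algebras.

A finite-dimensional algebra is almost unperforated: if `k + 1` copies of `a` lie under `k` copies
of `b`, then a comparison of dimensions shows that the spectral projections of `a` are equivalent to
projections below those of `b`. Hence, if `a` and `b_i` represent `x` and `y_i`, then `ψ^i(a)` is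
approximately of the form `r⋆ ψ^i(b_i) r`, and the identity gives
`φ^i ψ^i(a) ≾ φ^i ψ^i(b_i) ≤ b_i`. Summing over `i`, `a` is a limit of sums `∑ z_i⋆ b_i z_i`.

In `A ⊗ 𝒦` there are orthogonal isometries, acting as left multipliers. They represent every class
by an element of `A ⊗ 𝒦` itself, and `∑ y_i` by a norm convergent series of orthogonal elements.
-/

noncomputable section

namespace CuntzComparison

open Filter Topology
open scoped ENNReal CStarAlgebra

section CuntzCalculus

variable {B : Type*} [NonUnitalCStarAlgebra B]

/-- Cuntz subequivalence `a ≾ b` of elements of a C⋆-algebra, that is, `CuntzLE` for `1 × 1`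
matrices. -/
def CuntzSub (a b : B) : Prop := a ∈ closure (Set.range fun d : B => star d * b * d)

theorem cuntzSub_iff {a b : B} : CuntzSub a b ↔ ∀ e > 0, ∃ d : B, ‖a - star d * b * d‖ < e := by
  simp [CuntzSub, Metric.mem_closure_iff, dist_eq_norm]

theorem CuntzSub.conj (b d : B) : CuntzSub (star d * b * d) b := subset_closure ⟨d, rfl⟩

theorem CuntzSub.trans {a b c : B} (hab : CuntzSub a b) (hbc : CuntzSub b c) : CuntzSub a c := by
  refine closure_minimal ?_ isClosed_closure hab
  rintro _ ⟨d, rfl⟩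
  have hcont : Continuous fun x : B => star d * x * d := by fun_prop
  refine map_mem_closure (f := fun x : B => star d * x * d) hcont hbc ?_
  rintro _ ⟨e, rfl⟩
  exact ⟨e * d, by simp only [star_mul, mul_assoc]⟩

theorem CuntzSub.of_forall_near {a b : B} (h : ∀ e > 0, ∃ c, CuntzSub c b ∧ ‖a - c‖ < e) :
    CuntzSub a b := by
  have : a ∈ closure {c | CuntzSub c b} := by
    simpa only [Metric.mem_closure_iff, dist_eq_norm, Set.mem_ofPred_eq] using h
  exact closure_minimal (fun c hc => hc) isClosed_closure this

theorem norm_mul_star_sub_conj_le (c u : B) (hu : ‖u‖ ≤ 1) :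
    ‖c * star c - u * (c * star c) * star u‖ ≤ 2 * ‖c‖ * ‖c - u * c‖ := by
  have h : c * star c - u * (c * star c) * star u =
      (c - u * c) * star c + u * c * star (c - u * c) := by
    simp only [star_sub, star_mul]
    noncomm_ring
  have huc : ‖u * c‖ ≤ ‖c‖ :=
    (norm_mul_le _ _).trans (mul_le_of_le_one_left (norm_nonneg _) hu)
  calc ‖c * star c - u * (c * star c) * star u‖
      ≤ ‖c - u * c‖ * ‖star c‖ + ‖u * c‖ * ‖star (c - u * c)‖ :=
        h ▸ (norm_add_le _ _).trans (add_le_add (norm_mul_le _ _) (norm_mul_le _ _))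
    _ ≤ ‖c - u * c‖ * ‖c‖ + ‖c‖ * ‖c - u * c‖ := by
        rw [norm_star, norm_star]
        gcongr
    _ = 2 * ‖c‖ * ‖c - u * c‖ := by ring

theorem star_cfcₙ_real (f : ℝ → ℝ) (a : B) : star (cfcₙ f a) = cfcₙ f a :=
  (cfcₙ_predicate f a : IsSelfAdjoint _)

variable [PartialOrder B] [StarOrderedRing B]

theorem norm_sub_mul_le_of_mul_star_le {c r : B} (h : c * star c ≤ r * star r) (u : B) :
    ‖c - u * c‖ ≤ ‖r - u * r‖ := by
  obtain ⟨d, hd⟩ := CStarAlgebra.nonneg_iff_eq_mul_star_self.1 (sub_nonneg.2 h)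
  have hle : (c - u * c) * star (c - u * c) ≤ (r - u * r) * star (r - u * r) := by
    have hdiff : (r - u * r) * star (r - u * r) - (c - u * c) * star (c - u * c) =
        (d - u * d) * star (d - u * d) :=
      calc _ = (r * star r - c * star c) - u * (r * star r - c * star c) -
            (r * star r - c * star c) * star u + u * (r * star r - c * star c) * star u := by
            simp only [star_sub, star_mul]
            noncomm_ring
        _ = _ := by
            rw [hd]
            simp only [star_sub, star_mul]
            noncomm_ring
    rw [← sub_nonneg, hdiff]
    exact mul_star_self_nonneg _
  have hnorm := CStarAlgebra.norm_le_norm_of_nonneg_of_le (mul_star_self_nonneg _) hle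
  rw [CStarRing.norm_self_mul_star, CStarRing.norm_self_mul_star] at hnorm
  exact (mul_self_le_mul_self_iff (norm_nonneg _) (norm_nonneg _)).2 hnorm

/-- `K` is the regularized inverse square root `t ^ (1/2) (t + r)⁻¹`, for a small `r > 0`. -/
theorem exists_sqrt_mul_near_unit {t : B} (ht : 0 ≤ t) {e : ℝ} (he : 0 < e) :
    ∃ K : B, IsSelfAdjoint K ∧ Commute (CFC.sqrt t) K ∧ ‖CFC.sqrt t * K‖ ≤ 1 ∧
      ‖CFC.sqrt t - CFC.sqrt t * K * CFC.sqrt t‖ ≤ e := by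
  set k : ℝ → ℝ := fun x => √x / (|x| + e ^ 2)
  have hk : Continuous k :=
    Real.continuous_sqrt.div (by fun_prop) fun x => by positivity
  have hk0 : k 0 = 0 := by simp [k]
  have hsqrt_mul : ∀ x, 0 ≤ x → √x * k x = x / (x + e ^ 2) := fun x hx => by
    simp only [k, abs_of_nonneg hx, ← mul_div_assoc, Real.mul_self_sqrt hx]
  refine ⟨cfcₙ k t, cfcₙ_predicate k t, ?_, ?_, ?_⟩ <;> rw [CFC.sqrt_eq_real_sqrt t]
  · exact cfcₙ_commute_cfcₙ _ _ t
  · rw [← cfcₙ_mul Real.sqrt k t (by fun_prop) Real.sqrt_zero (by fun_prop) hk0]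
    refine norm_cfcₙ_le fun x hx => ?_
    have hx0 := quasispectrum_nonneg_of_nonneg t ht x hx
    rw [hsqrt_mul x hx0, Real.norm_of_nonneg (by positivity), div_le_one (by positivity)]
    linarith [sq_nonneg e]
  · rw [← cfcₙ_mul Real.sqrt k t (by fun_prop) Real.sqrt_zero (by fun_prop) hk0,
      ← cfcₙ_mul (fun x => √x * k x) Real.sqrt t (by fun_prop) (by simp) (by fun_prop)
        Real.sqrt_zero,
      ← cfcₙ_sub Real.sqrt (fun x => √x * k x * √x) t (by fun_prop) Real.sqrt_zero (by fun_prop)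
        (by simp)]
    refine norm_cfcₙ_le fun x hx => ?_
    have hx0 := quasispectrum_nonneg_of_nonneg t ht x hx
    have heq : √x - x / (x + e ^ 2) * √x = √x * e ^ 2 / (√x ^ 2 + e ^ 2) := by
      rw [Real.sq_sqrt hx0]
      field_simp
      ring
    rw [hsqrt_mul x hx0, heq, Real.norm_of_nonneg (by positivity), div_le_iff₀ (by positivity)]
    nlinarith [mul_nonneg he.le (sq_nonneg (√x - e)), mul_nonneg he.le (sq_nonneg (√x)),
      pow_pos he 3]

theorem exists_norm_sub_sqrt_conj_lt {c t : B} (h : c * star c ≤ t) {e : ℝ} (he : 0 < e) :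
    ∃ K : B, IsSelfAdjoint K ∧ Commute (CFC.sqrt t) K ∧
      ‖c * star c - CFC.sqrt t * K * (c * star c) * (K * CFC.sqrt t)‖ < e := by
  have ht : 0 ≤ t := (mul_star_self_nonneg c).trans h
  obtain ⟨K, hK, hcomm, hle, hnear⟩ :=
    exists_sqrt_mul_near_unit ht (e := e / (2 * ‖c‖ + 1)) (by positivity)
  have hR : IsSelfAdjoint (CFC.sqrt t) := .of_nonneg (CFC.sqrt_nonneg t)
  have hcK : ‖c - CFC.sqrt t * K * c‖ ≤ e / (2 * ‖c‖ + 1) :=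
    (norm_sub_mul_le_of_mul_star_le (by rwa [hR.star_eq, CFC.sqrt_mul_sqrt_self t ht]) _).trans
      hnear
  refine ⟨K, hK, hcomm, ?_⟩
  have hstar : K * CFC.sqrt t = star (CFC.sqrt t * K) := by rw [star_mul, hK.star_eq, hR.star_eq]
  rw [hstar]
  calc _ ≤ 2 * ‖c‖ * (e / (2 * ‖c‖ + 1)) :=
        (norm_mul_star_sub_conj_le c _ hle).trans (by gcongr)
    _ < e := by
        rw [← mul_div_assoc, div_lt_iff₀ (by positivity)]
        linarith

theorem CuntzSub.mul_self {a : B} (ha : 0 ≤ a) : CuntzSub a (a * a) := by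
  have hstar : IsSelfAdjoint (CFC.sqrt a) := .of_nonneg (CFC.sqrt_nonneg a)
  have hsq : CFC.sqrt a * CFC.sqrt a = a := CFC.sqrt_mul_sqrt_self a ha
  refine cuntzSub_iff.2 fun e he => ?_
  obtain ⟨K, hK, hcomm, hlt⟩ :=
    exists_norm_sub_sqrt_conj_lt (c := CFC.sqrt a) (t := a) (by rw [hstar.star_eq, hsq]) he
  refine ⟨K, ?_⟩
  rw [hstar.star_eq] at hlt
  generalize CFC.sqrt a = r at *
  subst hsq
  have hconj : r * K * (r * r) * (K * r) = star K * (r * r * (r * r)) * K :=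
    calc r * K * (r * r) * (K * r) = K * r * (r * r) * (r * K) := by rw [hcomm.eq]
      _ = star K * (r * r * (r * r)) * K := by
        rw [hK.star_eq]
        simp only [mul_assoc]
  rwa [hconj] at hlt

theorem CuntzSub.mul_star_self (y : B) : CuntzSub (y * star y) (star y * y) := by
  have h : y * star y * (y * star y) = star (star y) * (star y * y) * star y := by
    simp only [star_star, mul_assoc]
  exact (CuntzSub.mul_self (mul_star_self_nonneg y)).trans (h ▸ CuntzSub.conj _ _)

theorem CuntzSub.of_le {s t : B} (hs : 0 ≤ s) (hst : s ≤ t) : CuntzSub s t := by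
  obtain ⟨c, rfl⟩ := CStarAlgebra.nonneg_iff_eq_mul_star_self.1 hs
  have ht : 0 ≤ t := hs.trans hst
  refine CuntzSub.of_forall_near fun e he => ?_
  obtain ⟨K, hK, -, hlt⟩ := exists_norm_sub_sqrt_conj_lt hst he
  refine ⟨_, ?_, hlt⟩
  have hR : IsSelfAdjoint (CFC.sqrt t) := .of_nonneg (CFC.sqrt_nonneg t)
  set y := CFC.sqrt t * (K * c) with hy
  have hstar : star y = star (K * c) * CFC.sqrt t := by rw [hy, star_mul, hR.star_eq]
  have hyy : CFC.sqrt t * K * (c * star c) * (K * CFC.sqrt t) = y * star y := by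
    rw [hstar, hy, star_mul, hK.star_eq]
    simp only [mul_assoc]
  have hyy' : star y * y = star (K * c) * t * (K * c) := by
    rw [hstar, hy]
    nth_rw 3 [← CFC.sqrt_mul_sqrt_self t ht]
    simp only [mul_assoc]
  rw [hyy]
  exact (CuntzSub.mul_star_self y).trans (hyy' ▸ CuntzSub.conj _ _)

theorem CuntzSub.star_mul_self_mul {t : B} (ht : 0 ≤ t) (x y : B) :
    CuntzSub (star (x * t * y) * (x * t * y)) t := by
  obtain ⟨q, hq0, rfl⟩ : ∃ q : B, 0 ≤ q ∧ q * q = t :=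
    ⟨CFC.sqrt t, CFC.sqrt_nonneg t, CFC.sqrt_mul_sqrt_self t ht⟩
  have hq : star q = q := IsSelfAdjoint.of_nonneg hq0
  set d := √‖star x * x‖ • (q * y) with hd
  have hle : star (x * (q * q) * y) * (x * (q * q) * y) ≤ star d * (q * q) * d :=
    calc star (x * (q * q) * y) * (x * (q * q) * y)
        = star (q * q * y) * (star x * x) * (q * q * y) := by simp only [star_mul, mul_assoc]
      _ ≤ ‖star x * x‖ • (star (q * q * y) * (q * q * y)) :=
          CStarAlgebra.star_left_conjugate_le_norm_smul (.star_mul_self x)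
      _ = star d * (q * q) * d := by
          rw [hd, star_smul, star_trivial (√‖star x * x‖), smul_mul_assoc, smul_mul_assoc,
            mul_smul_comm, smul_smul, Real.mul_self_sqrt (norm_nonneg _)]
          simp only [star_mul, hq, mul_assoc]
  exact (CuntzSub.of_le (star_mul_self_nonneg _) hle).trans (CuntzSub.conj _ _)

theorem CuntzSub.of_cube_eq {p t x y : B} (hp : 0 ≤ p) (ht : 0 ≤ t) (h : p * p * p = x * t * y) :
    CuntzSub p t := by
  have hps : star p = p := IsSelfAdjoint.of_nonneg hp
  have hp2 : 0 ≤ p * p := by simpa only [hps] using star_mul_self_nonneg p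
  have hp4 : 0 ≤ p * p * (p * p) := by
    simpa only [star_mul, hps] using star_mul_self_nonneg (p * p)
  have h8 : p * p * (p * p) * (p * p * (p * p)) =
      star p * (star (p * p * p) * (p * p * p)) * p := by
    simp only [star_mul, hps, mul_assoc]
  have h6 : CuntzSub p (star (p * p * p) * (p * p * p)) :=
    (CuntzSub.mul_self hp).trans ((CuntzSub.mul_self hp2).trans
      ((CuntzSub.mul_self hp4).trans (h8 ▸ CuntzSub.conj _ p)))
  exact h6.trans (h ▸ CuntzSub.star_mul_self_mul ht x y)

end CuntzCalculus

section CompletelyPositive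

variable {A B : Type*} [NonUnitalCStarAlgebra A] [PartialOrder A] [StarOrderedRing A]
  [NonUnitalCStarAlgebra B] [PartialOrder B] [StarOrderedRing B]

theorem map_star_of_nonneg {f : A →ₗ[ℂ] B} (hf : ∀ a, 0 ≤ a → 0 ≤ f a) (a : A) :
    f (star a) = star (f a) := by
  have ha : a ∈ Submodule.span ℂ {a : A | 0 ≤ a} := CStarAlgebra.span_nonneg (A := A) ▸ trivial
  induction ha using Submodule.span_induction with
  | mem a ha =>
    rw [(IsSelfAdjoint.of_nonneg ha).star_eq, (IsSelfAdjoint.of_nonneg (hf a ha)).star_eq]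
  | zero => simp
  | add a b _ _ ha hb => simp [ha, hb]
  | smul c a _ ha => simp [ha]

/-- A weak form of the Stinespring dilation. -/
theorem exists_gram (g : A →CP B) {ι : Type*} [Fintype ι] [Nonempty ι] (v : ι → A) :
    ∃ w : ι → ι → B, ∀ i j, g (star (v i) * v j) = ∑ k, star (w k i) * w k j := by
  classical
  obtain ⟨k₀⟩ := ‹Nonempty ι›
  let N : CStarMatrix ι ι A := CStarMatrix.ofMatrix fun k j => if k = k₀ then v j else 0
  obtain ⟨w, hw⟩ :=
    exists_eq_star_mul_self (g.map_cstarMatrix_nonneg (star N * N) (star_mul_self_nonneg N))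
  refine ⟨w, fun i j => ?_⟩
  have hN : (star N * N) i j = star (v i) * v j := by
    have hentry : ∀ k j, N k j = if k = k₀ then v j else 0 := fun _ _ => rfl
    simp [CStarMatrix.mul_apply, CStarMatrix.star_apply, hentry, apply_ite star]
  rw [← hN, ← CStarMatrix.map_apply (f := g), hw, CStarMatrix.mul_apply]
  rfl

theorem map_mul_eq_zero_of_map_star_mul_self (g : A →CP B) {x : A} {z : B}
    (h : g (star x * x) * z = 0) : g x * z = 0 := by
  have hstar : ∀ e : A, g (star e * x) * z = 0 := by
    intro e
    obtain ⟨w, hw⟩ := exists_gram g ![e, x]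
    have hsum : ∑ k, star (w k 1 * z) * (w k 1 * z) = 0 := by
      have : ∑ k, star (w k 1 * z) * (w k 1 * z) = star z * (g (star x * x) * z) := by
        rw [show star x * x = star (![e, x] 1) * ![e, x] 1 from rfl, hw, Finset.sum_mul,
          Finset.mul_sum]
        simp only [star_mul, mul_assoc]
      rw [this, h, mul_zero]
    rw [Finset.sum_eq_zero_iff_of_nonneg fun _ _ => star_mul_self_nonneg _] at hsum
    have hz : ∀ k, w k 1 * z = 0 := fun k =>
      (CStarRing.star_mul_self_eq_zero_iff _).1 (hsum k (Finset.mem_univ _))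
    rw [show star e * x = star (![e, x] 0) * ![e, x] 1 from rfl, hw, Finset.sum_mul]
    exact Finset.sum_eq_zero fun k _ => by rw [mul_assoc, hz, mul_zero]
  have hu := CStarAlgebra.increasingApproximateUnit A
  have := hu.neBot
  have hlim : Tendsto (fun u : A => g (u * x) * z) (CStarAlgebra.approximateUnit A)
      (𝓝 (g x * z)) :=
    (((map_continuous g).tendsto x).comp (hu.tendsto_mul_right x)).mul_const z
  refine tendsto_nhds_unique hlim (tendsto_const_nhds.congr fun u => ?_)
  simpa using (hstar (star u)).symm

theorem IsCPC.map_nonneg {f : A →ₗ[ℂ] B} (hf : IsCPC f) {a : A} (ha : 0 ≤ a) : 0 ≤ f a := by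
  obtain ⟨g, rfl⟩ := hf.completelyPositive
  exact _root_.map_nonneg g ha

theorem IsCPC.map_mul_map_eq_zero {f : A →ₗ[ℂ] B} (hf : IsCPC f) (h0 : IsOrderZero f) {x y : A}
    (h : x * y = 0) : f x * f y = 0 := by
  have hstar : ∀ a, f (star a) = star (f a) := map_star_of_nonneg fun _ => hf.map_nonneg
  have hleft : ∀ {a : A} {z : B}, f (star a * a) * z = 0 → f a * z = 0 := by
    obtain ⟨g, rfl⟩ := hf.completelyPositive
    exact map_mul_eq_zero_of_map_star_mul_self g
  have hright : ∀ {a : A} {z : B}, z * f (a * star a) = 0 → z * f a = 0 := by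
    intro a z hz
    have : f (star a) * star z = 0 := hleft (by
      simpa only [star_mul, star_zero, ← hstar, star_star] using congrArg star hz)
    simpa only [star_mul, star_zero, ← hstar, star_star] using congrArg star this
  refine hright (hleft (h0 _ _ (star_mul_self_nonneg x) (mul_star_self_nonneg y) ?_))
  rw [mul_assoc, ← mul_assoc x, h, zero_mul, mul_zero]

end CompletelyPositive

section ZeroProducts

/-- The piecewise linear bump of height `1` at `0`, supported on `[-1, 1]`. -/
def tent (s : ℝ) : ℝ := max 0 (1 - |s|)

/-- The identity on `[-1, 1]`, cut off continuously outside `[-2, 2]`. -/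
def clippedId (s : ℝ) : ℝ := s * min 1 (max 0 (2 - |s|))

@[fun_prop]
theorem continuous_tent : Continuous tent := by
  unfold tent
  fun_prop

@[fun_prop]
theorem continuous_clippedId : Continuous clippedId := by
  unfold clippedId
  fun_prop

theorem tent_nonneg (s : ℝ) : 0 ≤ tent s := le_max_left _ _

theorem tent_eq_zero {s : ℝ} (hs : 1 ≤ |s|) : tent s = 0 := max_eq_left (by linarith)

theorem clippedId_eq_zero {s : ℝ} (hs : 2 ≤ |s|) : clippedId s = 0 := by
  rw [clippedId, max_eq_left (by linarith), min_eq_right zero_le_one, mul_zero]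

theorem tent_mul_clippedId (s : ℝ) : tent s * clippedId s = tent s * s := by
  rcases le_total 1 |s| with hs | hs
  · rw [tent_eq_zero hs, zero_mul, zero_mul]
  · rw [clippedId, max_eq_right (by linarith), min_eq_left (by linarith), mul_one]

theorem abs_tent_mul_le (s : ℝ) : |tent s * s| ≤ tent s := by
  rcases le_total 1 |s| with hs | hs
  · rw [tent_eq_zero hs, zero_mul, abs_zero]
  · rw [abs_mul, abs_of_nonneg (tent_nonneg s)]
    exact mul_le_of_le_one_right (tent_nonneg s) hs

theorem abs_clippedId_le (s : ℝ) : |clippedId s| ≤ 1 := by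
  rcases le_total 2 |s| with hs | hs
  · rw [clippedId_eq_zero hs, abs_zero]
    exact zero_le_one
  rw [clippedId, max_eq_right (by linarith), abs_mul,
    abs_of_nonneg (le_min zero_le_one (sub_nonneg.2 hs))]
  rcases le_total 1 |s| with h1 | h1
  · rw [min_eq_right (by linarith)]
    nlinarith [sq_nonneg (|s| - 1)]
  · rw [min_eq_left (by linarith), mul_one]
    exact h1

theorem abs_tent_le (s : ℝ) : |tent s| ≤ 1 := by
  rw [abs_of_nonneg (tent_nonneg s)]
  exact max_le zero_le_one (sub_le_self _ (abs_nonneg s))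

theorem tent_eq_sub (s : ℝ) :
    tent s = min 1 (max 0 (s + 1)) - min 1 (max 0 s) := by
  rcases le_total 0 s with hs | hs
  · simp only [tent, abs_of_nonneg hs, max_def, min_def]
    split_ifs <;> linarith
  · rw [tent, abs_of_nonpos hs, max_eq_left (a := 0) (b := s) hs, min_eq_right zero_le_one,
      min_eq_right (max_le zero_le_one (by linarith)), sub_zero, sub_neg_eq_add, add_comm]

theorem sum_tent_sub_natCast {n : ℕ} {t : ℝ} (h0 : 0 ≤ t) (hn : t ≤ n) :
    ∑ j ∈ Finset.range (n + 1), tent (t - j) = 1 := by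
  have htel : ∀ j : ℕ, tent (t - j) =
      min 1 (max 0 (t + 1 - j)) - min 1 (max 0 (t + 1 - (j + 1 : ℕ))) := fun j => by
    rw [tent_eq_sub]
    push_cast
    ring_nf
  rw [Finset.sum_congr rfl fun j _ => htel j,
    Finset.sum_range_sub' (fun j : ℕ => min 1 (max 0 (t + 1 - (j : ℝ))))]
  push_cast
  rw [max_eq_right (by linarith), min_eq_left (by linarith), max_eq_left (by linarith),
    min_eq_right zero_le_one, sub_zero]

theorem abs_sum_le_one_of_pairwise {ι : Type*} {s : Finset ι} {f : ι → ℝ} (hf : ∀ i, |f i| ≤ 1)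
    (h : ∀ i ∈ s, ∀ j ∈ s, i ≠ j → f i = 0 ∨ f j = 0) : |∑ i ∈ s, f i| ≤ 1 := by
  by_cases hs : ∃ i ∈ s, f i ≠ 0
  · obtain ⟨i, hi, hfi⟩ := hs
    rw [Finset.sum_eq_single_of_mem i hi fun j hj hji => (h i hi j hj hji.symm).resolve_left hfi]
    exact hf i
  · push Not at hs
    rw [Finset.sum_eq_zero hs, abs_zero]
    exact zero_le_one

theorem four_le_abs_sub_of_mod_eq {i j : ℕ} (hmod : i % 4 = j % 4) (hij : i ≠ j) :
    (4 : ℝ) ≤ |(i : ℝ) - j| := by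
  have : (4 : ℤ) ≤ |(i : ℤ) - j| := by
    rw [le_abs']
    omega
  exact_mod_cast this

variable {C : Type*} [CStarAlgebra C]

theorem norm_sum_cfc_le_one {ι : Type*} {s : Finset ι} {f : ι → ℝ → ℝ} (h : C)
    (hf : ∀ i, Continuous (f i)) (hle : ∀ t ∈ spectrum ℝ h, |∑ i ∈ s, f i t| ≤ 1) :
    ‖∑ i ∈ s, cfc (f i) h‖ ≤ 1 := by
  rw [← cfc_sum f h s fun i _ => (hf i).continuousOn]
  exact norm_cfc_le zero_le_one fun t ht => by
    rw [Finset.sum_apply]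
    exact hle t ht

variable {E : Type*} [NormedAddCommGroup E] [NormedSpace ℂ E] {I : Ideal C} [I.IsTwoSided]
  {β : C →ₗ[ℂ] C →ₗ[ℂ] E} {M : ℝ}

theorem norm_sum_bilin_le_of_mul_eq_zero (hM : ∀ x ∈ I, ∀ z ∈ I, ‖β x z‖ ≤ M * ‖x‖ * ‖z‖)
    (hM0 : 0 ≤ M) (hβ : ∀ x ∈ I, ∀ z ∈ I, x * z = 0 → β x z = 0) {x z : C} (hx : x ∈ I)
    (hz : z ∈ I) {ι : Type*} {s : Finset ι} {p c : ι → C}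
    (hpc : ∀ i ∈ s, ∀ j ∈ s, i ≠ j → p i * c j = 0) (hp : ‖∑ i ∈ s, p i‖ ≤ 1)
    (hc : ‖∑ i ∈ s, c i‖ ≤ 1) : ‖∑ i ∈ s, β (x * p i) (c i * z)‖ ≤ M * ‖x‖ * ‖z‖ := by
  have hsum : ∑ i ∈ s, β (x * p i) (c i * z) = β (x * ∑ i ∈ s, p i) ((∑ i ∈ s, c i) * z) := by
    rw [Finset.mul_sum, Finset.sum_mul, map_sum β, LinearMap.sum_apply]
    refine Finset.sum_congr rfl fun i hi => ?_
    rw [map_sum, Finset.sum_eq_single_of_mem i hi]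
    intro j hj hji
    refine hβ _ (I.mul_mem_right _ hx) _ (I.mul_mem_left _ hz) ?_
    rw [mul_assoc, ← mul_assoc (p i), hpc i hi j hj hji.symm, zero_mul, mul_zero]
  rw [hsum]
  refine (hM _ (I.mul_mem_right _ hx) _ (I.mul_mem_left _ hz)).trans ?_
  gcongr
  · exact (norm_mul_le _ _).trans (mul_le_of_le_one_right (norm_nonneg _) hp)
  · exact (norm_mul_le _ _).trans (mul_le_of_le_one_left (norm_nonneg _) hc)

theorem sum_cfc_tent_eq_one [PartialOrder C] [StarOrderedRing C] {h : C} (hh : 0 ≤ h) {n : ℕ}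
    (hn : ‖h‖ * ‖(1 : C)‖ ≤ n) :
    ∑ j ∈ Finset.range (n + 1), cfc (fun t => tent (t - j)) h = 1 := by
  rw [← cfc_sum (fun (j : ℕ) t => tent (t - j)) h _ (fun _ _ => by fun_prop), ← cfc_one ℝ h]
  refine cfc_congr fun t ht => ?_
  rw [Finset.sum_apply]
  exact sum_tent_sub_natCast (spectrum_nonneg_of_nonneg hh ht)
    ((le_abs_self t).trans ((spectrum.norm_le_norm_mul_of_mem ht).trans hn))

theorem cfc_tent_mul_cfc_clippedId (h : C) (j : ℕ) :
    cfc (fun t => tent (t - j)) h * cfc (fun t => clippedId (t - j)) h =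
      cfc (fun t => tent (t - j) * (t - j)) h := by
  rw [← cfc_mul (fun t => tent (t - j)) (fun t => clippedId (t - j)) h]
  simp only [tent_mul_clippedId]

theorem cfc_tent_mul_sub {h : C} (hh : IsSelfAdjoint h) (j : ℕ) :
    cfc (fun t => tent (t - j)) h * (h - (j : C)) = cfc (fun t => tent (t - j) * (t - j)) h := by
  rw [cfc_mul (fun t => tent (t - j)) (fun t => t - j) h,
    cfc_sub (fun t => t) (fun _ => (j : ℝ)) h, cfc_id' ℝ h, cfc_const (j : ℝ) h, map_natCast]

theorem norm_sum_cfc_tent_mul_le_one [PartialOrder C] [StarOrderedRing C] {h : C} (hh : 0 ≤ h)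
    {n : ℕ} (hn : ‖h‖ * ‖(1 : C)‖ ≤ n) :
    ‖∑ j ∈ Finset.range (n + 1), cfc (fun t => tent (t - j) * (t - j)) h‖ ≤ 1 := by
  refine norm_sum_cfc_le_one h (fun j => by fun_prop) fun t ht => ?_
  refine (Finset.abs_sum_le_sum_abs _ _).trans
    ((Finset.sum_le_sum fun (j : ℕ) _ => abs_tent_mul_le (t - j)).trans_eq ?_)
  exact sum_tent_sub_natCast (spectrum_nonneg_of_nonneg hh ht)
    ((le_abs_self t).trans ((spectrum.norm_le_norm_mul_of_mem ht).trans hn))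

theorem norm_sum_bilin_tent_clippedId_le (hM : ∀ x ∈ I, ∀ z ∈ I, ‖β x z‖ ≤ M * ‖x‖ * ‖z‖)
    (hM0 : 0 ≤ M) (hβ : ∀ x ∈ I, ∀ z ∈ I, x * z = 0 → β x z = 0) {x z : C} (hx : x ∈ I)
    (hz : z ∈ I) (h : C) (s : Finset ℕ) (m : ℕ) :
    ‖∑ j ∈ s with j % 4 = m, β (x * cfc (fun t => tent (t - j)) h)
      (cfc (fun t => clippedId (t - j)) h * z)‖ ≤ M * ‖x‖ * ‖z‖ := by
  have hdist : ∀ i ∈ s.filter (· % 4 = m), ∀ j ∈ s.filter (· % 4 = m), i ≠ j → ∀ t : ℝ,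
      2 ≤ |t - i| ∨ 2 ≤ |t - j| := by
    intro i hi j hj hij t
    have h4 := four_le_abs_sub_of_mod_eq
      ((Finset.mem_filter.1 hi).2.trans (Finset.mem_filter.1 hj).2.symm) hij
    by_contra! hlt
    have := abs_sub_le (i : ℝ) t j
    rw [abs_sub_comm (i : ℝ) t] at this
    linarith
  have hsupp : ∀ i ∈ s.filter (· % 4 = m), ∀ j ∈ s.filter (· % 4 = m), i ≠ j → ∀ t : ℝ,
      tent (t - i) = 0 ∨ clippedId (t - j) = 0 := fun i hi j hj hij t =>
    (hdist i hi j hj hij t).imp (fun h2 => tent_eq_zero (by linarith)) clippedId_eq_zero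
  refine norm_sum_bilin_le_of_mul_eq_zero hM hM0 hβ hx hz (fun i hi j hj hij => ?_) ?_ ?_
  · rw [← cfc_mul (fun t => tent (t - i)) (fun t => clippedId (t - j)) h]
    simp only [mul_eq_zero.2 (hsupp i hi j hj hij _), cfc_const_zero]
  · refine norm_sum_cfc_le_one h (fun j => by fun_prop) fun t _ =>
      abs_sum_le_one_of_pairwise (fun j => abs_tent_le _) fun i hi j hj hij => ?_
    exact (hdist i hi j hj hij t).imp (fun h2 => tent_eq_zero (by linarith))
      (fun h2 => tent_eq_zero (by linarith))
  · refine norm_sum_cfc_le_one h (fun j => by fun_prop) fun t _ =>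
      abs_sum_le_one_of_pairwise (fun j => abs_clippedId_le _) fun i hi j hj hij => ?_
    exact (hdist i hi j hj hij t).imp clippedId_eq_zero clippedId_eq_zero

theorem apply_mul_sub_apply_mul_eq_of_tent (hβ : ∀ x ∈ I, ∀ z ∈ I, x * z = 0 → β x z = 0)
    {x z : C} (hx : x ∈ I) (hz : z ∈ I) {h : C} (hh : IsSelfAdjoint h) (j : ℕ) :
    β (x * cfc (fun t => tent (t - j)) h * h) z - β (x * cfc (fun t => tent (t - j)) h) (h * z) =
      β (x * cfc (fun t => tent (t - j) * (t - j)) h) z -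
        β (x * cfc (fun t => tent (t - j)) h) (cfc (fun t => clippedId (t - j)) h * z) := by
  have hmul := cfc_tent_mul_sub hh j
  have hclip := cfc_tent_mul_cfc_clippedId h j
  generalize cfc (fun t => tent (t - j)) h = p at *
  generalize cfc (fun t => clippedId (t - j)) h = c at *
  have hzero : β (x * p) ((h - j - c) * z) = 0 := by
    refine hβ _ (I.mul_mem_right _ hx) _ (I.mul_mem_left _ hz) ?_
    rw [mul_assoc, ← mul_assoc p, mul_sub, hmul, hclip, sub_self, zero_mul, mul_zero]
  have hleft : x * p * h = x * (p * (h - j)) + j • (x * p) := by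
    rw [nsmul_eq_mul, (Nat.cast_commute j (x * p)).eq]
    noncomm_ring
  have hright : h * z = (h - j - c) * z + c * z + j • z := by
    rw [nsmul_eq_mul]
    noncomm_ring
  rw [hleft, hright, hmul]
  simp only [map_add, map_nsmul, LinearMap.add_apply, LinearMap.smul_apply, hzero]
  abel

theorem norm_apply_mul_sub_apply_mul_le [PartialOrder C] [StarOrderedRing C]
    (hM : ∀ x ∈ I, ∀ z ∈ I, ‖β x z‖ ≤ M * ‖x‖ * ‖z‖)
    (hM0 : 0 ≤ M) (hβ : ∀ x ∈ I, ∀ z ∈ I, x * z = 0 → β x z = 0) {x z : C} (hx : x ∈ I)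
    (hz : z ∈ I) {h : C} (hh : 0 ≤ h) : ‖β (x * h) z - β x (h * z)‖ ≤ 5 * (M * ‖x‖ * ‖z‖) := by
  obtain ⟨n, hn⟩ := exists_nat_ge (‖h‖ * ‖(1 : C)‖)
  set s := Finset.range (n + 1)
  set p : ℕ → C := fun j => cfc (fun t => tent (t - j)) h
  set c : ℕ → C := fun j => cfc (fun t => clippedId (t - j)) h
  set q : ℕ → C := fun j => cfc (fun t => tent (t - j) * (t - j)) h
  have hp : ∑ j ∈ s, p j = 1 := sum_cfc_tent_eq_one hh hn
  have hdiff : β (x * h) z - β x (h * z) =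
      β (x * ∑ j ∈ s, q j) z - ∑ j ∈ s, β (x * p j) (c j * z) :=
    calc β (x * h) z - β x (h * z)
        = β (x * (∑ j ∈ s, p j) * h) z - β (x * ∑ j ∈ s, p j) (h * z) := by rw [hp, mul_one]
      _ = ∑ j ∈ s, (β (x * p j * h) z - β (x * p j) (h * z)) := by
          simp only [Finset.mul_sum, Finset.sum_mul, map_sum, LinearMap.sum_apply,
            Finset.sum_sub_distrib]
      _ = ∑ j ∈ s, (β (x * q j) z - β (x * p j) (c j * z)) :=
          Finset.sum_congr rfl fun j _ =>
            apply_mul_sub_apply_mul_eq_of_tent hβ hx hz (.of_nonneg hh) j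
      _ = β (x * ∑ j ∈ s, q j) z - ∑ j ∈ s, β (x * p j) (c j * z) := by
          simp only [Finset.mul_sum, map_sum, LinearMap.sum_apply, Finset.sum_sub_distrib]
  have hq : ‖β (x * ∑ j ∈ s, q j) z‖ ≤ M * ‖x‖ * ‖z‖ := by
    refine (hM _ (I.mul_mem_right _ hx) _ hz).trans ?_
    gcongr
    exact (norm_mul_le _ _).trans (mul_le_of_le_one_right (norm_nonneg _)
      (norm_sum_cfc_tent_mul_le_one hh hn))
  have hpc : ‖∑ j ∈ s, β (x * p j) (c j * z)‖ ≤ 4 * (M * ‖x‖ * ‖z‖) := by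
    rw [← Finset.sum_fiberwise_of_maps_to (t := Finset.range 4) (g := (· % 4))
      fun j _ => Finset.mem_range.2 (Nat.mod_lt j four_pos)]
    refine (norm_sum_le_of_le _ fun m _ =>
      norm_sum_bilin_tent_clippedId_le hM hM0 hβ hx hz h s m).trans_eq ?_
    simp
  rw [hdiff]
  linarith [norm_sub_le (β (x * ∑ j ∈ s, q j) z) (∑ j ∈ s, β (x * p j) (c j * z))]

theorem apply_mul_eq_apply_mul_of_nonneg [PartialOrder C] [StarOrderedRing C]
    (hM : ∀ x ∈ I, ∀ z ∈ I, ‖β x z‖ ≤ M * ‖x‖ * ‖z‖)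
    (hM0 : 0 ≤ M) (hβ : ∀ x ∈ I, ∀ z ∈ I, x * z = 0 → β x z = 0) {x z : C} (hx : x ∈ I)
    (hz : z ∈ I) {h : C} (hh : 0 ≤ h) : β (x * h) z = β x (h * z) := by
  -- The bound is independent of `h`, hence applies to all multiples of `h`.
  have hbound : ∀ k : ℕ, k • ‖β (x * h) z - β x (h * z)‖ ≤ 5 * (M * ‖x‖ * ‖z‖) := fun k => by
    have := norm_apply_mul_sub_apply_mul_le hM hM0 hβ hx hz (nsmul_nonneg hh k)
    rwa [mul_smul_comm, smul_mul_assoc, map_nsmul, map_nsmul, LinearMap.smul_apply, ← smul_sub,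
      ← Nat.cast_smul_eq_nsmul ℝ, norm_smul, RCLike.norm_natCast, ← nsmul_eq_mul] at this
  rw [← sub_eq_zero, ← norm_le_zero_iff]
  by_contra! hpos
  obtain ⟨k, hk⟩ := exists_lt_nsmul hpos (5 * (M * ‖x‖ * ‖z‖))
  exact hk.not_ge (hbound k)

theorem apply_mul_eq_apply_mul_of_mul_eq_zero [PartialOrder C] [StarOrderedRing C]
    (hM : ∀ x ∈ I, ∀ z ∈ I, ‖β x z‖ ≤ M * ‖x‖ * ‖z‖)
    (hM0 : 0 ≤ M) (hβ : ∀ x ∈ I, ∀ z ∈ I, x * z = 0 → β x z = 0) {x z : C} (hx : x ∈ I)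
    (hz : z ∈ I) (y : C) : β (x * y) z = β x (y * z) := by
  have hy : y ∈ Submodule.span ℂ {y : C | 0 ≤ y} := CStarAlgebra.span_nonneg (A := C) ▸ trivial
  induction hy using Submodule.span_induction with
  | mem y hy => exact apply_mul_eq_apply_mul_of_nonneg hM hM0 hβ hx hz hy
  | zero => simp
  | add a b _ _ ha hb => simp only [mul_add, add_mul, map_add, LinearMap.add_apply, ha, hb]
  | smul c a _ ha =>
    simp only [mul_smul_comm, smul_mul_assoc, map_smul, LinearMap.smul_apply, ha]

end ZeroProducts

/-- The zero product theorem is applied in the unitization of `A`, to the ideal `A`. -/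
theorem IsCPC.map_mul_map {A B : Type*} [NonUnitalCStarAlgebra A] [PartialOrder A]
    [StarOrderedRing A] [NonUnitalCStarAlgebra B] [PartialOrder B] [StarOrderedRing B]
    {f : A →ₗ[ℂ] B} (hf : IsCPC f) (h0 : IsOrderZero f) (x y z : A) :
    f (x * y) * f z = f x * f (y * z) := by
  let g : Unitization ℂ A →ₗ[ℂ] B := f ∘ₗ Unitization.sndHom ℂ ℂ A
  let I : Ideal (Unitization ℂ A) := RingHom.ker (Unitization.fstHom ℂ A)
  have hI : ∀ {p : Unitization ℂ A}, p ∈ I → ∃ a : A, (a : Unitization ℂ A) = p := fun {p} hp =>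
    ⟨p.snd, Unitization.ext (RingHom.mem_ker.1 hp).symm rfl⟩
  have hmem : ∀ a : A, (a : Unitization ℂ A) ∈ I := fun a => RingHom.mem_ker.2 rfl
  have hbound : ∀ p ∈ I, ∀ q ∈ I, ‖(LinearMap.mul ℂ B).compl₁₂ g g p q‖ ≤ 1 * ‖p‖ * ‖q‖ := by
    intro p hp q hq
    obtain ⟨a, rfl⟩ := hI hp
    obtain ⟨b, rfl⟩ := hI hq
    rw [one_mul, Unitization.norm_inr, Unitization.norm_inr]
    exact (norm_mul_le _ _).trans
      (mul_le_mul (hf.contractive a) (hf.contractive b) (norm_nonneg _) (norm_nonneg _))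
  have hzero : ∀ p ∈ I, ∀ q ∈ I, p * q = 0 → (LinearMap.mul ℂ B).compl₁₂ g g p q = 0 := by
    intro p hp q hq hpq
    obtain ⟨a, rfl⟩ := hI hp
    obtain ⟨b, rfl⟩ := hI hq
    rw [← Unitization.inr_mul, ← Unitization.inr_zero] at hpq
    exact hf.map_mul_map_eq_zero h0 (Unitization.inr_injective hpq)
  have := apply_mul_eq_apply_mul_of_mul_eq_zero hbound zero_le_one hzero (hmem x) (hmem z) y
  rw [← Unitization.inr_mul, ← Unitization.inr_mul] at this
  exact this

section PartialIsometry

/-- `v` is a partial isometry whose source and range projections lie below `p` and `q`. -/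
structure IsPartialIsometryFrom {R : Type*} [Mul R] [Star R] (p q v : R) : Prop where
  mul_star_mul_self : v * star v * v = v
  mul_source : v * p = v
  target_mul : q * v = v

variable {R : Type*} [NonUnitalRing R] [StarRing R] {p q v w : R}

protected theorem IsPartialIsometryFrom.star (hp : IsSelfAdjoint p) (hq : IsSelfAdjoint q)
    (hv : IsPartialIsometryFrom p q v) : IsPartialIsometryFrom q p (star v) where
  mul_star_mul_self := by simpa [mul_assoc] using congrArg star hv.mul_star_mul_self
  mul_source := by simpa [hq.star_eq] using congrArg star hv.target_mul
  target_mul := by simpa [hp.star_eq] using congrArg star hv.mul_source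

theorem IsPartialIsometryFrom.mul_sub_eq_zero (hv : IsPartialIsometryFrom p q v) :
    v * (p - star v * v) = 0 := by
  rw [mul_sub, hv.mul_source, ← mul_assoc, hv.mul_star_mul_self, sub_self]

theorem IsPartialIsometryFrom.add (hv : IsPartialIsometryFrom p q v)
    (hw : IsPartialIsometryFrom p q w) (hwv : w * star v = 0) (hvw : star v * w = 0) :
    IsPartialIsometryFrom p q (v + w) where
  mul_star_mul_self := by
    have hvw' : v * star w = 0 := by simpa using congrArg star hwv
    have hwv' : star w * v = 0 := by simpa using congrArg star hvw
    simp only [star_add, add_mul, mul_add, hwv, hvw', add_zero, zero_add, mul_assoc, hvw, hwv',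
      mul_zero]
    rw [← mul_assoc, ← mul_assoc, hv.mul_star_mul_self, hw.mul_star_mul_self]
  mul_source := by rw [add_mul, hv.mul_source, hw.mul_source]
  target_mul := by rw [mul_add, hv.target_mul, hw.target_mul]

theorem range_mulRight_lt_range_mulRight_add {𝕜 : Type*} [Field 𝕜] [Module 𝕜 R]
    [IsScalarTower 𝕜 R R] (hv : v * star v * v = v)
    (hw : w * star w * w = w) (hw0 : w ≠ 0) (hwv : w * star v = 0) (hvw : star v * w = 0) :
    LinearMap.range (LinearMap.mulRight 𝕜 v) < LinearMap.range (LinearMap.mulRight 𝕜 (v + w)) := by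
  refine SetLike.lt_iff_le_and_exists.2 ⟨?_, w, LinearMap.mem_range.2 ⟨w * star w, ?_⟩, ?_⟩
  · rintro _ ⟨z, rfl⟩
    refine ⟨z * v * star v, ?_⟩
    simp only [LinearMap.mulRight_apply, mul_add, mul_assoc, hvw, mul_zero, add_zero]
    rw [← mul_assoc v, hv]
  · have hwv' : star w * v = 0 := by simpa using congrArg star hvw
    rw [LinearMap.mulRight_apply, mul_add, mul_assoc, hwv', mul_zero, zero_add, hw]
  · rintro ⟨z, hz⟩
    refine hw0 ?_
    calc w = z * (v * star v * v) := by rw [hv]; exact hz.symm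
      _ = w * star v * v := by simp only [← hz, LinearMap.mulRight_apply, mul_assoc]
      _ = 0 := by rw [hwv, zero_mul]

end PartialIsometry

section SpectralCut

variable {F : Type*} [NonUnitalCStarAlgebra F]

/-- The part of `f(a)` living on the part of the spectrum above the level `c`. The function applied
to `a` is in general discontinuous, so this is meaningful in finite dimensions only. -/
def spectralCut (c : ℝ) (f : ℝ → ℝ) (a : F) : F := cfcₙ ((Set.Ioi c).indicator f) a

theorem star_spectralCut (c : ℝ) (f : ℝ → ℝ) (a : F) :
    star (spectralCut c f a) = spectralCut c f a :=
  star_cfcₙ_real _ a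

theorem spectralCut_congr {c : ℝ} {f g : ℝ → ℝ} (h : ∀ t, c < t → f t = g t) (a : F) :
    spectralCut c f a = spectralCut c g a :=
  congrArg (cfcₙ · a) (Set.indicator_congr h)

theorem norm_spectralCut_le {c : ℝ} {f : ℝ → ℝ} {a : F} (ha : IsSelfAdjoint a)
    {M : ℝ} (hM : 0 ≤ M) (h : ∀ t, c < t → t ≤ ‖a‖ → |f t| ≤ M) : ‖spectralCut c f a‖ ≤ M := by
  refine norm_cfcₙ_le fun t ht => ?_
  by_cases hct : c < t
  · rw [Set.indicator_of_mem (Set.mem_Ioi.2 hct)]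
    exact h t hct ((le_abs_self t).trans (by
      simpa using NonUnitalIsometricContinuousFunctionalCalculus.norm_quasispectrum_le a ht))
  · rwa [Set.indicator_of_notMem (by simpa using hct), norm_zero]

variable [FiniteDimensional ℂ F]

theorem finite_quasispectrum (a : F) : (quasispectrum ℝ a).Finite := by
  rw [Unitization.quasispectrum_eq_spectrum_inr ℝ a]
  have : FiniteDimensional ℝ F := FiniteDimensional.complexToReal F
  have : Module.Finite ℝ (Unitization ℝ F) :=
    Module.Finite.equiv (Unitization.linearEquiv ℝ ℝ F).symm
  set x : Unitization ℝ F := (a : Unitization ℝ F)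
  have hx : IsIntegral ℝ x := Algebra.IsIntegral.isIntegral x
  refine ((minpoly ℝ x).roots.toFinset.finite_toSet).subset fun t ht => ?_
  have h := spectrum.subset_polynomial_aeval x (minpoly ℝ x) ⟨t, ht, rfl⟩
  rw [minpoly.aeval, spectrum.zero_eq] at h
  simpa [Polynomial.mem_roots (minpoly.ne_zero hx)] using h

theorem continuousOn_quasispectrum (f : ℝ → ℝ) (a : F) : ContinuousOn f (quasispectrum ℝ a) :=
  (finite_quasispectrum a).continuousOn f

variable {c : ℝ}

theorem spectralCut_mul_cfcₙ (hc : 0 ≤ c) (f : ℝ → ℝ) {g : ℝ → ℝ} (hg : g 0 = 0) (a : F) :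
    spectralCut c f a * cfcₙ g a = spectralCut c (fun t => f t * g t) a := by
  rw [spectralCut, ← cfcₙ_mul _ _ a (continuousOn_quasispectrum _ _)
    (Set.indicator_of_notMem (by simpa using hc) f) (continuousOn_quasispectrum _ _) hg]
  simp only [spectralCut, ← Set.indicator_mul_left]

theorem spectralCut_mul_spectralCut (hc : 0 ≤ c) (f g : ℝ → ℝ) (a : F) :
    spectralCut c f a * spectralCut c g a = spectralCut c (fun t => f t * g t) a := by
  have hg : (Set.Ioi c).indicator g 0 = 0 := Set.indicator_of_notMem (by simpa using hc) g
  rw [spectralCut.eq_1 c g, spectralCut_mul_cfcₙ hc f hg]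
  refine spectralCut_congr (fun t ht => ?_) a
  rw [Set.indicator_of_mem (Set.mem_Ioi.2 ht)]

theorem spectralCut_mul_self (hc : 0 ≤ c) (f : ℝ → ℝ) {a : F} (ha : IsSelfAdjoint a) :
    spectralCut c f a * a = spectralCut c (fun t => f t * t) a := by
  simpa only [cfcₙ_id' ℝ a] using spectralCut_mul_cfcₙ hc f (g := fun t => t) rfl a

theorem self_mul_spectralCut (hc : 0 ≤ c) (f : ℝ → ℝ) {a : F} (ha : IsSelfAdjoint a) :
    a * spectralCut c f a = spectralCut c (fun t => f t * t) a := by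
  simpa only [star_mul, star_spectralCut, ha.star_eq] using
    congrArg star (spectralCut_mul_self hc f ha)

theorem isStarProjection_spectralCut_one (hc : 0 ≤ c) (a : F) :
    IsStarProjection (spectralCut c 1 a) where
  isIdempotentElem := by
    rw [IsIdempotentElem, spectralCut_mul_spectralCut hc]
    simp only [Pi.one_apply, mul_one, Pi.one_def]
  isSelfAdjoint := star_spectralCut c 1 a

theorem norm_sub_spectralCut_id_le [PartialOrder F] [StarOrderedRing F] (hc : 0 ≤ c) {a : F}
    (ha : 0 ≤ a) : ‖a - spectralCut c id a‖ ≤ c := by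
  have hcut : a - spectralCut c id a = cfcₙ (fun t => t - (Set.Ioi c).indicator id t) a := by
    rw [cfcₙ_sub (fun t => t) _ a (continuousOn_quasispectrum _ _) rfl
      (continuousOn_quasispectrum _ _) (Set.indicator_of_notMem (by simpa using hc) id),
      cfcₙ_id' ℝ a, spectralCut]
  rw [hcut]
  refine norm_cfcₙ_le fun t ht => ?_
  by_cases hct : c < t
  · rwa [Set.indicator_of_mem (Set.mem_Ioi.2 hct), id, sub_self, norm_zero]
  · rw [Set.indicator_of_notMem (by simpa using hct), sub_zero,
      Real.norm_of_nonneg (quasispectrum_nonneg_of_nonneg a ha t ht)]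
    exact not_lt.1 hct

end SpectralCut

section FixedRight

variable {𝕜 R : Type*} [Field 𝕜] [NonUnitalRing R] [Module 𝕜 R] [IsScalarTower 𝕜 R R]
  {p q v w : R}

/-- The elements of `I` fixed by right multiplication by `p`. -/
def fixedRight (I : Submodule 𝕜 R) (p : R) : Submodule 𝕜 R :=
  I ⊓ LinearMap.eqLocus (LinearMap.mulRight 𝕜 p) LinearMap.id

theorem mem_fixedRight {I : Submodule 𝕜 R} {u : R} : u ∈ fixedRight I p ↔ u ∈ I ∧ u * p = u :=
  Iff.rfl

variable [FiniteDimensional 𝕜 R]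

theorem finrank_fixedRight_le {I : Submodule 𝕜 R} (hI : ∀ u ∈ I, u * v ∈ I) (hvp : v * p = v)
    (hIv : ∀ u ∈ I, u * (q - v * w) = 0) :
    Module.finrank 𝕜 (fixedRight I q) ≤ Module.finrank 𝕜 (fixedRight I p) := by
  let T : fixedRight I q →ₗ[𝕜] fixedRight I p :=
    (LinearMap.mulRight 𝕜 v).restrict fun u hu =>
      mem_fixedRight.2 ⟨hI u hu.1, by rw [LinearMap.mulRight_apply, mul_assoc, hvp]⟩
  refine LinearMap.finrank_le_finrank_of_injective (f := T) fun a b hab => Subtype.ext ?_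
  have hab' : (a : R) * v = b * v := congrArg Subtype.val hab
  have hrecover : ∀ c : fixedRight I q, (c : R) = c * v * w := fun c => by
    have := hIv c c.2.1
    rwa [mul_sub, (mem_fixedRight.1 c.2).2, ← mul_assoc, sub_eq_zero] at this
  rw [hrecover a, hab', ← hrecover b]

variable {ι κ : Type*} [Fintype ι] [Fintype κ]

theorem card_mul_finrank_fixedRight_le (hq : IsIdempotentElem q) (X : ι → κ → R)
    (hX : ∀ u : ι → R, (∀ i, u i * p = u i) → (∀ l, ∑ i, u i * X i l * q = 0) → u = 0)
    {I : Submodule 𝕜 R} (hI : ∀ u ∈ I, ∀ z, u * z ∈ I) :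
    Fintype.card ι * Module.finrank 𝕜 (fixedRight I p) ≤
      Fintype.card κ * Module.finrank 𝕜 (fixedRight I q) := by
  let T : (ι → fixedRight I p) →ₗ[𝕜] (κ → fixedRight I q) :=
    { toFun := fun u l => ⟨∑ i, (u i : R) * X i l * q,
        I.sum_mem fun i _ => hI _ (hI _ (u i).2.1 _) _, by
          simp [mul_assoc, hq.eq]⟩
      map_add' := fun a b => by
        ext l
        simp [add_mul, Finset.sum_add_distrib]
      map_smul' := fun c a => by
        ext l
        simp [smul_mul_assoc, Finset.smul_sum] }
  have hT : Function.Injective T := by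
    refine (injective_iff_map_eq_zero T).2 fun u hu => ?_
    have := hX (fun i => u i) (fun i => (u i).2.2) fun l => congrArg Subtype.val (congrFun hu l)
    ext i
    exact congrFun this i
  simpa [Module.finrank_pi_fintype] using LinearMap.finrank_le_finrank_of_injective hT

end FixedRight

section Perturbation

theorem eq_sum_mul_sub_mul {R : Type*} [NonUnitalRing R] {ι κ : Type*} [Fintype ι] [DecidableEq ι]
    [Fintype κ] {u : ι → R} {X : ι → κ → R} {Y : κ → ι → R} {w b g p : R}
    (hu : ∀ i, u i * p = u i) (hwg : w * g = p) (huX : ∀ l, (∑ i, u i * X i l) * b = 0) (j : ι) :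
    u j = (∑ i, u i * ((if i = j then w else 0) - ∑ l, X i l * b * Y l j)) * g := by
  have hsum : ∑ i, u i * ∑ l, X i l * b * Y l j = 0 := by
    simp only [Finset.mul_sum]
    rw [Finset.sum_comm]
    refine Finset.sum_eq_zero fun l _ => ?_
    simp only [← mul_assoc, ← Finset.sum_mul, huX, zero_mul]
  simp only [mul_sub, Finset.sum_sub_distrib, hsum, sub_zero, mul_ite, mul_zero,
    Finset.sum_ite_eq', Finset.mem_univ, if_true]
  rw [mul_assoc, hwg, hu]

variable {R : Type*} [NonUnitalNormedRing R] {ι κ : Type*} [Fintype ι] [Fintype κ]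

theorem norm_sub_sum_mul_mul_le {b b' c : R} {x y : κ → R} {η δ C : ℝ}
    (hc : ‖c - ∑ l, x l * b * y l‖ ≤ η) (hbb' : ‖b - b'‖ ≤ δ) (hx : ∀ l, ‖x l‖ ≤ C)
    (hy : ∀ l, ‖y l‖ ≤ C) :
    ‖c - ∑ l, x l * b' * y l‖ ≤ η + Fintype.card κ * (C * δ * C) := by
  have hsplit : c - ∑ l, x l * b' * y l =
      (c - ∑ l, x l * b * y l) + ∑ l, x l * (b - b') * y l := by
    simp only [mul_sub, sub_mul, Finset.sum_sub_distrib]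
    abel
  have hterm : ∀ l, ‖x l * (b - b') * y l‖ ≤ C * δ * C := fun l => by
    have hC : 0 ≤ C := (norm_nonneg _).trans (hx l)
    have hδ : 0 ≤ δ := (norm_nonneg _).trans hbb'
    refine norm_mul₃_le.trans ?_
    gcongr
    exacts [hx l, hy l]
  rw [hsplit]
  refine (norm_add_le _ _).trans (add_le_add hc ?_)
  exact (norm_sum_le_of_le _ fun l _ => hterm l).trans (by simp)

theorem eq_zero_of_eq_sum_mul_mul {u : ι → R} {D : ι → ι → R} {g : R} {ε M : ℝ}
    (hu : ∀ j, u j = (∑ i, u i * D i j) * g) (hD : ∀ i j, ‖D i j‖ ≤ ε) (hg : ‖g‖ ≤ M)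
    (hε : Fintype.card ι * ε * M < 1) : u = 0 := by
  rcases isEmpty_or_nonempty ι with hι | ⟨⟨i₀⟩⟩
  · exact Subsingleton.elim _ _
  have hε0 : 0 ≤ ε := (norm_nonneg _).trans (hD i₀ i₀)
  have hM : 0 ≤ Fintype.card ι * (‖u‖ * ε) * M := by
    have := (norm_nonneg _).trans hg
    positivity
  have hle : ‖u‖ ≤ Fintype.card ι * (‖u‖ * ε) * M := by
    refine (pi_norm_le_iff_of_nonneg hM).2 fun j => ?_
    rw [hu j]
    refine (norm_mul_le _ _).trans ?_
    gcongr
    refine (norm_sum_le_of_le _ (f := fun i => u i * D i j) (n := fun _ => ‖u‖ * ε)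
      fun i _ => ?_).trans (by simp)
    refine (norm_mul_le _ _).trans ?_
    gcongr
    exacts [norm_le_pi_norm u i, hD i j]
  refine norm_le_zero_iff.1 (not_lt.1 fun hpos => ?_)
  nlinarith

end Perturbation

section FiniteDimensional

variable {F : Type*} [NonUnitalCStarAlgebra F] [FiniteDimensional ℂ F] [PartialOrder F]
  [StarOrderedRing F]

theorem exists_mul_mul_self_partialIsometry {x : F} (hx : x ≠ 0) :
    ∃ g : F, x * (g * x) ≠ 0 ∧ x * (g * x) * star (x * (g * x)) * (x * (g * x)) = x * (g * x) := by
  set h := star x * x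
  have hh : 0 ≤ h := star_mul_self_nonneg x
  have hsa : IsSelfAdjoint h := .of_nonneg hh
  set s := spectralCut 0 (fun t => (√t)⁻¹) h
  have hs : star s = s := star_spectralCut _ _ _
  have hgh : spectralCut 0 (fun t => (√t)⁻¹ / t) h * h = s := by
    rw [spectralCut_mul_self le_rfl _ hsa]
    exact spectralCut_congr (fun t ht => div_mul_cancel₀ _ ht.ne') h
  refine ⟨spectralCut 0 (fun t => (√t)⁻¹ / t) h * star x, ?_⟩
  rw [mul_assoc, hgh]
  constructor
  · intro hxs
    have hh0 : h * s * s * h = h := by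
      rw [self_mul_spectralCut le_rfl _ hsa, spectralCut_mul_spectralCut le_rfl,
        spectralCut_mul_self le_rfl _ hsa, ← sub_eq_zero, ← norm_le_zero_iff, norm_sub_rev]
      refine (congrArg (‖h - ·‖) (spectralCut_congr (fun t ht => ?_) h)).trans_le
        (norm_sub_spectralCut_id_le le_rfl hh)
      have := (Real.sqrt_pos.2 ht).ne'
      field_simp
      rw [Real.sq_sqrt ht.le, id, sq]
    rw [mul_assoc (star x), hxs, mul_zero, zero_mul, zero_mul] at hh0
    exact hx ((CStarRing.star_mul_self_eq_zero_iff x).1 hh0.symm)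
  · have hshs : s * s * h * s = s := by
      rw [spectralCut_mul_spectralCut le_rfl, spectralCut_mul_self le_rfl _ hsa,
        spectralCut_mul_spectralCut le_rfl]
      refine spectralCut_congr (fun t ht => ?_) h
      have := (Real.sqrt_pos.2 ht).ne'
      field_simp
      rw [Real.sq_sqrt ht.le]
    calc x * s * star (x * s) * (x * s) = x * (s * s * (star x * x) * s) := by
          rw [star_mul, hs]
          simp only [mul_assoc]
      _ = x * s := by rw [hshs]

variable {p q v : F}

theorem IsPartialIsometryFrom.exists_orthogonal_of_ne_zero (hp : IsStarProjection p)
    (hq : IsStarProjection q) (hv : IsPartialIsometryFrom p q v) {y : F}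
    (hy : (q - v * star v) * y * (p - star v * v) ≠ 0) :
    ∃ w, w ≠ 0 ∧ IsPartialIsometryFrom p q w ∧ w * star v = 0 ∧ star v * w = 0 := by
  have hps := hp.isSelfAdjoint
  have hqs := hq.isSelfAdjoint
  obtain ⟨g, hw0, hw⟩ := exists_mul_mul_self_partialIsometry hy
  refine ⟨_, hw0, ⟨hw, ?_, ?_⟩, ?_, ?_⟩
  · simp only [mul_assoc, sub_mul, hp.isIdempotentElem.eq, hv.mul_source]
  · simp only [← mul_assoc, mul_sub, hq.isIdempotentElem.eq, hv.target_mul]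
  · have h0 : (p - star v * v) * star v = 0 := by
      simpa [hps.star_eq, mul_sub, sub_mul, mul_assoc] using congrArg star hv.mul_sub_eq_zero
    simp only [mul_assoc, h0, mul_zero]
  · have h0 : star v * (q - v * star v) = 0 := by
      simpa only [star_star] using (hv.star hps hqs).mul_sub_eq_zero
    simp only [← mul_assoc, h0, zero_mul]

theorem exists_maximal_partialIsometry (hp : IsStarProjection p) (hq : IsStarProjection q) :
    ∃ v : F, IsPartialIsometryFrom p q v ∧
      ∀ y, (q - v * star v) * y * (p - star v * v) = 0 := by
  obtain ⟨v, hv, hmax⟩ := exists_maximalFor_of_wellFoundedGT (IsPartialIsometryFrom p q)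
    (fun v => LinearMap.range (LinearMap.mulRight ℂ v)) ⟨0, by simp, by simp, by simp⟩
  refine ⟨v, hv, ?_⟩
  by_contra! hne
  obtain ⟨y, hy⟩ := hne
  obtain ⟨w, hw0, hw, hwv, hvw⟩ := hv.exists_orthogonal_of_ne_zero hp hq hy
  have hlt := range_mulRight_lt_range_mulRight_add (𝕜 := ℂ) hv.mul_star_mul_self
    hw.mul_star_mul_self hw0 hwv hvw
  exact hlt.not_ge (hmax (hv.add hw hwv hvw) hlt.le)

variable {ι κ : Type*} [Fintype ι] [Fintype κ]

/-- If more copies of `p` embed into fewer copies of `q`, compare the dimensions of `I p` and `I q`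
for the ideal `I` generated by the defect `p - v⋆v` of a maximal partial isometry `v`: on `I`, the
projection `q` is equivalent to a subprojection of `p`. -/
theorem exists_partialIsometry_of_injective (hp : IsStarProjection p) (hq : IsStarProjection q)
    (hcard : Fintype.card κ < Fintype.card ι) (X : ι → κ → F)
    (hX : ∀ u : ι → F, (∀ i, u i * p = u i) → (∀ l, ∑ i, u i * X i l * q = 0) → u = 0) :
    ∃ v : F, star v * v = p ∧ q * v = v := by
  obtain ⟨v, hv, hmax⟩ := exists_maximal_partialIsometry hp hq
  refine ⟨v, ?_, hv.target_mul⟩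
  set p' := p - star v * v with hp'
  set q' := q - v * star v with hq'
  let I : Submodule ℂ F := ⨅ y : F, LinearMap.ker (LinearMap.mulRight ℂ (y * q'))
  have mem_I : ∀ {u}, u ∈ I ↔ ∀ y, u * (y * q') = 0 := by simp [I, mul_assoc]
  have hI : ∀ u ∈ I, ∀ z, u * z ∈ I := fun u hu z => mem_I.2 fun y => by
    rw [mul_assoc, ← mul_assoc z]
    exact mem_I.1 hu (z * y)
  have hIq : ∀ u ∈ I, u * q' = 0 := fun u hu => by
    have hqq' : q * q' = q' := by
      rw [hq', mul_sub, hq.isIdempotentElem.eq, ← mul_assoc, hv.target_mul]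
    simpa only [hqq'] using mem_I.1 hu q
  have hp'I : p' ∈ I := mem_I.2 fun y => by
    simpa [hp', hq', hp.isSelfAdjoint.star_eq, hq.isSelfAdjoint.star_eq] using
      congrArg star (hmax (star y))
  have hp'p : p' * p = p' := by rw [hp', sub_mul, hp.isIdempotentElem.eq, mul_assoc, hv.mul_source]
  have hle := finrank_fixedRight_le (fun u hu => hI u hu v) hv.mul_source hIq
  have hcard_le := card_mul_finrank_fixedRight_le hq.isIdempotentElem X hX hI
  have hzero : Module.finrank ℂ (fixedRight I p) = 0 := by nlinarith
  have hp'0 : p' ∈ (⊥ : Submodule ℂ F) :=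
    Submodule.finrank_eq_zero.1 hzero ▸ mem_fixedRight.2 ⟨hp'I, hp'p⟩
  exact (sub_eq_zero.1 ((Submodule.mem_bot ℂ).1 hp'0)).symm

theorem exists_conj_near_of_partialIsometry {a b : F} (ha : 0 ≤ a) (hb : 0 ≤ b) {θ δ : ℝ}
    (hθ : 0 ≤ θ) (hδ : 0 < δ) (hvv : star v * v = spectralCut θ 1 a)
    (hbv : spectralCut δ 1 b * v = v) :
    ∃ r : F, ‖r‖ ≤ (√δ)⁻¹ * √‖a‖ ∧ ‖a - star r * b * r‖ ≤ θ := by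
  have hasa : IsSelfAdjoint a := .of_nonneg ha
  have hbsa : IsSelfAdjoint b := .of_nonneg hb
  set s := spectralCut δ (fun t => (√t)⁻¹) b
  set m := spectralCut θ (fun t => √t) a
  have hs : star s = s := star_spectralCut _ _ _
  have hm : star m = m := star_spectralCut _ _ _
  have hsbs : s * b * s = spectralCut δ 1 b := by
    rw [spectralCut_mul_self hδ.le _ hbsa, spectralCut_mul_spectralCut hδ.le]
    refine spectralCut_congr (fun t ht => ?_) b
    have := (Real.sqrt_pos.2 (hδ.trans ht)).ne'
    field_simp
    rw [Real.sq_sqrt (hδ.trans ht).le, Pi.one_apply, mul_one]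
  have hmm : m * spectralCut θ 1 a * m = spectralCut θ id a := by
    rw [spectralCut_mul_spectralCut hθ, spectralCut_mul_spectralCut hθ]
    refine spectralCut_congr (fun t ht => ?_) a
    rw [Pi.one_apply, mul_one, Real.mul_self_sqrt (hθ.trans ht.le), id]
  refine ⟨s * v * m, ?_, ?_⟩
  · have hv1 : ‖v‖ ≤ 1 := by
      have hp : ‖spectralCut θ 1 a‖ ≤ 1 := norm_spectralCut_le hasa zero_le_one fun t _ _ => by simp
      rw [← hvv, CStarRing.norm_star_mul_self] at hp
      nlinarith [norm_nonneg v]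
    have hs1 : ‖s‖ ≤ (√δ)⁻¹ := norm_spectralCut_le hbsa (by positivity) fun t ht _ => by
      rw [abs_of_nonneg (by positivity)]
      gcongr
    have hm1 : ‖m‖ ≤ √‖a‖ := norm_spectralCut_le hasa (by positivity) fun t _ ht => by
      rw [abs_of_nonneg (by positivity)]
      gcongr
    calc ‖s * v * m‖ ≤ ‖s‖ * ‖v‖ * ‖m‖ := norm_mul₃_le
      _ ≤ (√δ)⁻¹ * 1 * √‖a‖ := by gcongr
      _ = (√δ)⁻¹ * √‖a‖ := by rw [mul_one]
  · have hconj : star (s * v * m) * b * (s * v * m) = spectralCut θ id a :=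
      calc star (s * v * m) * b * (s * v * m) = m * (star v * ((s * b * s) * v)) * m := by
            simp only [star_mul, hs, hm, mul_assoc]
        _ = spectralCut θ id a := by rw [hsbs, hbv, hvv, hmm]
    rw [hconj]
    exact norm_sub_spectralCut_id_le hθ ha

theorem eq_zero_of_sum_mul_spectralCut_eq_zero [DecidableEq ι] {a b : F} (ha : 0 ≤ a) (hb : 0 ≤ b)
    {X : ι → κ → F} {Y : κ → ι → F} {C η θ δ : ℝ}
    (hX : ∀ i l, ‖X i l‖ ≤ C) (hY : ∀ l j, ‖Y l j‖ ≤ C) (hθ : 0 < θ) (hδ : 0 ≤ δ)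
    (hXY : ∀ i j, ‖(if i = j then a * a * a else 0) - ∑ l, X i l * b * Y l j‖ ≤ η)
    (hη : Fintype.card ι * (η + Fintype.card κ * (C * δ * C)) < θ ^ 3) {u : ι → F}
    (hu : ∀ i, u i * spectralCut θ 1 a = u i)
    (huX : ∀ l, ∑ i, u i * X i l * spectralCut δ 1 b = 0) : u = 0 := by
  have hasa : IsSelfAdjoint a := .of_nonneg ha
  set b' := spectralCut δ id b
  set g := spectralCut θ (fun t => (t ^ 3)⁻¹) a
  set D : ι → ι → F := fun i j => (if i = j then a * a * a else 0) - ∑ l, X i l * b' * Y l j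
  set ε := η + Fintype.card κ * (C * δ * C)
  have hD : ∀ i j, ‖D i j‖ ≤ ε := fun i j =>
    norm_sub_sum_mul_mul_le (hXY i j) (norm_sub_spectralCut_id_le hδ hb) (hX i) fun l => hY l j
  have hb' : spectralCut δ 1 b * b' = b' := by
    rw [spectralCut_mul_spectralCut hδ]
    exact spectralCut_congr (fun t _ => one_mul _) b
  have hag : a * a * a * g = spectralCut θ 1 a := by
    rw [mul_assoc, mul_assoc, self_mul_spectralCut hθ.le _ hasa, self_mul_spectralCut hθ.le _ hasa,
      self_mul_spectralCut hθ.le _ hasa]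
    refine spectralCut_congr (fun t ht => ?_) a
    have := (hθ.trans ht).ne'
    simp only [Pi.one_apply]
    field_simp
  have hg : ‖g‖ ≤ (θ ^ 3)⁻¹ := norm_spectralCut_le hasa (by positivity) fun t ht _ => by
    have := hθ.trans ht
    rw [abs_of_nonneg (by positivity)]
    gcongr
  have hXb' : ∀ l, (∑ i, u i * X i l) * b' = 0 := fun l =>
    calc (∑ i, u i * X i l) * b' = (∑ i, u i * X i l * spectralCut δ 1 b) * b' := by
          simp only [Finset.sum_mul, mul_assoc, hb']
      _ = 0 := by rw [huX, zero_mul]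
  refine eq_zero_of_eq_sum_mul_mul (eq_sum_mul_sub_mul hu hag hXb') hD hg ?_
  rwa [← div_eq_mul_inv, div_lt_one (by positivity)]

/-- Almost unperforation of finite-dimensional C⋆-algebras, in quantitative form. -/
theorem exists_conj_near_of_finiteDimensional [DecidableEq ι] {a b : F} (ha : 0 ≤ a) (hb : 0 ≤ b)
    (hcard : Fintype.card κ < Fintype.card ι) {X : ι → κ → F} {Y : κ → ι → F} {C η θ δ : ℝ}
    (hX : ∀ i l, ‖X i l‖ ≤ C) (hY : ∀ l j, ‖Y l j‖ ≤ C) (hθ : 0 < θ) (hδ : 0 < δ)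
    (hXY : ∀ i j, ‖(if i = j then a * a * a else 0) - ∑ l, X i l * b * Y l j‖ ≤ η)
    (hη : Fintype.card ι * (η + Fintype.card κ * (C * δ * C)) < θ ^ 3) :
    ∃ r : F, ‖r‖ ≤ (√δ)⁻¹ * √‖a‖ ∧ ‖a - star r * b * r‖ ≤ θ := by
  obtain ⟨v, hvv, hbv⟩ := exists_partialIsometry_of_injective
    (isStarProjection_spectralCut_one hθ.le a) (isStarProjection_spectralCut_one hδ.le b) hcard X
    fun u hu huX => eq_zero_of_sum_mul_spectralCut_eq_zero ha hb hX hY hθ hδ.le hXY hη hu huX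
  exact exists_conj_near_of_partialIsometry ha hb hθ.le hδ hvv hbv

end FiniteDimensional

section MulBalanced

/-- The algebraic form of having order zero: multiplicative up to a factor which can be moved
across. -/
def MulBalanced {R S : Type*} [Mul R] [Mul S] (f : R → S) : Prop :=
  ∀ x y z, f (x * y) * f z = f x * f (y * z)

theorem MulBalanced.map_mul_mul {R S : Type*} [Semigroup R] [Semigroup S] {f : R → S}
    (hf : MulBalanced f) (x y z u w : R) :
    f (x * y * z) * f u * f w = f x * f y * f (z * (u * w)) := by
  rw [hf (x * y) z u, hf x y (z * u), mul_assoc, hf y (z * u) w, ← mul_assoc, mul_assoc z]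

variable {A B : Type*} [NonUnitalCStarAlgebra A] [NonUnitalCStarAlgebra B] {f : A →ₗ[ℂ] B}

theorem MulBalanced.cuntzSub_map_conj [PartialOrder A] [StarOrderedRing A] [PartialOrder B]
    [StarOrderedRing B] (hf : MulBalanced f) (hpos : ∀ x, 0 ≤ x → 0 ≤ f x) {b : A} (hb : 0 ≤ b)
    (r : A) : CuntzSub (f (star r * b * r)) (f b) :=
  CuntzSub.of_cube_eq (hpos _ (star_left_conjugate_nonneg hb r)) (hpos b hb)
    (hf.map_mul_mul (star r) b r _ _)

theorem MulBalanced.norm_cube_sub_sum_le (hf : MulBalanced f) (hcontr : ∀ x, ‖f x‖ ≤ ‖x‖)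
    {ι κ : Type*} [DecidableEq ι] [Fintype κ] {a b : A} {d : κ → ι → A} {η : ℝ} {i j : ι}
    (hd : ‖(if i = j then a else 0) - ∑ l, star (d l i) * b * d l j‖ ≤ η) :
    ‖(if i = j then f a * f a * f a else 0) -
      ∑ l, f (star (d l i)) * f b * f (d l j * (a * a))‖ ≤ η * (‖a‖ * ‖a‖) := by
  have hfactor : (if i = j then f a * f a * f a else 0) -
      ∑ l, f (star (d l i)) * f b * f (d l j * (a * a)) =
      f ((if i = j then a else 0) - ∑ l, star (d l i) * b * d l j) * f a * f a := by
    simp only [map_sub, map_sum, sub_mul, Finset.sum_mul, hf.map_mul_mul]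
    split_ifs <;> simp
  have hη : 0 ≤ η := (norm_nonneg _).trans hd
  rw [hfactor, ← mul_assoc]
  refine norm_mul₃_le.trans ?_
  gcongr
  exacts [(hcontr _).trans hd, hcontr a, hcontr a]

end MulBalanced

theorem exists_pos_lt_of_continuous {f : ℝ → ℝ} (hf : Continuous f) {c : ℝ} (h : f 0 < c) :
    ∃ δ > 0, f δ < c :=
  (((hf.tendsto 0).eventually_lt_const h).filter_mono nhdsWithin_le_nhds |>.and
    self_mem_nhdsWithin).exists (f := 𝓝[>] 0) |>.imp fun _ => And.symm

section ProdModSum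

variable {L : Type*} [Preorder L] {F : L → Type*} [∀ l, NonUnitalCStarAlgebra (F l)]

theorem exists_lp_of_eventually {P : ∀ l, F l → Prop} {R : ℝ}
    (h : ∀ᶠ l in atTop, ∃ y : F l, ‖y‖ ≤ R ∧ P l y) :
    ∃ y : lp F ∞, ∀ᶠ l in atTop, P l (y l) := by
  classical
  choose! g hg using fun l (hl : ∃ y : F l, ‖y‖ ≤ R ∧ P l y) => hl
  refine ⟨⟨fun l => if ∃ y : F l, ‖y‖ ≤ R ∧ P l y then g l else 0, memℓp_infty ⟨|R|, ?_⟩⟩, ?_⟩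
  · rintro _ ⟨l, rfl⟩
    dsimp only
    split_ifs with hl
    · exact (hg l hl).1.trans (le_abs_self R)
    · simp
  · filter_upwards [h] with l hl
    simpa only [if_pos hl] using (hg l hl).2

namespace ProdModSum

theorem norm_diag_le {A : Type*} [NonUnitalCStarAlgebra A] (a : A) : ‖diag L A a‖ ≤ ‖a‖ :=
  norm_mk_le_of_eventually _ (norm_nonneg a) (.of_forall fun _ => le_rfl)

theorem norm_map_le {E : L → Type*} [∀ l, NonUnitalCStarAlgebra (E l)] {T : ∀ l, E l →ₗ[ℂ] F l}
    (hT : ∀ l x, ‖T l x‖ ≤ ‖x‖) (x : ProdModSum E) : ‖map T hT x‖ ≤ ‖x‖ := by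
  refine le_of_forall_pos_le_add fun e he => ?_
  obtain ⟨y, rfl, hy⟩ := exists_norm_lt x he
  refine (norm_mk_le _).trans (LE.le.trans ?_ hy.le)
  exact lp.norm_le_of_forall_le (norm_nonneg y) fun l =>
    (hT l _).trans (lp.norm_apply_le_norm ENNReal.top_ne_zero y l)

theorem exists_norm_sub_sum_conj_lt [IsDirectedOrder L] [Nonempty L] {A : Type*}
    [NonUnitalCStarAlgebra A] {a : A} {b : ℕ → A} {n : ℕ} {e : ℝ}
    {z : ℕ → ProdModSum fun _ : L => A}
    (hz : ‖diag L A a - ∑ i ∈ Finset.range n, star (z i) * diag L A (b i) * z i‖ < e) :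
    ∃ x : ℕ → A, ‖a - ∑ i ∈ Finset.range n, star (x i) * b i * x i‖ < e := by
  choose y hy using fun i => mk_surjective (z i)
  let c : A → lp (fun _ : L => A) ∞ := fun a => ⟨fun _ => a, memℓp_infty ⟨‖a‖, by simp⟩⟩
  have hmk : diag L A a - ∑ i ∈ Finset.range n, star (z i) * diag L A (b i) * z i =
      mk _ (c a - ∑ i ∈ Finset.range n, star (y i) * c (b i) * y i) := by
    simp only [map_sub, map_sum, mk_mul, mk_star, hy]
    rfl
  rw [hmk] at hz
  obtain ⟨l, hl⟩ := (eventually_norm_lt _ hz).exists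
  refine ⟨fun i => y i l, lt_of_eq_of_lt (congrArg norm ?_) hl⟩
  rw [lp.coeFn_sub, Pi.sub_apply, lp.coeFn_sum, Finset.sum_apply]
  rfl

theorem eventually_norm_sub_sum_mul_lt [IsDirectedOrder L] [Nonempty L] {κ : Type*} [Fintype κ]
    {p : Prop} [Decidable p] {a b : lp F ∞} {X Y : κ → lp F ∞} {e : ℝ}
    (h : ‖(if p then mk F a else 0) - ∑ k, mk F (X k) * mk F b * mk F (Y k)‖ < e) :
    ∀ᶠ l in atTop, ‖(if p then a l else 0) - ∑ k, X k l * b l * Y k l‖ < e := by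
  have hmk : (if p then mk F a else 0) - ∑ k, mk F (X k) * mk F b * mk F (Y k) =
      mk F ((if p then a else 0) - ∑ k, X k * b * Y k) := by
    simp only [map_sub, map_sum, apply_ite (mk F), map_zero, mk_mul]
  rw [hmk] at h
  filter_upwards [eventually_norm_lt _ h] with l hl
  refine lt_of_eq_of_lt (congrArg norm ?_) hl
  rw [lp.coeFn_sub, Pi.sub_apply, lp.coeFn_sum, Finset.sum_apply]
  split_ifs <;> rfl

variable [∀ l, PartialOrder (F l)] [∀ l, StarOrderedRing (F l)]

theorem mk_nonneg {x : lp F ∞} (hx : ∀ l, 0 ≤ x l) : 0 ≤ mk F x := by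
  choose c hc using fun l => exists_eq_star_mul_self (hx l)
  have hbound : ∀ l, ‖c l‖ ≤ √‖x‖ := fun l => Real.le_sqrt_of_sq_le <| by
    rw [sq, ← CStarRing.norm_star_mul_self, ← hc]
    exact lp.norm_apply_le_norm ENNReal.top_ne_zero x l
  let y : lp F ∞ := ⟨c, memℓp_infty ⟨√‖x‖, by rintro _ ⟨l, rfl⟩; exact hbound l⟩⟩
  have hxy : x = star y * y := by
    ext l
    exact hc l
  rw [hxy, mk_mul, mk_star]
  exact star_mul_self_nonneg _

theorem exists_mk_eq_of_nonneg {x : ProdModSum F} (hx : 0 ≤ x) :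
    ∃ y : lp F ∞, (∀ l, 0 ≤ y l) ∧ mk F y = x := by
  obtain ⟨c, rfl⟩ := exists_eq_star_mul_self hx
  obtain ⟨y, rfl⟩ := mk_surjective c
  exact ⟨star y * y, fun l => star_mul_self_nonneg (y l), rfl⟩

theorem map_nonneg {E : L → Type*} [∀ l, NonUnitalCStarAlgebra (E l)] [∀ l, PartialOrder (E l)]
    [∀ l, StarOrderedRing (E l)] {T : ∀ l, E l →ₗ[ℂ] F l} (hT : ∀ l x, ‖T l x‖ ≤ ‖x‖)
    (hpos : ∀ l x, 0 ≤ x → 0 ≤ T l x) {x : ProdModSum E} (hx : 0 ≤ x) : 0 ≤ map T hT x := by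
  obtain ⟨y, hy, rfl⟩ := exists_mk_eq_of_nonneg hx
  exact mk_nonneg fun l => hpos l _ (hy l)

theorem diag_nonneg {A : Type*} [NonUnitalCStarAlgebra A] [PartialOrder A] [StarOrderedRing A]
    {a : A} (ha : 0 ≤ a) : 0 ≤ diag L A a :=
  mk_nonneg fun _ => ha

theorem exists_conj_near [IsDirectedOrder L] [Nonempty L] [∀ l, FiniteDimensional ℂ (F l)]
    {ι κ : Type*} [Fintype ι] [Fintype κ] [DecidableEq ι] {a b : ProdModSum F} (ha : 0 ≤ a)
    (hb : 0 ≤ b) (hcard : Fintype.card κ < Fintype.card ι) {X : ι → κ → ProdModSum F}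
    {Y : κ → ι → ProdModSum F} {η θ : ℝ} (hθ : 0 < θ)
    (hXY : ∀ i j, ‖(if i = j then a * a * a else 0) - ∑ l, X i l * b * Y l j‖ ≤ η)
    (hη : Fintype.card ι * η < θ ^ 3) : ∃ r, ‖a - star r * b * r‖ ≤ θ := by
  obtain ⟨a, hapos, rfl⟩ := exists_mk_eq_of_nonneg ha
  obtain ⟨b, hbpos, rfl⟩ := exists_mk_eq_of_nonneg hb
  choose X' hX' using fun i l => mk_surjective (X i l)
  choose Y' hY' using fun l j => mk_surjective (Y l j)
  set C := ‖X'‖ + ‖Y'‖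
  have hX : ∀ p i l, ‖X' i l p‖ ≤ C := fun p i l =>
    (lp.norm_apply_le_norm ENNReal.top_ne_zero _ p).trans <| (norm_le_pi_norm (X' i) l).trans <|
      (norm_le_pi_norm X' i).trans <| le_add_of_nonneg_right (norm_nonneg Y')
  have hY : ∀ p l j, ‖Y' l j p‖ ≤ C := fun p l j =>
    (lp.norm_apply_le_norm ENNReal.top_ne_zero _ p).trans <| (norm_le_pi_norm (Y' l) j).trans <|
      (norm_le_pi_norm Y' l).trans <| le_add_of_nonneg_left (norm_nonneg X')
  obtain ⟨δ, hδ, hδη⟩ : ∃ δ > 0, Fintype.card ι * (η + δ + Fintype.card κ * (C * δ * C)) < θ ^ 3 :=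
    exists_pos_lt_of_continuous (by fun_prop) (by simpa using hη)
  have hXY' : ∀ᶠ p in atTop, ∀ i j, ‖(if i = j then a p * a p * a p else 0) -
      ∑ l, X' i l p * b p * Y' l j p‖ ≤ η + δ := by
    refine eventually_all.2 fun i => eventually_all.2 fun j => ?_
    have hlt : ‖(if i = j then mk F (a * a * a) else 0) -
        ∑ l, mk F (X' i l) * mk F b * mk F (Y' l j)‖ < η + δ := by
      simp only [hX', hY']
      exact (hXY i j).trans_lt (lt_add_of_pos_right η hδ)
    exact (eventually_norm_sub_sum_mul_lt hlt).mono fun p hp => hp.le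
  obtain ⟨r, hr⟩ : ∃ r : lp F ∞, ∀ᶠ p in atTop, ‖a p - star (r p) * b p * r p‖ ≤ θ := by
    refine exists_lp_of_eventually (P := fun p r => ‖a p - star r * b p * r‖ ≤ θ)
      (R := (√δ)⁻¹ * √‖a‖) ?_
    filter_upwards [hXY'] with p hp
    obtain ⟨r, hr, hrθ⟩ := exists_conj_near_of_finiteDimensional (hapos p) (hbpos p) hcard (hX p)
      (hY p) hθ hδ hp hδη
    refine ⟨r, hr.trans ?_, hrθ⟩
    gcongr
    exact lp.norm_apply_le_norm ENNReal.top_ne_zero a p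
  exact ⟨mk F r, norm_mk_le_of_eventually (F := F) (a - star r * b * r) hθ.le hr⟩

end ProdModSum

end ProdModSum

section Factorization

variable {L : Type*} [Preorder L] {A : Type*} [NonUnitalCStarAlgebra A] [PartialOrder A]

open ProdModSum

/-- Nets of positive contractions `A → F l → A` that have order zero in the limit. Unlike complete
positivity, this is inherited by entrywise amplifications for elementary reasons. -/
structure OrderZeroFactorization {F : L → Type*} [∀ l, NonUnitalCStarAlgebra (F l)]
    [∀ l, PartialOrder (F l)] [∀ l, StarOrderedRing (F l)] (ψ : ∀ l, A →ₗ[ℂ] F l)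
    (φ : ∀ l, F l →ₗ[ℂ] A) : Prop where
  norm_in_le : ∀ l x, ‖ψ l x‖ ≤ ‖x‖
  norm_out_le : ∀ l x, ‖φ l x‖ ≤ ‖x‖
  nonneg_in : ∀ l x, 0 ≤ x → 0 ≤ ψ l x
  nonneg_out : ∀ l x, 0 ≤ x → 0 ≤ φ l x
  balanced_in : MulBalanced (map ψ norm_in_le ∘ₗ diag L A)
  balanced_out : MulBalanced (map φ norm_out_le)

namespace OrderZeroFactorization

section

variable {F : L → Type*} [∀ l, NonUnitalCStarAlgebra (F l)] [∀ l, PartialOrder (F l)]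
  [∀ l, StarOrderedRing (F l)] {ψ : ∀ l, A →ₗ[ℂ] F l} {φ : ∀ l, F l →ₗ[ℂ] A}

/-- The map `A → ∏ F l / ⨁ F l` induced by the first net. -/
def inMap (h : OrderZeroFactorization ψ φ) : A →ₗ[ℂ] ProdModSum F := map ψ h.norm_in_le ∘ₗ diag L A

/-- The map `∏ F l / ⨁ F l → ∏ A / ⨁ A` induced by the second net. -/
def outMap (h : OrderZeroFactorization ψ φ) : ProdModSum F →ₗ[ℂ] ProdModSum fun _ : L => A :=
  map φ h.norm_out_le

theorem inMap_nonneg [StarOrderedRing A] (h : OrderZeroFactorization ψ φ) {a : A} (ha : 0 ≤ a) :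
    0 ≤ h.inMap a :=
  ProdModSum.map_nonneg _ h.nonneg_in (diag_nonneg ha)

theorem outMap_nonneg [StarOrderedRing A] (h : OrderZeroFactorization ψ φ) {x : ProdModSum F}
    (hx : 0 ≤ x) : 0 ≤ h.outMap x :=
  ProdModSum.map_nonneg _ h.nonneg_out hx

theorem norm_inMap_le (h : OrderZeroFactorization ψ φ) (a : A) : ‖h.inMap a‖ ≤ ‖a‖ :=
  (norm_map_le h.norm_in_le (diag L A a)).trans (norm_diag_le a)

end

end OrderZeroFactorization

/-- `k + 1` copies of `a` are Cuntz below `k` copies of `b`, up to an error `e`. -/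
def AmpSub {B : Type*} [NonUnitalCStarAlgebra B] (k : ℕ) (a b : B) (e : ℝ) : Prop :=
  ∃ d : Fin k → Fin (k + 1) → B,
    ∀ i j, ‖(if i = j then a else 0) - ∑ l, star (d l i) * b * d l j‖ < e

theorem OrderZeroFactorization.outMap_inMap_le_diag [StarOrderedRing A] {F : ℕ → L → Type*}
    [∀ i l, NonUnitalCStarAlgebra (F i l)] [∀ i l, PartialOrder (F i l)]
    [∀ i l, StarOrderedRing (F i l)] {ψ : ∀ i l, A →ₗ[ℂ] F i l} {φ : ∀ i l, F i l →ₗ[ℂ] A}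
    (h : ∀ i, OrderZeroFactorization (ψ i) (φ i)) {b : A} (hb : 0 ≤ b)
    (hsum : Tendsto (fun n => ∑ i ∈ Finset.range n, (h i).outMap ((h i).inMap b)) atTop
      (𝓝 (diag L A b))) (i : ℕ) : (h i).outMap ((h i).inMap b) ≤ diag L A b := by
  refine ge_of_tendsto hsum ?_
  filter_upwards [eventually_gt_atTop i] with m hm
  exact Finset.single_le_sum (f := fun i => (h i).outMap ((h i).inMap b))
    (fun j _ => (h j).outMap_nonneg ((h j).inMap_nonneg hb)) (Finset.mem_range.2 hm)

variable [IsDirectedOrder L] [Nonempty L] [StarOrderedRing A]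

theorem OrderZeroFactorization.exists_conj_diag_near {F : L → Type*}
    [∀ l, NonUnitalCStarAlgebra (F l)] [∀ l, PartialOrder (F l)] [∀ l, StarOrderedRing (F l)]
    [∀ l, FiniteDimensional ℂ (F l)] {ψ : ∀ l, A →ₗ[ℂ] F l} {φ : ∀ l, F l →ₗ[ℂ] A}
    (h : OrderZeroFactorization ψ φ) {a b : A} (ha : 0 ≤ a) (hb : 0 ≤ b)
    (hle : h.outMap (h.inMap b) ≤ diag L A b) {k : ℕ} {η θ : ℝ} (hab : AmpSub k a b η)
    (hθ : 0 < θ) (hη : (k + 1) * (η * (‖a‖ * ‖a‖)) < θ ^ 3) :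
    ∃ z, ‖h.outMap (h.inMap a) - star z * diag L A b * z‖ < 2 * θ := by
  obtain ⟨d, hd⟩ := hab
  have hcomp : ∀ i j, ‖(if i = j then h.inMap a * h.inMap a * h.inMap a else 0) -
      ∑ l, h.inMap (star (d l i)) * h.inMap b * h.inMap (d l j * (a * a))‖ ≤ η * (‖a‖ * ‖a‖) :=
    fun i j => MulBalanced.norm_cube_sub_sum_le h.balanced_in h.norm_inMap_le (hd i j).le
  obtain ⟨r, hr⟩ := ProdModSum.exists_conj_near (h.inMap_nonneg ha) (h.inMap_nonneg hb)
    (by simp) hθ hcomp (by simpa using hη)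
  have hsub : CuntzSub (h.outMap (star r * h.inMap b * r)) (diag L A b) :=
    (MulBalanced.cuntzSub_map_conj h.balanced_out (fun _ => h.outMap_nonneg)
      (h.inMap_nonneg hb) r).trans (.of_le (h.outMap_nonneg (h.inMap_nonneg hb)) hle)
  obtain ⟨z, hz⟩ := cuntzSub_iff.1 hsub θ hθ
  have hr' : ‖h.outMap (h.inMap a) - h.outMap (star r * h.inMap b * r)‖ ≤ θ := by
    rw [← map_sub]
    exact (norm_map_le _ _).trans hr
  have htri := norm_sub_le_norm_sub_add_norm_sub (h.outMap (h.inMap a))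
    (h.outMap (star r * h.inMap b * r)) (star z * diag L A b * z)
  exact ⟨z, by linarith⟩

theorem OrderZeroFactorization.exists_norm_sub_sum_conj_lt {F : ℕ → L → Type*}
    [∀ i l, NonUnitalCStarAlgebra (F i l)] [∀ i l, PartialOrder (F i l)]
    [∀ i l, StarOrderedRing (F i l)] [∀ i l, FiniteDimensional ℂ (F i l)]
    {ψ : ∀ i l, A →ₗ[ℂ] F i l} {φ : ∀ i l, F i l →ₗ[ℂ] A}
    (h : ∀ i, OrderZeroFactorization (ψ i) (φ i))
    (hsum : ∀ b, Tendsto (fun n => ∑ i ∈ Finset.range n, (h i).outMap ((h i).inMap b)) atTop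
      (𝓝 (diag L A b)))
    {a : A} (ha : 0 ≤ a) {b : ℕ → A} (hb : ∀ i, 0 ≤ b i) {k : ℕ → ℕ} {n : ℕ} {η : ℕ → ℝ}
    {e θ : ℝ} (hθ : 0 < θ) (hab : ∀ i < n, AmpSub (k i) a (b i) (η i))
    (hη : ∀ i < n, (k i + 1) * (η i * (‖a‖ * ‖a‖)) < θ ^ 3)
    (hn : ‖diag L A a - ∑ i ∈ Finset.range n, (h i).outMap ((h i).inMap a)‖ < e) :
    ∃ x : ℕ → A, ‖a - ∑ i ∈ Finset.range n, star (x i) * b i * x i‖ < e + n * (2 * θ) := by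
  choose! z hz using fun i hi => (h i).exists_conj_diag_near ha (hb i)
    (outMap_inMap_le_diag h (hb i) (hsum (b i)) i) (hab i hi) hθ (hη i hi)
  refine ProdModSum.exists_norm_sub_sum_conj_lt (L := L) (z := z) ?_
  refine (norm_sub_le_norm_sub_add_norm_sub _
    (∑ i ∈ Finset.range n, (h i).outMap ((h i).inMap a)) _).trans_lt (add_lt_add_of_lt_of_le hn ?_)
  rw [← Finset.sum_sub_distrib]
  exact (norm_sum_le_of_le _ fun i hi => (hz i (Finset.mem_range.1 hi)).le).trans (by simp)

end Factorization

section Amplification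

section Blocks

variable {B : Type*} {m : Type*}

/-- The `2 × 2` block matrix with rows `a b` and `c d`. -/
def blocks (a b c d : CStarMatrix m m B) : CStarMatrix (m ⊕ m) (m ⊕ m) B :=
  CStarMatrix.ofMatrix (Matrix.fromBlocks a b c d)

theorem blocks_inj {a b c d a' b' c' d' : CStarMatrix m m B} :
    blocks a b c d = blocks a' b' c' d' ↔ a = a' ∧ b = b' ∧ c = c' ∧ d = d' :=
  Matrix.fromBlocks_inj (α := B)

theorem exists_eq_blocks (M : CStarMatrix (m ⊕ m) (m ⊕ m) B) : ∃ a b c d, M = blocks a b c d :=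
  ⟨_, _, _, _, (Matrix.fromBlocks_toBlocks (α := B) M).symm⟩

variable [NonUnitalCStarAlgebra B]

theorem star_blocks (a b c d : CStarMatrix m m B) :
    star (blocks a b c d) = blocks (star a) (star c) (star b) (star d) :=
  Matrix.fromBlocks_conjTranspose (α := B) a b c d

variable [Fintype m]

theorem blocks_mul (a b c d a' b' c' d' : CStarMatrix m m B) :
    blocks a b c d * blocks a' b' c' d' = blocks (a * a' + b * c') (a * b' + b * d')
      (c * a' + d * c') (c * b' + d * d') :=
  Matrix.fromBlocks_multiply (α := B) a b c d a' b' c' d'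

theorem star_columnBlocks_mul (p q r s : CStarMatrix m m B) :
    star (blocks p 0 q 0) * blocks r 0 s 0 = blocks (star p * r + star q * s) 0 0 0 := by
  rw [star_blocks, blocks_mul]
  simp only [star_zero, zero_mul, mul_zero, add_zero]

variable [PartialOrder B] [StarOrderedRing B]

/-- The embedding `a ↦ diag (a, 0)`. -/
def cornerHom : CStarMatrix m m B →⋆ₙₐ[ℂ] CStarMatrix (m ⊕ m) (m ⊕ m) B where
  toFun a := blocks a 0 0 0
  map_smul' c a := by
    ext (i | i) (j | j) <;> simp [blocks, Matrix.fromBlocks]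
  map_zero' := Matrix.fromBlocks_zero
  map_add' a b := by
    ext (i | i) (j | j) <;> simp [blocks, Matrix.fromBlocks]
  map_mul' a b := by simp [blocks_mul]
  map_star' a := by simp [star_blocks]

theorem norm_cornerBlock (a : CStarMatrix m m B) : ‖blocks a 0 0 0‖ = ‖a‖ :=
  NonUnitalStarAlgHom.norm_map (cornerHom (B := B) (m := m)) (fun _ _ h => (blocks_inj.1 h).1) a

theorem norm_mul_self_le_of_blocks_nonneg {a b c d : CStarMatrix m m B} (h : 0 ≤ blocks a b c d) :
    ‖b‖ * ‖b‖ ≤ ‖a‖ * ‖d‖ := by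
  obtain ⟨X, hX⟩ := exists_eq_star_mul_self h
  obtain ⟨p, q, r, s, rfl⟩ := exists_eq_blocks X
  rw [star_blocks, blocks_mul, blocks_inj] at hX
  obtain ⟨ha, hb, -, hd⟩ := hX
  have hnorm_b : ‖b‖ ≤ ‖blocks p 0 r 0‖ * ‖blocks q 0 s 0‖ := by
    rw [← norm_cornerBlock, hb, ← star_columnBlocks_mul, ← norm_star (blocks p 0 r 0)]
    exact norm_mul_le _ _
  have hnorm_a : ‖blocks p 0 r 0‖ * ‖blocks p 0 r 0‖ = ‖a‖ := by
    rw [← CStarRing.norm_star_mul_self, star_columnBlocks_mul, ← ha, norm_cornerBlock]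
  have hnorm_d : ‖blocks q 0 s 0‖ * ‖blocks q 0 s 0‖ = ‖d‖ := by
    rw [← CStarRing.norm_star_mul_self, star_columnBlocks_mul, ← hd, norm_cornerBlock]
  rw [← hnorm_a, ← hnorm_d, mul_mul_mul_comm]
  exact mul_le_mul hnorm_b hnorm_b (norm_nonneg _) (by positivity)

end Blocks

/-- The embedding of `A` into the scalar diagonal matrices over `A`. -/
def scalarHom (A : Type*) [NonUnitalCStarAlgebra A] (n : ℕ) : A →⋆ₙₐ[ℂ] Mat A n where
  toFun a := CStarMatrix.ofMatrix (Matrix.diagonal fun _ => a)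
  map_smul' c a := by
    ext i j; by_cases h : i = j <;> simp [Matrix.diagonal, h]
  map_zero' := Matrix.diagonal_zero
  map_add' a b := by
    ext i j; by_cases h : i = j <;> simp [Matrix.diagonal, h]
  map_mul' a b := (Matrix.diagonal_mul_diagonal (α := A) (n := Fin n) (fun _ => a) fun _ => b).symm
  map_star' a := (Matrix.diagonal_conjTranspose (α := A) (n := Fin n) fun _ => a).symm

theorem star_scalarHom_mul_mul_apply {A : Type*} [NonUnitalCStarAlgebra A] {n : ℕ} (M : Mat A n)
    (e : A) (i j : Fin n) :
    (star (scalarHom A n e) * (M * scalarHom A n e)) i j = star e * (M i j * e) := by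
  rw [← map_star]
  exact (Matrix.diagonal_mul (α := A) _ _ i j).trans
    (congrArg (star e * ·) (Matrix.mul_diagonal (α := A) _ _ i j))

section CompletelyPositive

variable {A B : Type*} [NonUnitalCStarAlgebra A] [PartialOrder A] [StarOrderedRing A]
  [NonUnitalCStarAlgebra B] [PartialOrder B] [StarOrderedRing B] {f : A →ₗ[ℂ] B}

theorem IsCPC.mapₗ_nonneg (hf : IsCPC f) {m : Type*} [Fintype m] {M : CStarMatrix m m A}
    (hM : 0 ≤ M) : 0 ≤ (CStarMatrix.mapₗ f M : CStarMatrix m m B) := by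
  obtain ⟨g, rfl⟩ := hf.completelyPositive
  exact g.map_cstarMatrix_nonneg M hM

theorem IsCPC.norm_mapₗ_star_mul_sq_le (hf : IsCPC f) {m : Type*} [Fintype m]
    (x y : CStarMatrix m m A) :
    ‖(CStarMatrix.mapₗ f (star x * y) : CStarMatrix m m B)‖ *
        ‖(CStarMatrix.mapₗ f (star x * y) : CStarMatrix m m B)‖ ≤
      ‖(CStarMatrix.mapₗ f (star x * x) : CStarMatrix m m B)‖ *
        ‖(CStarMatrix.mapₗ f (star y * y) : CStarMatrix m m B)‖ := by
  have hgram : star (blocks x y 0 0) * blocks x y 0 0 =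
      blocks (star x * x) (star x * y) (star y * x) (star y * y) := by
    rw [star_blocks, blocks_mul]
    simp only [star_zero, zero_mul, add_zero]
  have hpos := hf.mapₗ_nonneg (star_mul_self_nonneg (blocks x y 0 0))
  rw [hgram] at hpos
  exact norm_mul_self_le_of_blocks_nonneg <|
    hpos.trans_eq (Matrix.fromBlocks_map (star x * x) (star x * y) (star y * x) (star y * y) f)

theorem norm_map_conj_le {G : A →ₗ[ℂ] B} (hG : ∀ a, 0 ≤ a → 0 ≤ G a) (x e : A) :
    ‖G (star (x * e) * (x * e))‖ ≤ ‖x‖ * ‖x‖ * ‖G (star e * e)‖ := by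
  have hle : star (x * e) * (x * e) ≤ ‖star x * x‖ • (star e * e) := by
    rw [star_mul, mul_assoc, ← mul_assoc (star x), ← mul_assoc]
    exact CStarAlgebra.star_left_conjugate_le_norm_smul (IsSelfAdjoint.star_mul_self x)
  have hGle : G (star (x * e) * (x * e)) ≤ ‖star x * x‖ • G (star e * e) := by
    have hnonneg := hG _ (sub_nonneg.2 hle)
    rwa [map_sub, sub_nonneg, ← Complex.coe_smul, map_smul, Complex.coe_smul] at hnonneg
  refine (CStarAlgebra.norm_le_norm_of_nonneg_of_le (hG _ (star_mul_self_nonneg _)) hGle).trans ?_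
  rw [norm_smul, norm_norm, CStarRing.norm_star_mul_self]

theorem tendsto_star_mul_mul (a : A) :
    Tendsto (fun u : A => star u * a * u) (CStarAlgebra.approximateUnit A) (𝓝 a) := by
  have hu := CStarAlgebra.increasingApproximateUnit A
  have hl : Tendsto (fun u : A => a * u - a) (CStarAlgebra.approximateUnit A) (𝓝 0) := by
    simpa using (hu.tendsto_mul_left a).sub_const a
  have hr : Tendsto (fun u : A => u * a - a) (CStarAlgebra.approximateUnit A) (𝓝 0) := by
    simpa using (hu.tendsto_mul_right a).sub_const a
  have hbdd : IsBoundedUnder (· ≤ ·) (CStarAlgebra.approximateUnit A) (norm ∘ fun u : A => u) :=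
    isBoundedUnder_of_eventually_le hu.eventually_norm
  have hlim := ((isBoundedUnder_le_mul_tendsto_zero hbdd hl).add hr).add_const a
  simp only [add_zero, zero_add] at hlim
  refine hlim.congr' ?_
  filter_upwards [hu.eventually_star_eq] with u hu'
  rw [hu']
  noncomm_ring

/-- The entrywise amplification of `f` to `n × n` matrices. -/
abbrev amp (n : ℕ) (f : A →ₗ[ℂ] B) : Mat A n →ₗ[ℂ] Mat B n := CStarMatrix.mapₗ f

theorem IsCPC.norm_amp_scalarHom_le (hf : IsCPC f) {n : ℕ} {e : A} (he : ‖e‖ ≤ 1) :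
    ‖amp n f (star (scalarHom A n e) * scalarHom A n e)‖ ≤ 1 := by
  have hscalar : amp n f (star (scalarHom A n e) * scalarHom A n e) =
      scalarHom B n (f (star e * e)) := by
    rw [← map_star, ← map_mul]
    exact Matrix.diagonal_map (map_zero f)
  rw [hscalar]
  refine (NonUnitalStarAlgHom.norm_apply_le _ _).trans ((hf.contractive _).trans ?_)
  rw [CStarRing.norm_star_mul_self]
  exact mul_le_one₀ he (norm_nonneg _) he

theorem IsCPC.norm_amp_conj_le (hf : IsCPC f) {n : ℕ} (x : Mat A n) {e : A} (he : ‖e‖ ≤ 1) :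
    ‖amp n f (star (scalarHom A n e) * (x * scalarHom A n e))‖ ≤ ‖x‖ := by
  set E := scalarHom A n e
  have hE : ‖amp n f (star E * E)‖ ≤ 1 := hf.norm_amp_scalarHom_le he
  rw [mul_self_le_mul_self_iff (norm_nonneg _) (norm_nonneg _)]
  calc ‖amp n f (star E * (x * E))‖ * ‖amp n f (star E * (x * E))‖
      ≤ ‖amp n f (star E * E)‖ * ‖amp n f (star (x * E) * (x * E))‖ :=
        hf.norm_mapₗ_star_mul_sq_le E (x * E)
    _ ≤ 1 * (‖x‖ * ‖x‖ * ‖amp n f (star E * E)‖) := by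
        gcongr
        exact norm_map_conj_le (fun _ => hf.mapₗ_nonneg) x E
    _ ≤ ‖x‖ * ‖x‖ := by
        rw [one_mul]
        exact mul_le_of_le_one_right (by positivity) hE

theorem IsCPC.norm_amp_le (hf : IsCPC f) {n : ℕ} (x : Mat A n) : ‖amp n f x‖ ≤ ‖x‖ := by
  have hu := CStarAlgebra.increasingApproximateUnit A
  have := hu.neBot
  have hcont : Continuous f :=
    (f.mkContinuous 1 fun a => by simpa using hf.contractive a).continuous
  have hlim : Tendsto (fun e => amp n f (star (scalarHom A n e) * (x * scalarHom A n e)))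
      (CStarAlgebra.approximateUnit A) (𝓝 (amp n f x)) := by
    refine tendsto_pi_nhds.2 fun i => tendsto_pi_nhds.2 fun j => ?_
    have hentry : ∀ e, amp n f (star (scalarHom A n e) * (x * scalarHom A n e)) i j =
        f (star e * x i j * e) := fun e =>
      congrArg f ((star_scalarHom_mul_mul_apply x e i j).trans (mul_assoc _ _ _).symm)
    simp only [hentry]
    exact (hcont.tendsto _).comp (tendsto_star_mul_mul _)
  exact le_of_tendsto hlim.norm (hu.eventually_norm.mono fun e => hf.norm_amp_conj_le x)

end CompletelyPositive

end Amplification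

section MatrixEntries

theorem MulBalanced.of_entries {R S R' S' ι : Type*} [Fintype ι] [NonUnitalNonAssocRing R]
    [NonUnitalNonAssocRing S] [Mul R'] [Mul S'] [Module ℂ R] [Module ℂ S] {f : R →ₗ[ℂ] S}
    (hf : MulBalanced f) {f' : R' → S'} (r : ι → ι → R' → R) (s : ι → ι → S' → S)
    (hr : ∀ x y i j, r i j (x * y) = ∑ k, r i k x * r k j y)
    (hs : ∀ x y i j, s i j (x * y) = ∑ k, s i k x * s k j y)
    (hs_inj : ∀ x y, (∀ i j, s i j x = s i j y) → x = y)
    (hcomp : ∀ x i j, s i j (f' x) = f (r i j x)) : MulBalanced f' := by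
  refine fun x y z => hs_inj _ _ fun i j => ?_
  simp only [hs, hcomp, hr, map_sum, Finset.sum_mul, Finset.mul_sum, hf _ _ _]
  exact Finset.sum_comm

section Matrices

variable {A : Type*} [NonUnitalCStarAlgebra A]

instance (n : ℕ) [FiniteDimensional ℂ A] : FiniteDimensional ℂ (Mat A n) :=
  inferInstanceAs (FiniteDimensional ℂ (Matrix (Fin n) (Fin n) A))

/-- The entry of a matrix at a given position, as a linear map. -/
def entry {n : ℕ} (i j : Fin n) : Mat A n →ₗ[ℂ] A where
  toFun M := M i j
  map_add' _ _ := rfl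
  map_smul' _ _ := rfl

/-- The matrix with a single nonzero entry, as a linear map. -/
def single {n : ℕ} (i j : Fin n) : A →ₗ[ℂ] Mat A n where
  toFun a := CStarMatrix.ofMatrix (Matrix.single i j a)
  map_add' a b := congrArg CStarMatrix.ofMatrix (Matrix.single_add i j a b)
  map_smul' c a := congrArg CStarMatrix.ofMatrix (Matrix.smul_single c i j a).symm

theorem sum_single_entry {n : ℕ} (M : Mat A n) : ∑ i, ∑ j, single i j (entry i j M) = M :=
  (Matrix.matrix_eq_sum_single (α := A) M).symm

variable [PartialOrder A] [StarOrderedRing A]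

/-- The embedding of `A` into `M_n(A)` in the `i`-th diagonal position. -/
def diagEntryHom {n : ℕ} (i : Fin n) : A →⋆ₙₐ[ℂ] Mat A n where
  toFun := single i i
  map_smul' := map_smul _
  map_zero' := map_zero _
  map_add' := map_add _
  map_mul' a b := (Matrix.single_mul_single_same (c := a) i i i b).symm
  map_star' a := (Matrix.conjTranspose_single i i a).symm

theorem norm_entry_le {n : ℕ} (i j : Fin n) (M : Mat A n) : ‖entry i j M‖ ≤ ‖M‖ :=
  CStarMatrix.norm_entry_le_norm (M := M) (i := i) (j := j)

theorem norm_single_le {n : ℕ} (i j : Fin n) (a : A) : ‖single i j a‖ ≤ ‖a‖ := by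
  have hstar : star (single i j a) = single j i (star a) := Matrix.conjTranspose_single i j a
  have hgram : star (single i j a) * single i j a = diagEntryHom j (star a * a) := by
    rw [hstar]
    exact Matrix.single_mul_single_same (c := star a) j i j a
  rw [mul_self_le_mul_self_iff (norm_nonneg _) (norm_nonneg _), ← CStarRing.norm_star_mul_self,
    hgram, ← CStarRing.norm_star_mul_self]
  exact NonUnitalStarAlgHom.norm_apply_le _ _

end Matrices

namespace ProdModSum

variable {L : Type*} [Preorder L] {n : ℕ} {E : L → Type*} [∀ l, NonUnitalCStarAlgebra (E l)]
  [∀ l, PartialOrder (E l)] [∀ l, StarOrderedRing (E l)]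

/-- The entry of a class of nets of matrices. -/
def netEntry (i j : Fin n) : ProdModSum (fun l => Mat (E l) n) →ₗ[ℂ] ProdModSum E :=
  map (fun _ => entry i j) fun _ => norm_entry_le i j

/-- The class of nets of matrices with a single nonzero entry. -/
def netSingle (i j : Fin n) : ProdModSum E →ₗ[ℂ] ProdModSum fun l => Mat (E l) n :=
  map (fun _ => single i j) fun _ => norm_single_le i j

theorem sum_netSingle_netEntry (x : ProdModSum fun l => Mat (E l) n) :
    ∑ i, ∑ j, netSingle i j (netEntry i j x) = x := by
  obtain ⟨y, rfl⟩ := mk_surjective x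
  have hy : ∑ i, ∑ j, lpMap (fun _ => single i j) (fun _ => norm_single_le i j)
      (lpMap (fun _ => entry i j) (fun _ => norm_entry_le i j) y) = y := by
    ext1
    funext l
    simp only [lp.coeFn_sum, Finset.sum_apply]
    exact sum_single_entry (y l)
  conv_rhs => rw [← hy]
  simp only [map_sum]
  rfl

theorem eq_of_netEntry_eq {x y : ProdModSum fun l => Mat (E l) n}
    (h : ∀ i j, netEntry i j x = netEntry i j y) : x = y := by
  rw [← sum_netSingle_netEntry x, ← sum_netSingle_netEntry y]
  simp only [h]

theorem tendsto_of_netEntry {ι : Type*} {l : Filter ι} {x : ι → ProdModSum fun l => Mat (E l) n}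
    {y : ProdModSum fun l => Mat (E l) n}
    (h : ∀ i j, Tendsto (fun t => netEntry i j (x t)) l (𝓝 (netEntry i j y))) :
    Tendsto x l (𝓝 y) := by
  have hcont : ∀ i j : Fin n, Continuous (netSingle (E := E) i j) := fun i j =>
    ((netSingle i j).mkContinuous 1 fun z => by
      rw [one_mul]
      exact norm_map_le _ z).continuous
  rw [← sum_netSingle_netEntry y, ← funext fun t => sum_netSingle_netEntry (x t)]
  exact tendsto_finsetSum _ fun i _ => tendsto_finsetSum _ fun j _ =>
    ((hcont i j).tendsto _).comp (h i j)

theorem netEntry_mul (x y : ProdModSum fun l => Mat (E l) n) (i j : Fin n) :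
    netEntry i j (x * y) = ∑ k, netEntry i k x * netEntry k j y := by
  obtain ⟨x, rfl⟩ := mk_surjective x
  obtain ⟨y, rfl⟩ := mk_surjective y
  have hentry : ∀ (i j : Fin n) (z : lp (fun l => Mat (E l) n) ∞), netEntry i j (mk _ z) =
      mk _ (lpMap (fun _ => entry i j) (fun _ => norm_entry_le i j) z) := fun _ _ _ => rfl
  rw [← mk_mul]
  simp only [hentry, ← mk_mul, ← map_sum]
  congr 1
  ext1
  funext l
  simp only [lp.coeFn_sum, Finset.sum_apply]
  exact CStarMatrix.mul_apply

theorem netEntry_map_amp {G : L → Type*} [∀ l, NonUnitalCStarAlgebra (G l)]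
    [∀ l, PartialOrder (G l)] [∀ l, StarOrderedRing (G l)] {T : ∀ l, E l →ₗ[ℂ] G l}
    (hT : ∀ l x, ‖T l x‖ ≤ ‖x‖) (hT' : ∀ l x, ‖amp n (T l) x‖ ≤ ‖x‖)
    (x : ProdModSum fun l => Mat (E l) n) (i j : Fin n) :
    netEntry i j (map (fun l => amp n (T l)) hT' x) = map T hT (netEntry i j x) := by
  obtain ⟨x, rfl⟩ := mk_surjective x
  rfl

end ProdModSum

open ProdModSum

variable {L : Type v} [Preorder L] {A : Type u} [NonUnitalCStarAlgebra A] [PartialOrder A]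
  [StarOrderedRing A]

theorem OrderZeroFactorization.amp {F : L → Type w} [∀ l, NonUnitalCStarAlgebra (F l)]
    [∀ l, PartialOrder (F l)] [∀ l, StarOrderedRing (F l)] {ψ : ∀ l, A →ₗ[ℂ] F l}
    {φ : ∀ l, F l →ₗ[ℂ] A} (hψ : ∀ l, IsCPC (ψ l)) (hφ : ∀ l, IsCPC (φ l))
    (hin : IsCPC (inducedIn hψ) ∧ IsOrderZero (inducedIn hψ))
    (hout : IsCPC (inducedOut hφ) ∧ IsOrderZero (inducedOut hφ)) (n : ℕ) :
    OrderZeroFactorization (fun l => CuntzComparison.amp n (ψ l))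
      (fun l => CuntzComparison.amp n (φ l)) where
  norm_in_le l := (hψ l).norm_amp_le
  norm_out_le l := (hφ l).norm_amp_le
  nonneg_in l _ := (hψ l).mapₗ_nonneg
  nonneg_out l _ := (hφ l).mapₗ_nonneg
  balanced_in := MulBalanced.of_entries (hin.1.map_mul_map hin.2) (fun i j M => M i j)
    (fun i j => netEntry i j) (fun _ _ _ _ => CStarMatrix.mul_apply) netEntry_mul
    (fun _ _ => eq_of_netEntry_eq) fun _ _ _ => rfl
  balanced_out := MulBalanced.of_entries (hout.1.map_mul_map hout.2) (fun i j => netEntry i j)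
    (fun i j => netEntry i j) netEntry_mul netEntry_mul (fun _ _ => eq_of_netEntry_eq)
    (netEntry_map_amp (fun l => (hφ l).contractive) _)

theorem OrderZeroFactorization.tendsto_amp {F : ℕ → L → Type w}
    [∀ i l, NonUnitalCStarAlgebra (F i l)] [∀ i l, PartialOrder (F i l)]
    [∀ i l, StarOrderedRing (F i l)] {ψ : ∀ i l, A →ₗ[ℂ] F i l} {φ : ∀ i l, F i l →ₗ[ℂ] A}
    (hψ : ∀ i l, IsCPC (ψ i l)) (hφ : ∀ i l, IsCPC (φ i l))
    (hsum : ∀ a : A, Tendsto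
      (fun n : ℕ => ∑ i ∈ Finset.range n, inducedOut (hφ i) (inducedIn (hψ i) a))
      atTop (𝓝 (diag L A a))) {n : ℕ}
    (h : ∀ i, OrderZeroFactorization (fun l => CuntzComparison.amp n (ψ i l))
      (fun l => CuntzComparison.amp n (φ i l))) (M : Mat A n) :
    Tendsto (fun N : ℕ => ∑ i ∈ Finset.range N, (h i).outMap ((h i).inMap M)) atTop
      (𝓝 (diag L (Mat A n) M)) := by
  refine tendsto_of_netEntry fun i j => ?_
  refine (hsum (M i j)).congr fun N => ?_
  rw [map_sum]
  rfl

end MatrixEntries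

section Stabilization

variable {A : Type u} [NonUnitalCStarAlgebra A]

/-- The matrix over `ℕ` extending `M` by zero. -/
def extend {n : ℕ} (M : Mat A n) (i j : ℕ) : A :=
  if h : i < n ∧ j < n then M ⟨i, h.1⟩ ⟨j, h.2⟩ else 0

/-- The upper left `n × n` corner of a matrix over `ℕ`. -/
def corner (n : ℕ) (a : ℕ → ℕ → A) : Mat A n := CStarMatrix.ofMatrix fun i j => a i j

theorem extend_of_le {n : ℕ} (M : Mat A n) {i j : ℕ} (h : n ≤ i ∨ n ≤ j) : extend M i j = 0 :=
  dif_neg (by omega)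

theorem corner_extend {n : ℕ} (M : Mat A n) : corner n (extend M) = M := by
  ext i j
  exact dif_pos ⟨i.2, j.2⟩

theorem extend_corner {n : ℕ} {a : ℕ → ℕ → A} (ha : ∀ i j, n ≤ i ∨ n ≤ j → a i j = 0) :
    extend (corner n a) = a := by
  ext i j
  by_cases hij : i < n ∧ j < n
  · exact dif_pos hij
  · rw [ha i j (by omega), extend_of_le _ (by omega)]

theorem sum_extend_mul {n k : ℕ} (h : n ≤ k) (M : Mat A n) (i : ℕ) (g : ℕ → A) :
    ∑ p : Fin k, extend M i p * g p = ∑ p : Fin n, extend M i p * g p := by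
  rw [Fin.sum_univ_eq_sum_range (fun p => extend M i p * g p),
    Fin.sum_univ_eq_sum_range (fun p => extend M i p * g p)]
  refine (Finset.sum_subset (Finset.range_mono h) fun p _ hp => ?_).symm
  rw [extend_of_le M (by simpa using Or.inr hp), zero_mul]

theorem extend_mul {n k : ℕ} (h : n ≤ k) (M N : Mat A n) (i j : ℕ) :
    extend (M * N) i j = ∑ p : Fin k, extend M i p * extend N p j := by
  rw [sum_extend_mul h M i fun p => extend N p j]
  by_cases hij : i < n ∧ j < n
  · rw [extend, dif_pos hij, CStarMatrix.mul_apply]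
    refine Finset.sum_congr rfl fun p _ => ?_
    rw [extend, extend, dif_pos ⟨hij.1, p.2⟩, dif_pos ⟨p.2, hij.2⟩]
  · rw [extend_of_le _ (by omega)]
    refine (Finset.sum_eq_zero fun p _ => ?_).symm
    by_cases hi : i < n
    · rw [extend_of_le N (by omega), mul_zero]
    · rw [extend_of_le M (by omega), zero_mul]

/-- The embedding `M ↦ diag (M, 0)` of `M_n(A)` into `M_k(A)`, for `n ≤ k`. -/
def pad {n k : ℕ} (h : n ≤ k) : Mat A n →⋆ₙₐ[ℂ] Mat A k where
  toFun M := corner k (extend M)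
  map_smul' c M := by
    ext i j
    change extend (c • M) i j = c • extend M i j
    unfold extend
    split_ifs
    · rfl
    · exact (smul_zero c).symm
  map_zero' := by
    ext i j
    exact ite_self _
  map_add' M N := by
    ext i j
    change extend (M + N) i j = extend M i j + extend N i j
    unfold extend
    split_ifs
    · rfl
    · exact (add_zero 0).symm
  map_mul' M N := by
    ext i j
    exact extend_mul h M N i j
  map_star' M := by
    ext i j
    change extend (star M) i j = star (extend M j i)
    unfold extend
    simp only [and_comm]
    split_ifs
    · rfl
    · exact star_zero A |>.symm

theorem pad_apply {n k : ℕ} (h : n ≤ k) (M : Mat A n) (i j : Fin k) :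
    pad h M i j = extend M i j := rfl

theorem extend_pad {n k : ℕ} (h : n ≤ k) (M : Mat A n) : extend (pad h M) = extend M :=
  extend_corner fun _ _ hij => extend_of_le M (by omega)

theorem exists_pad_eq_mul_mul {n k : ℕ} (h : n ≤ k) (M N : Mat A n) (X : Mat A k) :
    ∃ K, pad h K = pad h M * X * pad h N := by
  refine ⟨corner n (extend (pad h M * X * pad h N)), ?_⟩
  have hsupp : ∀ i j, n ≤ i ∨ n ≤ j → extend (pad h M * X * pad h N) i j = 0 := by
    rintro i j hij
    by_cases hk : i < k ∧ j < k
    · rw [extend, dif_pos hk, CStarMatrix.mul_apply]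
      refine Finset.sum_eq_zero fun q _ => ?_
      rw [CStarMatrix.mul_apply, pad_apply]
      rcases hij with hi | hj
      · rw [Finset.sum_eq_zero fun p _ => ?_, zero_mul]
        rw [pad_apply, extend_of_le M (Or.inl hi), zero_mul]
      · rw [extend_of_le N (Or.inr hj), mul_zero]
    · exact extend_of_le _ (by omega)
  rw [← corner_extend (pad h _), extend_pad, extend_corner hsupp, corner_extend]

theorem star_scalarHom_mul_pad_mul {n k : ℕ} (h : n ≤ k) (M : Mat A n) (u : A) :
    star (scalarHom A k u) * (pad h M * scalarHom A k u) =
      pad h (star (scalarHom A n u) * (M * scalarHom A n u)) := by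
  ext i j
  rw [star_scalarHom_mul_mul_apply, pad_apply, pad_apply]
  by_cases hij : (i : ℕ) < n ∧ (j : ℕ) < n
  · simp only [extend, dif_pos hij, star_scalarHom_mul_mul_apply]
  · rw [extend_of_le _ (by omega), extend_of_le _ (by omega), zero_mul, mul_zero]

/-- The embedding of `M_n(A)` into `M_k(A)` for `n ≤ k`, and zero for `k < n`. -/
def padOrZero (n k : ℕ) : Mat A n →⋆ₙₐ[ℂ] Mat A k := if h : n ≤ k then pad h else 0

theorem padOrZero_of_le {n k : ℕ} (h : n ≤ k) : padOrZero (A := A) n k = pad h := dif_pos h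

variable [PartialOrder A] [StarOrderedRing A]

theorem norm_pad {n k : ℕ} (h : n ≤ k) (M : Mat A n) : ‖pad h M‖ = ‖M‖ := by
  refine NonUnitalStarAlgHom.norm_map (pad h) (fun M N hMN => ?_) M
  rw [← corner_extend M, ← corner_extend N, ← extend_pad h M, hMN, extend_pad]

/-- The sequence of the matrices `diag (M, 0)` of all sizes. -/
def padNet {n : ℕ} (M : Mat A n) : lp (Mat A) ∞ :=
  ⟨fun k => padOrZero n k M, memℓp_infty ⟨‖M‖, by
    rintro _ ⟨k, rfl⟩
    exact NonUnitalStarAlgHom.norm_apply_le _ _⟩⟩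

theorem padNet_apply {n k : ℕ} (h : n ≤ k) (M : Mat A n) : padNet M k = pad h M :=
  congrArg (fun f : Mat A n →⋆ₙₐ[ℂ] Mat A k => f M) (padOrZero_of_le h)

theorem mk_padNet_mem {n : ℕ} (M : Mat A n) :
    ProdModSum.mk (Mat A) (padNet M) ∈ (finMatrices A).topologicalClosure := by
  refine (finMatrices A).le_topologicalClosure ?_
  refine ⟨padNet M, rfl, n, extend M, fun _ _ => extend_of_le M, fun m hm i j => ?_⟩
  rw [padNet_apply hm, pad_apply]

/-- The embedding of `M_n(A)` into `A ⊗ 𝒦`. -/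
def emb (n : ℕ) : Mat A n →⋆ₙₐ[ℂ] Stab A where
  toFun M := ⟨ProdModSum.mk (Mat A) (padNet M), mk_padNet_mem M⟩
  map_smul' c M := Subtype.ext <| congrArg (ProdModSum.mk _) <| lp.ext <| funext fun k =>
    map_smul (padOrZero n k) c M
  map_zero' := Subtype.ext <| congrArg (ProdModSum.mk _) <| lp.ext <| funext fun k =>
    map_zero (padOrZero n k)
  map_add' M N := Subtype.ext <| congrArg (ProdModSum.mk _) <| lp.ext <| funext fun k =>
    map_add (padOrZero n k) M N
  map_mul' M N := Subtype.ext <| congrArg (ProdModSum.mk _) <| lp.ext <| funext fun k =>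
    map_mul (padOrZero n k) M N
  map_star' M := Subtype.ext <| congrArg (ProdModSum.mk _) <| lp.ext <| funext fun k =>
    map_star (padOrZero n k) M

theorem coe_emb {n : ℕ} (M : Mat A n) : (emb n M).1 = ProdModSum.mk (Mat A) (padNet M) := rfl

theorem ProdModSum.mk_eq_mk_of_eventually_eq {L : Type*} [Preorder L] {F : L → Type*}
    [∀ l, NonUnitalCStarAlgebra (F l)] {x y : lp F ∞} (h : ∀ᶠ l in atTop, x l = y l) :
    mk F x = mk F y := by
  rw [mk_eq_mk, mem_nullNets]
  refine tendsto_const_nhds.congr' ?_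
  filter_upwards [h] with l hl
  rw [lp.coeFn_sub, Pi.sub_apply, hl, sub_self, norm_zero]

theorem emb_eq_of_extend_eq {n k : ℕ} {M : Mat A n} {N : Mat A k} (h : extend M = extend N) :
    emb n M = emb k N := by
  refine Subtype.ext (ProdModSum.mk_eq_mk_of_eventually_eq ?_)
  filter_upwards [eventually_ge_atTop n, eventually_ge_atTop k] with m hn hk
  rw [padNet_apply hn, padNet_apply hk, ← corner_extend (pad hn M), extend_pad, h,
    ← extend_pad hk, corner_extend]

theorem emb_pad {n k : ℕ} (h : n ≤ k) (M : Mat A n) : emb k (pad h M) = emb n M :=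
  emb_eq_of_extend_eq (extend_pad h M)

theorem emb_injective (n : ℕ) : Function.Injective (emb (A := A) n) := by
  rw [injective_iff_map_eq_zero]
  intro M hM
  have hmk : ProdModSum.mk (Mat A) (padNet M) = 0 := by
    rw [← coe_emb, hM]
    exact ZeroMemClass.coe_zero (finMatrices A).topologicalClosure
  rw [← map_zero (ProdModSum.mk (Mat A)), ProdModSum.mk_eq_mk, sub_zero, mem_nullNets] at hmk
  refine norm_eq_zero.1 (tendsto_nhds_unique (tendsto_const_nhds.congr' ?_) hmk)
  filter_upwards [eventually_ge_atTop n] with k hk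
  rw [padNet_apply hk, norm_pad]

theorem norm_emb {n : ℕ} (M : Mat A n) : ‖emb n M‖ = ‖M‖ :=
  NonUnitalStarAlgHom.norm_map (emb n) (emb_injective n) M

theorem isometry_emb (n : ℕ) : Isometry (emb (A := A) n) :=
  AddMonoidHomClass.isometry_of_norm (emb n) norm_emb

theorem denseRange_emb : DenseRange fun M : Σ n, Mat A n => emb M.1 M.2 := by
  refine Metric.dense_iff.2 fun x e he => ?_
  obtain ⟨z, hz, hxz⟩ := Metric.mem_closure_iff.1 x.2 e he
  obtain ⟨y, rfl, n, a, ha, hya⟩ := id hz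
  have hemb : (emb n (corner n a)).1 = ProdModSum.mk _ y := by
    refine ProdModSum.mk_eq_mk_of_eventually_eq ?_
    filter_upwards [eventually_ge_atTop n] with m hm
    ext i j
    rw [padNet_apply hm, pad_apply, extend_corner ha, hya m hm]
  refine ⟨_, ?_, ⟨n, corner n a⟩, rfl⟩
  rw [Metric.mem_ball, dist_comm]
  change dist x.1 (emb n (corner n a)).1 < e
  rwa [hemb]

/-- `M_n(A)` is a hereditary subalgebra of `A ⊗ 𝒦`. -/
theorem exists_emb_eq_mul_mul {n : ℕ} (M N : Mat A n) (x : Stab A) :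
    ∃ K, emb n K = emb n M * x * emb n N := by
  have hclosed : IsClosed (Set.range (emb (A := A) n)) :=
    (isometry_emb n).isUniformInducing.isComplete_range.isClosed
  refine denseRange_emb.induction_on x (hclosed.preimage
    (f := fun x => emb n M * x * emb n N) (by fun_prop)) fun ⟨k, X⟩ => ?_
  obtain ⟨K, hK⟩ := exists_pad_eq_mul_mul (le_max_left n k) M N (pad (le_max_right n k) X)
  exact ⟨K, by rw [← emb_pad (le_max_left n k), hK]; simp only [map_mul, emb_pad]⟩

theorem nonneg_of_map_nonneg {C D : Type*} [NonUnitalCStarAlgebra C] [PartialOrder C]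
    [StarOrderedRing C] [NonUnitalCStarAlgebra D] [PartialOrder D] [StarOrderedRing D]
    (f : C →⋆ₙₐ[ℂ] D) (hf : Isometry f) {x : C} (h : 0 ≤ f x) : 0 ≤ x := by
  have hsa : IsSelfAdjoint x := by
    have := (IsSelfAdjoint.of_nonneg h).star_eq
    rw [← map_star] at this
    exact hf.injective this
  rw [CStarAlgebra.nonneg_iff_isSelfAdjoint_and_negPart_eq_zero]
  refine ⟨hsa, hf.injective ?_⟩
  rw [map_zero, ← ((CStarAlgebra.nonneg_iff_isSelfAdjoint_and_negPart_eq_zero).1 h).2]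
  simp only [CFC.negPart_def]
  exact NonUnitalStarAlgHomClass.map_cfcₙ (f.restrictScalars ℝ) _ x (hφ := hf.continuous)

theorem nonneg_of_emb_nonneg {n : ℕ} {M : Mat A n} (h : 0 ≤ emb n M) : 0 ≤ M :=
  nonneg_of_map_nonneg (emb n) (isometry_emb n) h

end Stabilization

theorem exists_orthogonal_isometries {P ι B : Type*} [NonUnitalCStarAlgebra B] [DecidableEq P]
    {e : ι → B} (he : DenseRange e) {f : P → ι → B}
    (hf : ∀ p q i j, star (f p i) * f q j = if p = q then star (e i) * e j else 0) :
    ∃ V : P → B → B, ∀ p q c d, star (V p c) * V q d = if p = q then star c * d else 0 := by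
  have hdist : ∀ p i j, dist (f p i) (f p j) = dist (e i) (e j) := by
    intro p i j
    rw [dist_eq_norm, dist_eq_norm, ← mul_self_inj (norm_nonneg _) (norm_nonneg _),
      ← CStarRing.norm_star_mul_self, ← CStarRing.norm_star_mul_self]
    simp only [star_sub, sub_mul, mul_sub, hf, if_true]
  have hseq : ∀ c, ∃ s : ℕ → ι, Tendsto (fun n => e (s n)) atTop (𝓝 c) := fun c => by
    obtain ⟨t, ht, htc⟩ := mem_closure_iff_seq_limit.1 (he c)
    choose s hs using ht
    exact ⟨s, by simpa only [hs] using htc⟩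
  choose s hs using hseq
  have hcauchy : ∀ p c, CauchySeq fun n => f p (s c n) := fun p c =>
    Metric.cauchySeq_iff.2 <| by simpa only [hdist] using Metric.cauchySeq_iff.1 (hs c).cauchySeq
  choose V hV using fun p c => cauchySeq_tendsto_of_complete (hcauchy p c)
  refine ⟨V, fun p q c d => tendsto_nhds_unique ((hV p c).star.mul (hV q d)) ?_⟩
  simp only [hf]
  split_ifs
  · exact (hs c).star.mul (hs d)
  · exact tendsto_const_nhds

theorem tendsto_conj_of_denseRange {ι κ B : Type*} [NonUnitalCStarAlgebra B] {l : Filter κ}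
    {u : κ → B} (hu : ∀ᶠ p in l, ‖u p‖ ≤ 1) {e : ι → B} (he : DenseRange e)
    (h : ∀ i, Tendsto (fun p => star (u p) * e i * u p) l (𝓝 (e i))) (x : B) :
    Tendsto (fun p => star (u p) * x * u p) l (𝓝 x) := by
  rw [Metric.tendsto_nhds]
  intro r hr
  obtain ⟨i, hi⟩ := Metric.denseRange_iff.1 he x (r / 3) (by positivity)
  filter_upwards [hu, Metric.tendsto_nhds.1 (h i) (r / 3) (by positivity)] with p hp hpi
  have hconj : dist (star (u p) * x * u p) (star (u p) * e i * u p) ≤ dist x (e i) := by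
    rw [dist_eq_norm, dist_eq_norm, ← sub_mul, ← mul_sub]
    calc _ ≤ ‖star (u p)‖ * ‖x - e i‖ * ‖u p‖ := norm_mul₃_le
      _ ≤ 1 * ‖x - e i‖ * 1 := by rw [norm_star]; gcongr
      _ = _ := by ring
  calc _ ≤ _ := dist_triangle4 _ (star (u p) * e i * u p) (e i) x
    _ < r := by rw [dist_comm (e i)]; linarith

section StabUnits

variable {A : Type u} [NonUnitalCStarAlgebra A]

/-- The matrix whose row `Nat.pair p i` is row `i` of `M` and whose other rows vanish. -/
def shiftRows (p : ℕ) {n : ℕ} (M : Mat A n) : Mat A (Nat.pair p n) :=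
  corner _ fun i j => if i.unpair.1 = p then extend M i.unpair.2 j else 0

theorem extend_shiftRows (p : ℕ) {n : ℕ} (M : Mat A n) :
    extend (shiftRows p M) = fun i j => if i.unpair.1 = p then extend M i.unpair.2 j else 0 := by
  refine extend_corner fun i j hij => ite_eq_right_iff.2 fun hi => extend_of_le M ?_
  refine hij.imp (fun h => ?_) (Nat.right_le_pair p n).trans
  contrapose! h
  rw [← Nat.pair_unpair i, hi]
  exact Nat.pair_lt_pair_right p h

variable [PartialOrder A] [StarOrderedRing A]

theorem star_emb_mul_emb {m n k : ℕ} (hm : m ≤ k) (hn : n ≤ k) (M : Mat A m) (N : Mat A n) :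
    star (emb m M) * emb n N =
      emb k (corner k fun i j => ∑' r, star (extend M r i) * extend N r j) := by
  rw [← emb_pad hm, ← emb_pad hn, ← map_star, ← map_mul]
  congr 1
  ext i j
  refine Eq.trans ?_ (tsum_eq_sum (s := Finset.range k) fun r hr => ?_).symm
  · exact Fin.sum_univ_eq_sum_range (fun r => star (extend M r i) * extend N r j) k
  · rw [extend_of_le N (Or.inl (hn.trans (by simpa using hr))), mul_zero]

theorem star_emb_shiftRows_mul (p q : ℕ) {m n : ℕ} (M : Mat A m) (N : Mat A n) :
    star (emb _ (shiftRows p M)) * emb _ (shiftRows q N) =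
      if p = q then star (emb m M) * emb n N else 0 := by
  rw [star_emb_mul_emb (le_max_left _ _) (le_max_right _ _)]
  simp only [extend_shiftRows]
  split_ifs with hpq
  · subst hpq
    rw [star_emb_mul_emb ((Nat.right_le_pair p m).trans (le_max_left _ _))
      ((Nat.right_le_pair p n).trans (le_max_right _ _))]
    congr 2
    ext i j
    have hinj : Function.Injective (Nat.pair p) := fun r s h => (Nat.pair_eq_pair.1 h).2
    refine (hinj.tsum_eq fun r hr => ?_).symm.trans (tsum_congr fun r => ?_)
    rotate_left
    · simp only [Nat.unpair_pair, if_true]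
    · refine ⟨r.unpair.2, ?_⟩
      contrapose! hr
      have hp : r.unpair.1 ≠ p := fun hp => hr (by rw [← hp, Nat.pair_unpair])
      simp only [Function.mem_support, hp, if_false, mul_zero, ne_eq, not_true, not_false_eq_true]
  · refine (congrArg (emb _) ?_).trans (map_zero _)
    ext i j
    refine (tsum_congr fun r => ?_).trans tsum_zero
    by_cases hp : r.unpair.1 = p
    · rw [if_neg (hp ▸ hpq : r.unpair.1 ≠ q), mul_zero]
    · rw [if_neg hp, star_zero, zero_mul]

variable (A) in
theorem exists_isometries : ∃ V : ℕ → Stab A → Stab A, ∀ p q c d,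
    star (V p c) * V q d = if p = q then star c * d else 0 :=
  exists_orthogonal_isometries denseRange_emb fun p q M N => star_emb_shiftRows_mul p q M.2 N.2

/-- The approximate unit of `A ⊗ 𝒦` consisting of the scalar matrices `diag (u, …, u)` of size `n`,
where `(n, u) = p` and `u` ranges over an approximate unit of `A`. -/
def unitNet (p : ℕ × A) : Stab A := emb p.1 (scalarHom A p.1 p.2)

variable (A) in
/-- The filter along which `unitNet` is an approximate unit. -/
def unitFilter : Filter (ℕ × A) := atTop ×ˢ CStarAlgebra.approximateUnit A

instance : (unitFilter A).NeBot :=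
  have := (CStarAlgebra.increasingApproximateUnit A).neBot
  inferInstanceAs (atTop ×ˢ CStarAlgebra.approximateUnit A).NeBot

theorem eventually_le_fst_unitFilter (n : ℕ) : ∀ᶠ p in unitFilter A, n ≤ p.1 :=
  tendsto_fst.eventually (eventually_ge_atTop n)

theorem eventually_norm_snd_unitFilter_le : ∀ᶠ p in unitFilter A, ‖p.2‖ ≤ 1 :=
  tendsto_snd.eventually (CStarAlgebra.increasingApproximateUnit A).eventually_norm

theorem norm_unitNet_le {p : ℕ × A} (hp : ‖p.2‖ ≤ 1) : ‖unitNet p‖ ≤ 1 := by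
  rw [unitNet, norm_emb]
  exact (NonUnitalStarAlgHom.norm_apply_le _ _).trans hp

theorem star_unitNet_mul_emb_mul {n : ℕ} {p : ℕ × A} (h : n ≤ p.1) (M : Mat A n) :
    star (unitNet p) * emb n M * unitNet p =
      emb n (star (scalarHom A n p.2) * (M * scalarHom A n p.2)) := by
  rw [mul_assoc, ← emb_pad h, ← emb_pad h, unitNet, ← map_star, ← map_mul, ← map_mul,
    star_scalarHom_mul_pad_mul]

theorem tendsto_unitNet (x : Stab A) :
    Tendsto (fun p => star (unitNet p) * x * unitNet p) (unitFilter A) (𝓝 x) := by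
  refine tendsto_conj_of_denseRange
    (eventually_norm_snd_unitFilter_le.mono fun p => norm_unitNet_le) denseRange_emb ?_ x
  rintro ⟨n, M⟩
  have hentries : Tendsto (fun u => star (scalarHom A n u) * (M * scalarHom A n u))
      (CStarAlgebra.approximateUnit A) (𝓝 M) := by
    refine tendsto_pi_nhds.2 fun i => tendsto_pi_nhds.2 fun j => ?_
    simp only [star_scalarHom_mul_mul_apply, ← mul_assoc]
    exact tendsto_star_mul_mul _
  refine (((isometry_emb n).continuous.tendsto M).comp (hentries.comp tendsto_snd)).congr' ?_
  filter_upwards [eventually_le_fst_unitFilter n] with p hp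
  exact (star_unitNet_mul_emb_mul hp M).symm

theorem exists_emb_eq_unitNet (p : ℕ × A) (x : Stab A) :
    ∃ K, emb p.1 K = star (unitNet p) * x * unitNet p := by
  rw [unitNet, ← map_star]
  exact exists_emb_eq_mul_mul _ _ x

end StabUnits

section Core

theorem AmpSub.conj {B : Type*} [NonUnitalCStarAlgebra B] {k : ℕ} {a b : B}
    (h : ∀ e > 0, AmpSub k a b e) (u : B) : ∀ e > 0, AmpSub k (star u * a * u) b e := by
  intro e he
  obtain ⟨δ, hδ, hδe⟩ : ∃ δ > 0, ‖u‖ * δ * ‖u‖ < e :=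
    exists_pos_lt_of_continuous (by fun_prop) (by simpa using he)
  obtain ⟨d, hd⟩ := h δ hδ
  refine ⟨fun l i => d l i * u, fun i j => ?_⟩
  have hfactor : (if i = j then star u * a * u else 0) - ∑ l, star (d l i * u) * b * (d l j * u) =
      star u * ((if i = j then a else 0) - ∑ l, star (d l i) * b * d l j) * u := by
    simp only [star_mul, mul_sub, sub_mul, Finset.mul_sum, Finset.sum_mul, mul_ite, ite_mul,
      mul_zero, zero_mul, mul_assoc]
  rw [hfactor]
  refine (norm_mul₃_le.trans ?_).trans_lt hδe
  rw [norm_star]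
  gcongr
  exact (hd i j).le

theorem amp_pad {A B : Type*} [NonUnitalCStarAlgebra A] [NonUnitalCStarAlgebra B]
    [PartialOrder A] [StarOrderedRing A] [PartialOrder B] [StarOrderedRing B] (f : A →ₗ[ℂ] B)
    {n k : ℕ} (h : n ≤ k) (M : Mat A n) : amp k f (pad h M) = pad h (amp n f M) := by
  ext i j
  change f (extend M i j) = extend (amp n f M) i j
  unfold extend
  split_ifs
  · rfl
  · exact map_zero f

variable {A : Type u} [NonUnitalCStarAlgebra A] [PartialOrder A] [StarOrderedRing A]

theorem AmpSub.eventually_unitNet {k n : ℕ} {a : Mat A n} {b : Stab A} {e : ℝ}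
    (h : AmpSub k (emb n a) b e) :
    ∀ᶠ p in unitFilter A, ∀ (hn : n ≤ p.1) (b' : Mat A p.1),
      emb p.1 b' = star (unitNet p) * b * unitNet p → AmpSub k (pad hn a) b' e := by
  obtain ⟨d, hd⟩ := h
  have hlim : ∀ i j, Tendsto (fun p => ‖(if i = j then emb n a else 0) - ∑ l,
      star (star (unitNet p) * d l i * unitNet p) * (star (unitNet p) * b * unitNet p) *
        (star (unitNet p) * d l j * unitNet p)‖) (unitFilter A)
      (𝓝 ‖(if i = j then emb n a else 0) - ∑ l, star (d l i) * b * d l j‖) := fun i j =>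
    (tendsto_const_nhds.sub <| tendsto_finsetSum _ fun l _ =>
      ((tendsto_unitNet (d l i)).star.mul (tendsto_unitNet b)).mul (tendsto_unitNet (d l j))).norm
  filter_upwards [eventually_all.2 fun i => eventually_all.2 fun j =>
    (hlim i j).eventually_lt_const (hd i j)] with p hp hn b' hb'
  choose d' hd' using fun l i => exists_emb_eq_unitNet p (d l i)
  refine ⟨d', fun i j => ?_⟩
  rw [← norm_emb, map_sub, map_sum, apply_ite (emb p.1), map_zero, emb_pad]
  simp only [map_mul, map_star, hd', hb']
  exact hp i j

section Padding

variable {L : Type v} [Preorder L] {n k : ℕ}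

open ProdModSum

/-- `pad` as a linear map. -/
def padₗ (h : n ≤ k) : Mat A n →ₗ[ℂ] Mat A k where
  toFun := pad h
  map_add' := map_add (pad h)
  map_smul' := map_smul (pad h)

/-- The embedding `M_n(A) → M_k(A)` applied to classes of nets. -/
def netPad (L : Type v) [Preorder L] (h : n ≤ k) :
    ProdModSum (fun _ : L => Mat A n) →ₗ[ℂ] ProdModSum fun _ : L => Mat A k :=
  map (fun _ => padₗ h) fun _ M => (norm_pad h M).le

theorem OrderZeroFactorization.norm_sub_sum_pad_le {F : ℕ → L → Type w}
    [∀ i l, NonUnitalCStarAlgebra (F i l)] [∀ i l, PartialOrder (F i l)]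
    [∀ i l, StarOrderedRing (F i l)] {ψ : ∀ i l, A →ₗ[ℂ] F i l} {φ : ∀ i l, F i l →ₗ[ℂ] A}
    (hf : ∀ n i, OrderZeroFactorization (fun l => CuntzComparison.amp n (ψ i l))
      (fun l => CuntzComparison.amp n (φ i l))) (h : n ≤ k) (M : Mat A n) (s : Finset ℕ) :
    ‖diag L _ (pad h M) - ∑ i ∈ s, (hf k i).outMap ((hf k i).inMap (pad h M))‖ ≤
      ‖diag L _ M - ∑ i ∈ s, (hf n i).outMap ((hf n i).inMap M)‖ := by
  have hterm : ∀ i, (hf k i).outMap ((hf k i).inMap (pad h M)) =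
      netPad L h ((hf n i).outMap ((hf n i).inMap M)) := fun i => by
    refine congrArg (ProdModSum.mk fun _ : L => Mat A k) (lp.ext (funext fun l => ?_))
    exact (congrArg (CuntzComparison.amp k (φ i l)) (amp_pad (ψ i l) h M)).trans (amp_pad _ h _)
  have hdiag : diag L _ (pad h M) = netPad L h (diag L _ M) := rfl
  simp only [hterm, hdiag, ← map_sum, ← map_sub]
  exact norm_map_le _ _

end Padding

theorem NuclearDimLEOmega.exists_norm_emb_sub_sum_conj_lt
    (hA : NuclearDimLEOmega.{u, v, w} A) {n : ℕ} {a : Mat A n} (ha : 0 ≤ a)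
    {b : ℕ → Stab A} (hb : ∀ i, 0 ≤ b i) {k : ℕ → ℕ}
    (hab : ∀ i, ∀ e > 0, AmpSub (k i) (emb n a) (b i) e) {e : ℝ} (he : 0 < e) :
    ∃ (N : ℕ) (x : ℕ → Stab A), ‖emb n a - ∑ i ∈ Finset.range N, star (x i) * b i * x i‖ < e := by
  obtain ⟨L, _, _, _, F, _, _, _, _, ψ, φ, hψ, hφ, hin, hout, hsum⟩ := hA
  have hf := fun n i => OrderZeroFactorization.amp (hψ i) (hφ i) (hin i) (hout i) n
  obtain ⟨N, hN⟩ := (Metric.tendsto_nhds.1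
    (OrderZeroFactorization.tendsto_amp hψ hφ hsum (hf n) a) (e / 2) (half_pos he)).exists
  rw [dist_comm, dist_eq_norm] at hN
  obtain ⟨θ, hθ, hθe⟩ : ∃ θ > 0, e / 2 + N * (2 * θ) < e :=
    exists_pos_lt_of_continuous (by fun_prop) (by simpa using he)
  have htol : ∀ i, ∃ η > 0, (k i + 1) * (η * (‖a‖ * ‖a‖)) < θ ^ 3 := fun i =>
    exists_pos_lt_of_continuous (by fun_prop) (by simpa using pow_pos hθ 3)
  choose η hη hηθ using htol
  obtain ⟨p, hp, hnp⟩ := (((eventually_all_finset (Finset.range N)).2 fun i _ =>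
    (hab i (η i) (hη i)).eventually_unitNet).and (eventually_le_fst_unitFilter n)).exists
  choose b' hb' using fun i => exists_emb_eq_unitNet p (b i)
  have hb'_nonneg : ∀ i, 0 ≤ b' i := fun i => nonneg_of_emb_nonneg <| by
    rw [hb']
    exact star_left_conjugate_nonneg (hb i) _
  obtain ⟨x, hx⟩ := OrderZeroFactorization.exists_norm_sub_sum_conj_lt (hf p.1)
    (OrderZeroFactorization.tendsto_amp hψ hφ hsum (hf p.1)) (map_nonneg (pad hnp) ha)
    hb'_nonneg hθ (fun i hi => hp i (Finset.mem_range.2 hi) hnp _ (hb' i))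
    (fun i _ => by rw [norm_pad]; exact hηθ i)
    ((OrderZeroFactorization.norm_sub_sum_pad_le hf hnp a _).trans_lt hN)
  refine ⟨N, fun i => unitNet p * emb p.1 (x i), lt_of_eq_of_lt ?_ (hx.trans hθe)⟩
  rw [← norm_emb, map_sub, map_sum, emb_pad]
  simp only [map_mul, map_star, hb', star_mul, mul_assoc]

theorem NuclearDimLEOmega.exists_norm_sub_sum_conj_lt
    (hA : NuclearDimLEOmega.{u, v, w} A) {a : Stab A} (ha : 0 ≤ a)
    {b : ℕ → Stab A} (hb : ∀ i, 0 ≤ b i) {k : ℕ → ℕ}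
    (hab : ∀ i, ∀ e > 0, AmpSub (k i) a (b i) e) {e : ℝ} (he : 0 < e) :
    ∃ (N : ℕ) (x : ℕ → Stab A), ‖a - ∑ i ∈ Finset.range N, star (x i) * b i * x i‖ < e := by
  obtain ⟨q, hq⟩ := (Metric.tendsto_nhds.1 (tendsto_unitNet a) (e / 2) (half_pos he)).exists
  rw [dist_comm, dist_eq_norm] at hq
  obtain ⟨a', ha'⟩ := exists_emb_eq_unitNet q a
  rw [← ha'] at hq
  have ha'_nonneg : 0 ≤ a' := nonneg_of_emb_nonneg <| by
    rw [ha']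
    exact star_left_conjugate_nonneg ha _
  obtain ⟨N, x, hx⟩ := hA.exists_norm_emb_sub_sum_conj_lt ha'_nonneg hb
    (fun i => by rw [ha']; exact AmpSub.conj (hab i) _) (half_pos he)
  exact ⟨N, x, (norm_sub_le_norm_sub_add_norm_sub _ _ _).trans_lt (by linarith)⟩

end Core

section Classes

theorem exists_pos_summable_sq_smul {E : Type*} [NormedAddCommGroup E] [NormedSpace ℝ E]
    [CompleteSpace E] (x : ℕ → E) :
    ∃ t : ℕ → ℝ, (∀ i, 0 < t i) ∧ Summable fun i => t i ^ 2 • x i := by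
  refine ⟨fun i => (1 / 2) ^ i / (‖x i‖ + 1), fun i => by positivity,
    Summable.of_norm_bounded (g := fun i : ℕ => (1 / 2 : ℝ) ^ i) summable_geometric_two
      fun i => ?_⟩
  have hpow : (1 / 2 : ℝ) ^ i ≤ 1 := pow_le_one₀ (by norm_num) (by norm_num)
  have hle_one : (1 / 2 : ℝ) ^ i / (‖x i‖ + 1) ≤ 1 :=
    div_le_one_of_le₀ (hpow.trans (le_add_of_nonneg_left (norm_nonneg _))) (by positivity)
  calc ‖((1 / 2 : ℝ) ^ i / (‖x i‖ + 1)) ^ 2 • x i‖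
      = ((1 / 2) ^ i / (‖x i‖ + 1)) ^ 2 * ‖x i‖ := by
        rw [norm_smul, Real.norm_of_nonneg (by positivity)]
    _ ≤ (1 / 2) ^ i / (‖x i‖ + 1) * (‖x i‖ + 1) := by
        gcongr
        · exact pow_le_of_le_one (by positivity) hle_one two_ne_zero
        · exact le_add_of_nonneg_right zero_le_one
    _ = (1 / 2) ^ i := div_mul_cancel₀ _ (by positivity)

variable {B : Type u} [NonUnitalCStarAlgebra B]

theorem conjTranspose_mul_mul_apply {m n : ℕ} (b : Mat B n) (d : CStarMatrix (Fin n) (Fin m) B)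
    (i j : Fin m) :
    (d.conjTranspose * b * d) i j = ∑ l, ∑ l', star (d l i) * b l l' * d l' j := by
  rw [CStarMatrix.mul_apply, Finset.sum_comm]
  refine Finset.sum_congr rfl fun l' _ => ?_
  rw [CStarMatrix.mul_apply, Finset.sum_mul]
  rfl

/-- The diagonal matrix `diag (b 0, …, b (n - 1))`. -/
def diagMat (n : ℕ) (b : ℕ → B) : Mat B n :=
  CStarMatrix.ofMatrix (Matrix.diagonal fun i : Fin n => b i)

theorem diagMat_apply (n : ℕ) (b : ℕ → B) (i j : Fin n) :
    diagMat n b i j = if i = j then b i else 0 := rfl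

theorem diagMat_one_apply (a : B) (i j : Fin 1) : diagMat 1 (fun _ => a) i j = a :=
  if_pos (Subsingleton.elim _ _)

theorem diagMat_mul (n : ℕ) (b c : ℕ → B) :
    diagMat n b * diagMat n c = diagMat n fun i => b i * c i :=
  Matrix.diagonal_mul_diagonal (α := B) (n := Fin n) (fun i => b i) fun i => c i

theorem star_diagMat (n : ℕ) (b : ℕ → B) : star (diagMat n b) = diagMat n fun i => star (b i) :=
  Matrix.diagonal_conjTranspose (α := B) (n := Fin n) fun i => b i

theorem sum_mul_diagMat_mul (n : ℕ) (b : ℕ → B) (x y : Fin n → B) :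
    ∑ l, ∑ l', x l * diagMat n b l l' * y l' = ∑ l, x l * b l * y l := by
  refine Finset.sum_congr rfl fun l _ => ?_
  simp only [diagMat_apply, mul_ite, ite_mul, mul_zero, zero_mul, Finset.sum_ite_eq,
    Finset.mem_univ, if_true]

theorem CuntzLE.of_eq {m n : ℕ} {a : Mat B m} {b : Mat B n} (d : Fin n → Fin m → B)
    (h : ∀ i j, a i j = ∑ l, ∑ l', star (d l i) * b l l' * d l' j) : CuntzLE a b := by
  refine subset_closure ⟨CStarMatrix.ofMatrix d, ?_⟩
  ext i j
  exact (conjTranspose_mul_mul_apply b _ i j).trans (h i j).symm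

theorem cuntzLE_iff {m n : ℕ} {a : Mat B m} {b : Mat B n} :
    CuntzLE a b ↔ ∀ e > 0, ∃ d : Fin n → Fin m → B,
      ∀ i j, ‖a i j - ∑ l, ∑ l', star (d l i) * b l l' * d l' j‖ < e := by
  refine (Metric.mem_closure_iff (α := Fin m → Fin m → B)).trans (forall₂_congr fun e he =>
    Set.exists_range_iff.trans (exists_congr fun d => ?_))
  refine (dist_pi_lt_iff he).trans (forall_congr' fun i => (dist_pi_lt_iff he).trans
    (forall_congr' fun j => ?_))
  rw [dist_eq_norm]
  exact iff_of_eq (congrArg (fun y => ‖a i j - y‖ < e) (conjTranspose_mul_mul_apply b d i j))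

variable [PartialOrder B] [StarOrderedRing B]

theorem relabel_blockDiag_diagMat (n : ℕ) (b : ℕ → B) :
    relabel (blockDiag (diagMat n b) (diagMat 1 fun _ => b n)) finSumFinEquiv.symm =
      diagMat (n + 1) b := by
  ext i j
  rw [relabel_apply, diagMat_apply]
  obtain ⟨i | i, rfl⟩ := (finSumFinEquiv (m := n) (n := 1)).surjective i <;>
    obtain ⟨j | j, rfl⟩ := (finSumFinEquiv (m := n) (n := 1)).surjective j <;>
    rw [Equiv.symm_apply_apply, Equiv.symm_apply_apply]
  · change diagMat n b i j = _
    simp [diagMat_apply, Fin.ext_iff]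
  · change (0 : B) = _
    rw [if_neg fun h => ?_]
    simp only [Fin.ext_iff, finSumFinEquiv_apply_left, finSumFinEquiv_apply_right, Fin.val_castAdd,
      Fin.val_natAdd] at h
    omega
  · change (0 : B) = _
    rw [if_neg fun h => ?_]
    simp only [Fin.ext_iff, finSumFinEquiv_apply_left, finSumFinEquiv_apply_right, Fin.val_castAdd,
      Fin.val_natAdd] at h
    omega
  · change diagMat 1 (fun _ => b n) i j = _
    obtain rfl : i = j := Subsingleton.elim _ _
    simp [diagMat_apply]

theorem diagMat_nonneg (n : ℕ) {b : ℕ → B} (hb : ∀ i, 0 ≤ b i) : 0 ≤ diagMat n b := by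
  choose c hc using fun i => exists_eq_star_mul_self (hb i)
  have hstar : diagMat n b = star (diagMat n c) * diagMat n c := by
    rw [star_diagMat, diagMat_mul]
    simp only [← hc]
  exact hstar ▸ star_mul_self_nonneg _

/-- `diag (b 0, …, b (n - 1))`, for positive `b i`, as an element of `⋃ M_n(B)₊`. -/
def posDiag (n : ℕ) {b : ℕ → B} (hb : ∀ i, 0 ≤ b i) : PosMat B :=
  ⟨n, diagMat n b, diagMat_nonneg n hb⟩

/-- The class `[a]` of a positive element of `B`, regarded as a `1 × 1` matrix. -/
def cls {a : B} (ha : 0 ≤ a) : CuntzW B := CuntzW.mk (posDiag 1 fun _ => ha)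

theorem sum_cls {b : ℕ → B} (hb : ∀ i, 0 ≤ b i) (n : ℕ) :
    ∑ i ∈ Finset.range n, cls (hb i) = CuntzW.mk (posDiag n hb) := by
  induction n with
  | zero =>
    refine congrArg (fun M => CuntzW.mk (⟨0, M⟩ : PosMat B)) (Subtype.ext ?_)
    ext i
    exact i.elim0
  | succ n ih =>
    rw [Finset.sum_range_succ, ih, cls, ← CuntzW.mk_add]
    exact congrArg (fun M => CuntzW.mk (⟨n + 1, M⟩ : PosMat B))
      (Subtype.ext (relabel_blockDiag_diagMat n b))

theorem cls_le_cls {a b : B} (ha : 0 ≤ a) (hb : 0 ≤ b) : cls ha ≤ cls hb ↔ CuntzSub a b := by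
  change CuntzLE (diagMat 1 fun _ => a) (diagMat 1 fun _ => b) ↔ _
  rw [cuntzLE_iff, cuntzSub_iff]
  simp only [diagMat_one_apply, Fin.sum_univ_one, Fin.forall_fin_one]
  exact forall₂_congr fun e _ => ⟨fun ⟨d, hd⟩ => ⟨d 0 0, hd⟩, fun ⟨d, hd⟩ => ⟨fun _ _ => d, hd⟩⟩

theorem cls_le_mk_posDiag {a : B} (ha : 0 ≤ a) {b : ℕ → B} (hb : ∀ i, 0 ≤ b i) {n : ℕ}
    (x : ℕ → B) (h : a = ∑ i ∈ Finset.range n, star (x i) * b i * x i) :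
    cls ha ≤ CuntzW.mk (posDiag n hb) := by
  change CuntzLE (diagMat 1 fun _ => a) (diagMat n b)
  refine CuntzLE.of_eq (fun l _ => x l) fun i j => ?_
  rw [diagMat_one_apply, sum_mul_diagMat_mul, h]
  exact (Fin.sum_univ_eq_sum_range (fun l => star (x l) * b l * x l) n).symm

theorem mk_posDiag_le_cls {s : B} (hs : 0 ≤ s) {b : ℕ → B} (hb : ∀ i, 0 ≤ b i) (n : ℕ)
    (x : ℕ → B) (h : ∀ i j, star (x i) * s * x j = if i = j then b i * b i else 0) :
    CuntzW.mk (posDiag n hb) ≤ cls hs := by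
  change CuntzLE (diagMat n b) (diagMat 1 fun _ => s)
  refine CuntzLE.trans (CuntzSub.mul_self (diagMat_nonneg n hb))
    (CuntzLE.of_eq (fun _ i => x i) fun i j => ?_)
  rw [sum_mul_diagMat_mul, Fin.sum_univ_one, h, diagMat_mul, diagMat_apply]
  simp only [Fin.val_inj]

theorem nsmul_cls (n : ℕ) {a : B} (ha : 0 ≤ a) :
    n • cls ha = CuntzW.mk (posDiag n fun _ => ha) := by
  rw [← sum_cls, Finset.sum_const, Finset.card_range]

theorem LEs.ampSub {a b : B} {ha : 0 ≤ a} {hb : 0 ≤ b} (h : LEs (cls ha) (cls hb)) :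
    ∃ k, ∀ e > 0, AmpSub k a b e := by
  obtain ⟨k, hk⟩ := h
  rw [nsmul_cls, nsmul_cls, CuntzW.mk_le_mk] at hk
  change CuntzLE (diagMat (k + 1) fun _ => a) (diagMat k fun _ => b) at hk
  refine ⟨k, fun e he => ?_⟩
  obtain ⟨d, hd⟩ := cuntzLE_iff.1 hk e he
  simp only [sum_mul_diagMat_mul] at hd
  exact ⟨d, hd⟩

section OrthogonalIsometries

variable {V : ℕ → B → B}

theorem exists_gram_eq (hV : ∀ p q c d, star (V p c) * V q d = if p = q then star c * d else 0)
    {n : ℕ} {M : Mat B n} (hM : 0 ≤ M) : ∃ D : Fin n → B, ∀ q r, star (D q) * D r = M q r := by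
  obtain ⟨c, rfl⟩ := exists_eq_star_mul_self hM
  refine ⟨fun q => ∑ p : Fin n, V p (c p q), fun q r => ?_⟩
  simp only [star_sum, Finset.sum_mul_sum, hV, Fin.val_inj, Finset.sum_ite_eq, Finset.mem_univ,
    if_true]
  exact (CStarMatrix.mul_apply (M := star c) (N := c)).symm

theorem exists_cls_eq (hV : ∀ p q c d, star (V p c) * V q d = if p = q then star c * d else 0)
    (x : CuntzW B) : ∃ (a : B) (ha : 0 ≤ a), x = cls ha := by
  induction x using CuntzW.ind with
  | h P =>
  obtain ⟨n, M, hM⟩ := P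
  obtain ⟨D, hD⟩ := exists_gram_eq hV hM
  have hS : 0 ≤ ∑ q, D q * star (D q) := Finset.sum_nonneg fun q _ => mul_star_self_nonneg _
  refine ⟨_, hS, le_antisymm ?_ ?_⟩
  · change CuntzLE M (diagMat 1 fun _ => ∑ q, D q * star (D q))
    refine CuntzLE.trans (CuntzSub.mul_self hM) (CuntzLE.of_eq (fun _ i => D i) fun i j => ?_)
    rw [CStarMatrix.mul_apply, sum_mul_diagMat_mul, Fin.sum_univ_one, Finset.mul_sum,
      Finset.sum_mul]
    simp only [← hD, mul_assoc]
  · change CuntzLE (diagMat 1 fun _ => ∑ q, D q * star (D q)) M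
    refine CuntzLE.trans (CuntzSub.mul_self (diagMat_nonneg 1 fun _ => hS))
      (CuntzLE.of_eq (fun q _ => star (D q)) fun i j => ?_)
    simp only [diagMat_mul, diagMat_one_apply, Finset.sum_mul_sum, star_star, ← hD, mul_assoc]

theorem exists_orthogonal_roots
    (hV : ∀ p q c d, star (V p c) * V q d = if p = q then star c * d else 0)
    {b : ℕ → B} (hb : ∀ i, 0 ≤ b i) :
    ∃ w : ℕ → B, ∀ i j, star (w i) * w j = if i = j then b i else 0 := by
  choose c hc using fun i => exists_eq_star_mul_self (hb i)
  refine ⟨fun i => V i (c i), fun i j => ?_⟩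
  rw [hV]
  split_ifs with h
  · rw [hc, h]
  · rfl

end OrthogonalIsometries

section OrthogonalRoots

variable {b w : ℕ → B} {t : ℕ → ℝ} {s : B}

theorem sum_cls_le_cls_of_hasSum (hw : ∀ i j, star (w i) * w j = if i = j then b i else 0)
    (ht : ∀ i, 0 < t i) (hs : HasSum (fun i => t i ^ 2 • (w i * star (w i))) s) (hb : ∀ i, 0 ≤ b i)
    (hs0 : 0 ≤ s) (n : ℕ) : ∑ i ∈ Finset.range n, cls (hb i) ≤ cls hs0 := by
  rw [sum_cls]
  refine mk_posDiag_le_cls hs0 hb n (fun i => (t i)⁻¹ • w i) fun i j => ?_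
  have hterm : ∀ k, star (w i) * (t k ^ 2 • (w k * star (w k))) * w j =
      if k = i then (if i = j then t i ^ 2 • (b i * b i) else 0) else 0 := fun k => by
    rw [mul_smul_comm, smul_mul_assoc, ← mul_assoc, mul_assoc, hw, hw]
    rcases eq_or_ne k i with rfl | hki
    · simp only [if_true, mul_ite, smul_ite, mul_zero, smul_zero]
    · rw [if_neg hki.symm, if_neg hki, zero_mul, smul_zero]
  have hsum := (hs.mul_left (star (w i))).mul_right (w j)
  simp only [hterm] at hsum
  rw [star_smul, star_trivial, smul_mul_assoc, smul_mul_assoc, mul_smul_comm, smul_smul,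
    hsum.unique (hasSum_ite_eq i _)]
  split_ifs with hij
  · subst hij
    have : t i ≠ 0 := (ht i).ne'
    rw [smul_smul, show (t i)⁻¹ * (t i)⁻¹ * t i ^ 2 = 1 by field_simp, one_smul]
  · rw [smul_zero]

theorem cls_sq_sum_le_sum_cls (hw : ∀ i j, star (w i) * w j = if i = j then b i else 0)
    (hb : ∀ i, 0 ≤ b i) (n : ℕ) {f : B}
    (hf : f = ∑ i ∈ Finset.range n, t i ^ 2 • (w i * star (w i))) (hf0 : 0 ≤ f * f) :
    cls hf0 ≤ ∑ i ∈ Finset.range n, cls (hb i) := by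
  rw [sum_cls]
  refine cls_le_mk_posDiag hf0 hb (fun i => t i ^ 2 • star (w i)) ?_
  have hterm : ∀ i j, t i ^ 2 • (w i * star (w i)) * t j ^ 2 • (w j * star (w j)) =
      if i = j then star (t i ^ 2 • star (w i)) * b i * (t i ^ 2 • star (w i)) else 0 := by
    intro i j
    calc _ = t i ^ 2 • t j ^ 2 • (w i * (star (w i) * w j) * star (w j)) := by
          simp only [mul_smul_comm, smul_mul_assoc, mul_assoc]
          exact smul_comm _ _ _
      _ = _ := by
          rw [hw]
          split_ifs with hij
          · subst hij
            rw [star_smul, star_star, star_trivial (t i ^ 2), smul_mul_assoc, smul_mul_assoc,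
              mul_smul_comm]
          · rw [mul_zero, zero_mul, smul_zero, smul_zero]
  rw [hf, Finset.sum_mul_sum]
  refine Finset.sum_congr rfl fun i hi => ?_
  simp only [hterm, Finset.sum_ite_eq, hi, if_true]

end OrthogonalRoots

theorem exists_isLUB_cls {V : ℕ → B → B}
    (hV : ∀ p q c d, star (V p c) * V q d = if p = q then star c * d else 0)
    {b : ℕ → B} (hb : ∀ i, 0 ≤ b i) : ∃ (s : B) (hs : 0 ≤ s),
      IsLUB (Set.range fun n : ℕ => ∑ i ∈ Finset.range n, cls (hb i)) (cls hs) := by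
  obtain ⟨w, hw⟩ := exists_orthogonal_roots hV hb
  obtain ⟨t, ht, s, hs⟩ := exists_pos_summable_sq_smul fun i => w i * star (w i)
  have hterm : ∀ i, 0 ≤ t i ^ 2 • (w i * star (w i)) := fun i =>
    smul_nonneg (sq_nonneg _) (mul_star_self_nonneg _)
  have hs0 : 0 ≤ s := hs.nonneg hterm
  refine ⟨s, hs0, Set.forall_mem_range.2 (sum_cls_le_cls_of_hasSum hw ht hs hb hs0), fun u hu => ?_⟩
  obtain ⟨c, hc, rfl⟩ := exists_cls_eq hV u
  rw [cls_le_cls]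
  refine CuntzSub.of_forall_near fun e he => ?_
  obtain ⟨n, hn⟩ := (Metric.tendsto_nhds.1 hs.tendsto_sum_nat e he).exists
  rw [dist_comm, dist_eq_norm] at hn
  have hf : 0 ≤ ∑ i ∈ Finset.range n, t i ^ 2 • (w i * star (w i)) :=
    Finset.sum_nonneg fun i _ => hterm i
  refine ⟨_, (CuntzSub.mul_self hf).trans ?_, hn⟩
  rw [← cls_le_cls hf.isSelfAdjoint.mul_self_nonneg hc]
  exact (cls_sq_sum_le_sum_cls hw hb n rfl _).trans (hu ⟨n, rfl⟩)

end Classes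

end CuntzComparison

end

theorem theorem3p3 {A : Type u} [NonUnitalCStarAlgebra A] [PartialOrder A] [StarOrderedRing A]
    (hA : CuntzComparison.NuclearDimLEOmega.{u, v, w} A) :
    CuntzComparison.OmegaComparison (CuntzComparison.Cu A) := by
  intro x y hxy
  obtain ⟨V, hV⟩ := CuntzComparison.exists_isometries A
  obtain ⟨a, ha, rfl⟩ := CuntzComparison.exists_cls_eq hV x
  choose b hb hyb using fun i => CuntzComparison.exists_cls_eq hV (y i)
  obtain rfl : y = fun i => CuntzComparison.cls (hb i) := funext hyb
  choose k hk using fun i => (hxy i).ampSub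
  obtain ⟨s, hs, hlub⟩ := CuntzComparison.exists_isLUB_cls hV hb
  refine ⟨_, hlub, (CuntzComparison.cls_le_cls ha hs).2
    (CuntzComparison.CuntzSub.of_forall_near fun e he => ?_)⟩
  obtain ⟨N, z, hz⟩ := hA.exists_norm_sub_sum_conj_lt ha hb hk he
  have hsum : 0 ≤ ∑ i ∈ Finset.range N, star (z i) * b i * z i :=
    Finset.sum_nonneg fun i _ => star_left_conjugate_nonneg (hb i) _
  refine ⟨_, (CuntzComparison.cls_le_cls hsum hs).1 ?_, hz⟩
  exact (CuntzComparison.cls_le_mk_posDiag hsum hb z rfl).trans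
    ((CuntzComparison.sum_cls hb N).symm.trans_le (hlub.1 ⟨N, rfl⟩))
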